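/- **Setting.** Let $N\ge 0$. A planar $N$-cluster is a family $\mathcal E=(E_1,\dots,E_N)$ of pairwise disjoint nonempty open subsets of $\mathbb R^2$ of finite area; put $E_0=\mathbb R^2\setminus\bigcup_{i=1}^N E_i$. For $A\subset\mathbb R^2$, let $\partial^*A$ be the set of points at which the Lebesgue density of $A$ is neither $0$ nor $1$, let $P(A)=\mathcal H^1(\partial^*A)$, and let $B_A$ be the disk centred at the origin with the same area as $A$. For $\varepsilon>0$ put $$P_\varepsilon(\mathcal E)=\frac12\sum_{0\le i\ne j\le N}c_{ij}(\varepsilon)\,\mathcal H^1(\partial^*E_i\cap\partial^*E_j),\qquad c_{ij}(\varepsilon)=\begin{cases}1&\text{if } i=0\text{ or } j=0,\\ 2-\varepsilon&\text{otherwise.}\end{cases}$$ An arc of constant curvature is a nondegenerate segment or circular arc (possibly a whole circle). **Proposition 3.6.** Let $N\ge 0$ and $r_1,\dots,r_N>0$. There are constants $C\in\mathbb R$ and $\varepsilon_0>0$, depending only on $N$ and $r_1,\dots,r_N$, such that the following holds for every $\varepsilon\in(0,\varepsilon_0)$ and every planar $N$-cluster $\mathcal E=(E_1,\dots,E_N)$.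 Suppose that * $|E_i|=\pi r_i^2$ for $i=1,\dots,N$; * each topological boundary $\partial E_i$, $1\le i\le N$, is a union of finitely many arcs of constant curvature; * every two chambers $E_i,E_j$ with $1\le i<j\le N$ share at most one arc, that is, up to finitely many points $\partial E_i\cap\partial E_j$ is either empty or a single arc of constant curvature which, except at finitely many of its points, has $E_i$ on one fixed side and $E_j$ on the other. Then $$P_\varepsilon(\mathcal E)\ \ge\ \sum_{i=1}^N P(B_{E_i})-\frac43\,\varepsilon^{3/2}\sum_{1\le i<j\le N}\sigma_{ij}\,\frac{2r_ir_j}{r_i+r_j}-C\,\varepsilon^{5/2},$$ where $\sigma_{ij}=1$ if $\mathcal H^1(\partial^*E_i\cap\partial^*E_j)>0$ (the chambers share some boundary) and $\sigma_{ij}=0$ otherwise. -/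

import Mathlib

open MeasureTheory Set Filter Topology

/-! The plane is `ℂ`, with its Euclidean metric and Lebesgue measure `volume`; length is the
one-dimensional Hausdorff measure `μH[1]`. -/

noncomputable section

/-- The essential boundary of a set: the points at which its Lebesgue density is neither `0`
nor `1` (in particular those where the density does not exist). -/
def essBoundary (A : Set ℂ) : Set ℂ :=
  {x | ¬ Tendsto (fun ρ : ℝ => volume (A ∩ Metric.ball x ρ) / volume (Metric.ball x ρ))
          (𝓝[>] 0) (𝓝 0) ∧
       ¬ Tendsto (fun ρ : ℝ => volume (A ∩ Metric.ball x ρ) / volume (Metric.ball x ρ))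
          (𝓝[>] 0) (𝓝 1)}

/-- The perimeter of a set: the length of its essential boundary. -/
def perimeter (A : Set ℂ) : ℝ := (μH[1] (essBoundary A)).toReal

/-- The disk, centred at the origin, with the same area as `A`. -/
def equivDisk (A : Set ℂ) : Set ℂ := Metric.ball 0 (Real.sqrt ((volume A).toReal / Real.pi))

/-- A planar `N`-cluster: disjoint nonempty open sets of finite area. Regularity of the boundaries
is the separate condition `HasPiecewiseConstCurvBoundary`. -/
structure IsCluster {N : ℕ} (E : Fin N → Set ℂ) : Prop where
  isOpen : ∀ i, IsOpen (E i)
  nonempty : ∀ i, (E i).Nonempty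
  disjoint : ∀ i j, i ≠ j → Disjoint (E i) (E j)
  finite_area : ∀ i, volume (E i) < ⊤

/-- All the chambers: index `0` is the exterior chamber, the complement of the union of the `E i`;
index `i.succ` is `E i`. -/
def chamber {N : ℕ} (E : Fin N → Set ℂ) : Fin (N + 1) → Set ℂ :=
  Fin.cases (⋃ i, E i)ᶜ E

/-- The interface between two chambers (the exterior one allowed). -/
def interface {N : ℕ} (E : Fin N → Set ℂ) (i j : Fin (N + 1)) : Set ℂ :=
  essBoundary (chamber E i) ∩ essBoundary (chamber E j)

/-- The weights: `1` towards the exterior, `2 - ε` between two true chambers. -/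
def weight {N : ℕ} (ε : ℝ) (i j : Fin (N + 1)) : ℝ :=
  if i = 0 ∨ j = 0 then 1 else 2 - ε

/-- The weighted perimeter `P_ε`: half the sum over ordered pairs of distinct chambers. -/
def weightedPerimeter {N : ℕ} (ε : ℝ) (E : Fin N → Set ℂ) : ℝ :=
  (1 / 2) * ∑ i : Fin (N + 1), ∑ j : Fin (N + 1),
    if i = j then 0 else weight ε i j * (μH[1] (interface E i j)).toReal

/-- `γ`, restricted to `[0, L]`, is a unit-speed arc of constant signed curvature `κ` and
length `L > 0` without self-overlap: its unit tangent has angle `θ + κ t`. So it is a segment or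
an arc of a circle, possibly a whole circle. -/
structure IsCurvatureArc (γ : ℝ → ℂ) (κ L : ℝ) : Prop where
  length_pos : 0 < L
  hasDerivAt : ∃ θ : ℝ, ∀ t : ℝ,
    HasDerivAt γ (Complex.exp (((θ + κ * t : ℝ) : ℂ) * Complex.I)) t
  injOn : InjOn γ (Ico 0 L)

/-- The (topological) boundary of `A` is made of finitely many arcs of constant curvature. -/
def HasPiecewiseConstCurvBoundary (A : Set ℂ) : Prop :=
  ∃ S : Set (Set ℂ), S.Finite ∧
    (∀ Γ ∈ S, ∃ (γ : ℝ → ℂ) (κ L : ℝ), IsCurvatureArc γ κ L ∧ Γ = γ '' Icc 0 L) ∧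
    frontier A = ⋃₀ S

/-- `γ`, restricted to `[0, L]`, runs between `A` and `B`: except at finitely many parameters,
`A` lies immediately to its left and `B` immediately to its right. -/
def RunsBetween (γ : ℝ → ℂ) (L : ℝ) (A B : Set ℂ) : Prop :=
  ∃ T : Set ℝ, T.Finite ∧ ∀ t ∈ Ioo 0 L \ T, ∀ᶠ h : ℝ in 𝓝[>] 0,
    γ t + (h : ℂ) * (Complex.I * deriv γ t) ∈ A ∧ γ t - (h : ℂ) * (Complex.I * deriv γ t) ∈ B

/-- `A` and `B` share at most one arc: apart from finitely many points, their boundaries have in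
common either nothing or one arc of constant curvature, which runs between `A` and `B`.
(Reversing the arc exchanges left and right, so the condition is symmetric in `A` and `B`.) -/
def ShareAtMostOneArc (A B : Set ℂ) : Prop :=
  (frontier A ∩ frontier B).Finite ∨
  ∃ (γ : ℝ → ℂ) (κ L : ℝ) (F : Set ℂ), IsCurvatureArc γ κ L ∧ F.Finite ∧
    frontier A ∩ frontier B = γ '' Icc 0 L ∪ F ∧ RunsBetween γ L A B

open Classical in
/-- `σ_ij`: one if the chambers `E i` and `E j` share some boundary (of positive length), zero
otherwise. -/
def contact {N : ℕ} (E : Fin N → Set ℂ) (i j : Fin N) : ℝ :=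
  if 0 < μH[1] (interface E i.succ j.succ) then 1 else 0

end

/-! In `P_ε` a true interface has weight `2 - ε`, that is, one for each of its two sides minus `ε`.
Hence `P_ε(E) ≥ ∑ P(E_i) - ε ∑_{i<j} ℓ_ij`, where `ℓ_ij` is the length of the interface of `E_i` and
`E_j` (`sum_perimeter_sub_le_weightedPerimeter`). The loss linear in `ℓ_ij` has to be balanced by a
cubic gain in `∑ P(E_i)` over the perimeters of the disks.

The gain comes from a conflict of curvatures. The best boundary for `E_i` has curvature `b = 1/r_i`,
the best one for `E_j` has `c = 1/r_j`, but a shared arc has curvature `κ` seen from `E_i` and `-κ`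
seen from `E_j`. Replace, in the boundary of `E_i`, an arc of length `ℓ` and curvature `κ` by an arc
over the same chord with curvature close to `b`. If its length is `ℓ'` and the enclosed area grows
by `a`, the isoperimetric inequality for the modified region gives `P(E_i) ≥ 2π r_i + (ℓ - ℓ') + b a
- O(a²)`, which is `2π r_i + ℓ³ (κ - b)² / 24` up to higher order (`add_sum_deficit_le_perimeter`,
`le_deficit`). The two sides together gain `ℓ³ ((κ - b)² + (κ + c)²) / 24 ≥ ℓ³ (b + c)² / 48`, with
equality at `κ = (b - c) / 2` (`le_deficit_add_deficit`). With `s = b + c`, the function `ℓ³ s² / 48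
- ε ℓ` is least at `ℓ = 4 √ε / s`, with value `-(4/3) ε^(3/2) (2/s)`, and `2/s = 2 r_i r_j / (r_i +
r_j)`. Errors of order `ℓ⁵` become errors of order `ε^(5/2)` (`exists_pair_bound`).

Two precautions make the constants uniform. Only an initial piece of length `min ℓ_ij ℓ₀` of each
shared arc is replaced: on a longer interface this piece already gains more than `ε ℓ_ij`. And if
the total perimeter is at least twice that of the disks, the claim is immediate, so that interfaces
may be taken to have bounded length.

The new arcs may cross the old boundary and each other, so the modified region is not a set but an
integer valued function `n`: the indicator of `E` plus the fields bounded by the closed curves "new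
arc minus old arc". For such functions `4π ∫ n² ≤ M²`, where `M` bounds the mass of the boundary
(`IntField.isoperimetric`), and `n ≤ n²` turns this into a bound on the area
(`isoperimetric_of_replacement`). The proof uses the kernel `ū/u`, of modulus one, whose second
`dbar`-derivative is `4π` times the Dirac mass: testing the boundary of `n` with it bounds a
potential by `M`, and testing with the potential gives `M²`. The boundary is brought in by the
Gauss-Green formula for piecewise circular open sets (`gaussGreen`): normal coordinates at regular
points, no contribution at slits, and a cutoff at the finitely many remaining points. -/

noncomputable section
-- Oriented circles and arcs of constant curvature
open Complex

/-- The level function of the oriented circle (or line) through `p` with unit tangent `T` and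
signed curvature `κ`: it is positive to the left of the circle and negative to its right. -/
def lev (p T : ℂ) (κ : ℝ) (z : ℂ) : ℝ :=
  2 * ((z - p) * (starRingEnd ℂ) T).im - κ * normSq (z - p)

/-- `γ` runs with unit speed and constant curvature `κ`, and has tangent `T` at time `0`. -/
structure UnitArc (γ : ℝ → ℂ) (T : ℂ) (κ : ℝ) : Prop where
  norm_one : ‖T‖ = 1
  hasDerivAt : ∀ t : ℝ, HasDerivAt γ (T * exp (((κ * t : ℝ) : ℂ) * I)) t

lemma IsCurvatureArc.exists_unitArc {γ : ℝ → ℂ} {κ L : ℝ} (h : IsCurvatureArc γ κ L) :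
    ∃ T, UnitArc γ T κ := by
  obtain ⟨θ, hθ⟩ := h.hasDerivAt
  refine ⟨exp (θ * I), norm_exp_ofReal_mul_I θ, fun t => ?_⟩
  convert hθ t using 1
  rw [← exp_add]; push_cast; ring_nf

lemma continuous_lev (p T : ℂ) (κ : ℝ) : Continuous (lev p T κ) := by
  unfold lev
  have h1 : Continuous fun z : ℂ => ((z - p) * (starRingEnd ℂ) T).im :=
    continuous_im.comp (by fun_prop)
  have h2 : Continuous fun z : ℂ => normSq (z - p) := continuous_normSq.comp (by fun_prop)
  fun_prop

lemma lev_neg (p T : ℂ) (κ : ℝ) (z : ℂ) : lev p (-T) (-κ) z = -lev p T κ z := by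
  simp [lev]; ring

lemma re_sq_add_im_sq_eq_one {T : ℂ} (hT : ‖T‖ = 1) : T.re * T.re + T.im * T.im = 1 := by
  have := normSq_eq_norm_sq T
  rw [hT, normSq_apply] at this
  linarith

/-- Along a curve of constant curvature the unit tangent is an affine function of the position, here
`T + I * κ * (q - p)`. Its squared norm is `1 - κ * lev p T κ q`. -/
lemma norm_tangent_of_lev_eq_zero {p T : ℂ} {κ : ℝ} {q : ℂ} (hT : ‖T‖ = 1)
    (hq : lev p T κ q = 0) : ‖T + I * κ * (q - p)‖ = 1 := by
  have h := re_sq_add_im_sq_eq_one hT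
  have : normSq (T + I * κ * (q - p)) = 1 := by
    simp only [lev, normSq_apply, mul_im, conj_re, conj_im, sub_re, sub_im] at hq
    simp only [normSq_apply, add_re, add_im, mul_re, mul_im, I_re, I_im, ofReal_re, ofReal_im,
      sub_re, sub_im]
    linear_combination h - κ * hq
  rw [normSq_eq_norm_sq] at this
  nlinarith [norm_nonneg (T + I * κ * (q - p))]

/-- Any point of the circle can serve as base point; this is how local statements at `p` are
transported to the neighbouring points of the boundary. -/
lemma lev_rebase {p T : ℂ} {κ : ℝ} {q : ℂ} (hq : lev p T κ q = 0) (z : ℂ) :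
    lev q (T + I * κ * (q - p)) κ z = lev p T κ z := by
  simp only [lev, normSq_apply, mul_im, conj_re, conj_im, sub_re, sub_im] at hq
  simp only [lev, normSq_apply, add_re, add_im, mul_re, mul_im, I_re, I_im, ofReal_re, ofReal_im,
      sub_re, sub_im, conj_re, conj_im]
  linear_combination -hq

/-- In the frame `(T, iT)` at `p` the level function is `2 y - κ (x² + y²)`. -/
lemma lev_frame {p T : ℂ} {κ : ℝ} (hT : ‖T‖ = 1) (x y : ℝ) :
    lev p T κ (p + (x + y * I) * T) = 2 * y - κ * (x ^ 2 + y ^ 2) := by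
  have h := re_sq_add_im_sq_eq_one hT
  simp only [lev, normSq_apply, add_re, add_im, mul_re, mul_im, I_re, I_im, ofReal_re, ofReal_im,
      sub_re, sub_im, conj_re, conj_im]
  linear_combination (2 * y - κ * (x ^ 2 + y ^ 2)) * h

lemma exists_frame {T : ℂ} (hT : ‖T‖ = 1) (p z : ℂ) :
    ∃ x y : ℝ, z = p + (x + y * I) * T ∧ x ^ 2 + y ^ 2 = ‖z - p‖ ^ 2 := by
  have h0 : T ≠ 0 := by intro h; simp [h] at hT
  refine ⟨((z - p) / T).re, ((z - p) / T).im, ?_, ?_⟩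
  · rw [re_add_im, div_mul_cancel₀ _ h0]; ring
  · have := normSq_apply ((z - p) / T)
    rw [normSq_eq_norm_sq, norm_div, hT, div_one] at this
    linarith

lemma norm_frame_le {T : ℂ} (hT : ‖T‖ = 1) (x y : ℝ) : ‖((x : ℂ) + y * I) * T‖ ≤ |x| + |y| := by
  rw [norm_mul, hT, mul_one]
  refine (norm_add_le _ _).trans ?_
  simp

namespace UnitArc

variable {γ : ℝ → ℂ} {T : ℂ} {κ : ℝ}

lemma norm_deriv (T : ℂ) (hT : ‖T‖ = 1) (x : ℝ) : ‖T * exp ((x : ℂ) * I)‖ = 1 := by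
  rw [norm_mul, hT, norm_exp_ofReal_mul_I, one_mul]

lemma deriv_eq (h : UnitArc γ T κ) (t : ℝ) : deriv γ t = T * exp (((κ * t : ℝ) : ℂ) * I) :=
  (h.hasDerivAt t).deriv

lemma norm_deriv_eq (h : UnitArc γ T κ) (t : ℝ) : ‖deriv γ t‖ = 1 := by
  rw [h.deriv_eq, norm_deriv T h.norm_one]

lemma continuous (h : UnitArc γ T κ) : Continuous γ :=
  continuous_iff_continuousAt.2 fun t => (h.hasDerivAt t).continuousAt

lemma lipschitzWith (h : UnitArc γ T κ) : LipschitzWith 1 γ := by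
  refine lipschitzWith_of_nnnorm_deriv_le (fun t => (h.hasDerivAt t).differentiableAt) fun t => ?_
  rw [← NNReal.coe_le_coe]
  simpa using (h.norm_deriv_eq t).le

/-- The chord of a circular arc. -/
lemma chord (h : UnitArc γ T κ) (s t : ℝ) :
    γ t - γ s = ((t - s : ℝ) * Real.sinc (κ * (t - s) / 2) : ℝ) *
      (T * exp (((κ * (t + s) / 2 : ℝ) : ℂ) * I)) := by
  rcases eq_or_ne κ 0 with rfl | hκ
  · have hd : ∀ u, HasDerivAt (fun u : ℝ => γ u - u * T) 0 u := fun u => by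
      have h1 := (h.hasDerivAt u).sub ((ofRealCLM.hasDerivAt (x := u)).mul_const T)
      exact h1.congr_deriv (by simp)
    have := is_const_of_deriv_eq_zero (fun u => (hd u).differentiableAt) (fun u => (hd u).deriv) t s
    simp only [zero_mul, zero_div, Real.sinc_zero, mul_one, ofReal_zero, exp_zero]
    push_cast
    linear_combination this
  · have hκ' : (κ : ℂ) ≠ 0 := by exact_mod_cast hκ
    have hd : ∀ u, HasDerivAt (fun u : ℝ => γ u - T * exp (((κ * u : ℝ) : ℂ) * I) / (κ * I)) 0 u := by
      intro u
      have h0 : HasDerivAt (fun u : ℝ => ((κ * u : ℝ) : ℂ) * I) (κ * I) u := by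
        have := ((ofRealCLM.hasDerivAt (x := u)).const_mul (κ : ℂ)).mul_const I
        simpa using this
      have h1 := (h.hasDerivAt u).sub ((h0.cexp.const_mul T).div_const (κ * I))
      refine h1.congr_deriv ?_
      have hI := I_ne_zero
      field_simp
      simp
    have := is_const_of_deriv_eq_zero (fun u => (hd u).differentiableAt) (fun u => (hd u).deriv) t s
    have e1 : exp (((κ * t : ℝ) : ℂ) * I) = exp (((κ * (t + s) / 2 : ℝ) : ℂ) * I) *
        exp (((κ * (t - s) / 2 : ℝ) : ℂ) * I) := by
      rw [← exp_add]; push_cast; ring_nf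
    have e2 : exp (((κ * s : ℝ) : ℂ) * I) = exp (((κ * (t + s) / 2 : ℝ) : ℂ) * I) *
        exp (-((κ * (t - s) / 2 : ℝ) : ℂ) * I) := by
      rw [← exp_add]; push_cast; ring_nf
    have e3 : ((t - s) * Real.sinc (κ * (t - s) / 2) : ℝ) = 2 * Real.sin (κ * (t - s) / 2) / κ := by
      rcases eq_or_ne t s with rfl | hts
      · simp
      · rw [Real.sinc_of_ne_zero (by
          have := sub_ne_zero.2 hts
          positivity)]
        have := sub_ne_zero.2 hts
        field_simp
    have e4 : ((Real.sin (κ * (t - s) / 2) : ℝ) : ℂ) * (2 * I) =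
        exp (((κ * (t - s) / 2 : ℝ) : ℂ) * I) - exp (-((κ * (t - s) / 2 : ℝ) : ℂ) * I) := by
      rw [ofReal_sin, Complex.sin]
      linear_combination (exp (-((κ * (t - s) / 2 : ℝ) : ℂ) * I) - exp (((κ * (t - s) / 2 : ℝ) : ℂ) * I)) * I_mul_I
    rw [e3]
    have e5 : γ t - γ s = T * exp (((κ * (t + s) / 2 : ℝ) : ℂ) * I) *
       (exp (((κ * (t - s) / 2 : ℝ) : ℂ) * I) - exp (-((κ * (t - s) / 2 : ℝ) : ℂ) * I)) / (κ * I) := by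
      rw [e1, e2] at this
      linear_combination this
    rw [e5, ← e4]
    push_cast
    field_simp

lemma norm_chord (h : UnitArc γ T κ) (s t : ℝ) :
    ‖γ t - γ s‖ = |t - s| * |Real.sinc (κ * (t - s) / 2)| := by
  rw [h.chord, norm_mul, norm_deriv T h.norm_one, mul_one, norm_real, norm_mul]
  simp

lemma sinc_ne_zero {x : ℝ} (hx : |x| < Real.pi) : Real.sinc x ≠ 0 := by
  rcases eq_or_ne x 0 with rfl | h0
  · simp
  · rw [Real.sinc_of_ne_zero h0]
    refine div_ne_zero (fun hs => h0 ?_) h0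
    exact (Real.sin_eq_zero_iff_of_lt_of_lt (abs_lt.1 hx).1 (abs_lt.1 hx).2).1 hs

/-- Less than a full turn: the chord is the arc length times `sinc`, which has no zero in `(-π, π)`.
-/
lemma eq_of_eq (h : UnitArc γ T κ) {s t : ℝ} (hst : |κ| * |t - s| < 2 * Real.pi)
    (he : γ t = γ s) : t = s := by
  have := h.norm_chord s t
  rw [he, sub_self, norm_zero] at this
  rcases mul_eq_zero.1 this.symm with h1 | h1
  · linarith [abs_eq_zero.1 h1]
  · refine absurd (abs_eq_zero.1 h1) (sinc_ne_zero ?_)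
    rw [abs_div, abs_mul, abs_two]; linarith

/-- A longer arc would return to its initial point at time `2π / |κ| < L`. -/
lemma curv_mul_le (h : UnitArc γ T κ) {L : ℝ} (hL : 0 < L) (hi : InjOn γ (Ico 0 L)) :
    |κ| * L ≤ 2 * Real.pi := by
  by_contra! hc
  have hκ : 0 < |κ| := by
    by_contra! h0
    have : |κ| = 0 := le_antisymm h0 (abs_nonneg _)
    rw [this] at hc
    linarith [Real.pi_pos]
  have hp := Real.pi_pos
  have h1 : 2 * Real.pi / |κ| < L := by rw [div_lt_iff₀ hκ]; linarith
  have h2 : 0 < 2 * Real.pi / |κ| := by positivity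
  have h3 : γ (2 * Real.pi / |κ|) = γ 0 := by
    have := h.norm_chord 0 (2 * Real.pi / |κ|)
    rw [sub_zero] at this
    have h4 : Real.sinc (κ * (2 * Real.pi / |κ|) / 2) = 0 := by
      rcases abs_cases κ with ⟨hk, _⟩ | ⟨hk, _⟩
      · rw [hk] at hκ ⊢
        rw [show κ * (2 * Real.pi / κ) / 2 = Real.pi by field_simp,
          Real.sinc_of_ne_zero hp.ne']; simp
      · rw [hk] at hκ ⊢
        rw [show κ * (2 * Real.pi / -κ) / 2 = -Real.pi by
          have : κ ≠ 0 := by intro h; simp [h] at hκ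
          field_simp, Real.sinc_neg,
          Real.sinc_of_ne_zero hp.ne']; simp
    rw [h4, abs_zero, mul_zero, norm_eq_zero, sub_eq_zero] at this
    exact this
  have := hi ⟨h2.le, h1⟩ ⟨le_rfl, hL⟩ h3
  linarith

lemma mul_sinc_half (κ t : ℝ) : κ * (t * Real.sinc (κ * t / 2)) = 2 * Real.sin (κ * t / 2) := by
  rcases eq_or_ne (κ * t / 2) 0 with h0 | h0
  · rw [h0, Real.sinc_zero, Real.sin_zero]; linarith
  · rw [Real.sinc_of_ne_zero h0]
    have h1 : κ ≠ 0 := by rintro rfl; simp at h0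
    have h2 : t ≠ 0 := by rintro rfl; simp at h0
    field_simp

/-- The tangent as a function of the position. -/
lemma tangent_eq (h : UnitArc γ T κ) (t : ℝ) :
    T * exp (((κ * t : ℝ) : ℂ) * I) = T + I * κ * (γ t - γ 0) := by
  have hc := h.chord 0 t
  rw [sub_zero, add_zero] at hc
  have e4 : ((Real.sin (κ * t / 2) : ℝ) : ℂ) * (2 * I) =
        exp (((κ * t / 2 : ℝ) : ℂ) * I) - exp (-((κ * t / 2 : ℝ) : ℂ) * I) := by
      rw [ofReal_sin, Complex.sin]
      linear_combination (exp (-((κ * t / 2 : ℝ) : ℂ) * I) - exp (((κ * t / 2 : ℝ) : ℂ) * I)) * I_mul_I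
  have e5 : I * κ * (γ t - γ 0) = (I * (κ * (t * Real.sinc (κ * t / 2)) : ℝ)) *
      (T * exp (((κ * t / 2 : ℝ) : ℂ) * I)) := by rw [hc]; push_cast; ring
  rw [e5, mul_sinc_half]
  have e6 : exp (((κ * t : ℝ) : ℂ) * I) = exp (((κ * t / 2 : ℝ) : ℂ) * I) *
        exp (((κ * t / 2 : ℝ) : ℂ) * I) := by
      rw [← exp_add]; push_cast; ring_nf
  have e7 : exp (-((κ * t / 2 : ℝ) : ℂ) * I) * exp (((κ * t / 2 : ℝ) : ℂ) * I) = 1 := by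
    rw [← exp_add]; ring_nf; exact exp_zero
  push_cast at e4 e6 e7 ⊢
  rw [e6]
  linear_combination (-T * exp (κ * t / 2 * I)) * e4 + T * e7

lemma lev_eq_zero (h : UnitArc γ T κ) (t : ℝ) : lev (γ 0) T κ (γ t) = 0 := by
  have hc := h.chord 0 t
  rw [sub_zero, add_zero] at hc
  set a := t * Real.sinc (κ * t / 2) with ha
  have h1 : κ * a = 2 * Real.sin (κ * t / 2) := mul_sinc_half κ t
  have h2 := re_sq_add_im_sq_eq_one h.norm_one
  have h3 := Real.sin_sq_add_cos_sq (κ * t / 2)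
  unfold lev
  rw [hc, exp_mul_I, ← ofReal_cos, ← ofReal_sin]
  generalize κ * t / 2 = x at *
  simp only [normSq_apply, add_re, add_im, mul_re, mul_im, I_re, I_im, ofReal_re, ofReal_im,
      conj_re, conj_im]
  linear_combination (-a * (Real.sin x ^ 2 + Real.cos x ^ 2) * (T.re * T.re + T.im * T.im)) * h1 +
    (2 * a * Real.sin x) * (T.re * T.re + T.im * T.im) * (-h3)

lemma reverse (h : UnitArc γ T κ) (a : ℝ) :
    UnitArc (fun t => γ (a - t)) (-(T * exp (((κ * a : ℝ) : ℂ) * I))) (-κ) := by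
  refine ⟨by rw [norm_neg]; exact norm_deriv T h.norm_one _, fun t => ?_⟩
  have := (h.hasDerivAt (a - t)).scomp t ((hasDerivAt_id t).const_sub a)
  refine this.congr_deriv ?_
  simp only [neg_smul, one_smul, neg_mul]
  rw [mul_assoc, ← exp_add]; push_cast; ring_nf

lemma exists_arc (p : ℂ) {T : ℂ} (hT : ‖T‖ = 1) (κ : ℝ) : ∃ γ : ℝ → ℂ, UnitArc γ T κ ∧ γ 0 = p := by
  have hc : Continuous fun t : ℝ => T * exp (((κ * t : ℝ) : ℂ) * I) := by fun_prop
  refine ⟨fun t => p + ∫ s in (0:ℝ)..t, T * exp (((κ * s : ℝ) : ℂ) * I), ⟨hT, fun t => ?_⟩, by simp⟩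
  exact (intervalIntegral.integral_hasDerivAt_right (hc.intervalIntegrable _ _)
    hc.stronglyMeasurable.stronglyMeasurableAtFilter hc.continuousAt).const_add p

lemma analyticAt_exp (κ t : ℝ) : AnalyticAt ℝ (fun t : ℝ => exp (((κ * t : ℝ) : ℂ) * I)) t := by
  have h1 : AnalyticAt ℝ (fun t : ℝ => ((κ * t : ℝ) : ℂ) * I) t := by
    have h0 : AnalyticAt ℝ (fun t : ℝ => (ofRealCLM (κ * t)) * I) t := by
      refine AnalyticAt.mul ?_ analyticAt_const
      exact (ofRealCLM.analyticAt _).comp (analyticAt_const.mul analyticAt_id)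
    exact h0
  exact (analyticAt_cexp.restrictScalars (𝕜 := ℝ)).comp h1

lemma analyticAt (h : UnitArc γ T κ) (t : ℝ) : AnalyticAt ℝ γ t := by
  rcases eq_or_ne κ 0 with rfl | hκ
  · have : γ = fun t => γ 0 + ofRealCLM t * T := by
      funext t
      have := h.chord 0 t
      simp only [zero_mul, zero_div, Real.sinc_zero, mul_one, ofReal_zero, exp_zero, sub_zero] at this
      rw [ofRealCLM_apply, ← this]; ring
    rw [this]
    exact analyticAt_const.add ((ofRealCLM.analyticAt _).mul analyticAt_const)
  · have hκ' : (κ : ℂ) ≠ 0 := by exact_mod_cast hκ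
    have : γ = fun t => γ 0 + (T * exp (((κ * t : ℝ) : ℂ) * I) - T) * (I * κ)⁻¹ := by
      funext t
      rw [h.tangent_eq t]
      field_simp
      ring
    rw [this]
    exact analyticAt_const.add (((analyticAt_const.mul (analyticAt_exp κ t)).sub
      analyticAt_const).mul analyticAt_const)

/-- An arc either stays on a given circle or meets it in finitely many points. -/
lemma lev_eq_zero_or_finite (h : UnitArc γ T κ) (q S : ℂ) (μ : ℝ) (a b : ℝ) :
    (∀ t, lev q S μ (γ t) = 0) ∨ {t ∈ Icc a b | lev q S μ (γ t) = 0}.Finite := by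
  have hre : ∀ (f : ℝ → ℂ) t, AnalyticAt ℝ f t → AnalyticAt ℝ (fun t => (f t).re) t :=
    fun f t hf => (reCLM.analyticAt _).comp hf
  have him : ∀ (f : ℝ → ℂ) t, AnalyticAt ℝ f t → AnalyticAt ℝ (fun t => (f t).im) t :=
    fun f t hf => (imCLM.analyticAt _).comp hf
  -- The level function along the arc is real analytic in the parameter, so infinitely many zeros in
  -- a compact interval force it to vanish identically.
  have ha : AnalyticOnNhd ℝ (fun t => lev q S μ (γ t)) univ := by
    intro t _
    have h1 : AnalyticAt ℝ (fun t => γ t - q) t := (h.analyticAt t).sub analyticAt_const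
    have h2 := hre _ _ h1
    have h3 := him _ _ h1
    simp only [lev, normSq_apply]
    exact (analyticAt_const.mul (him _ _ (h1.mul analyticAt_const))).sub
      (analyticAt_const.mul ((h2.mul h2).add (h3.mul h3)))
  by_cases hz : ∀ t, lev q S μ (γ t) = 0
  · exact Or.inl hz
  · right
    push Not at hz
    obtain ⟨t₀, ht₀⟩ := hz
    by_contra hinf
    obtain ⟨x, hx, hacc⟩ := Set.Infinite.exists_accPt_of_subset_isCompact hinf isCompact_Icc
      (fun t ht => ht.1)
    have hf : ∃ᶠ z in 𝓝[≠] x, lev q S μ (γ z) = 0 :=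
      (accPt_iff_frequently_nhdsNE.1 hacc).mono fun z hz => hz.2
    have := ha.eqOn_zero_of_preconnected_of_frequently_eq_zero isPreconnected_univ (mem_univ x) hf
    exact ht₀ (this (mem_univ t₀))

end UnitArc
end

/-! ### Arc length as one-dimensional Hausdorff measure -/

noncomputable section
open Complex

namespace UnitArc

variable {γ : ℝ → ℂ} {T : ℂ} {κ : ℝ}

/-- The ratio of chord to arc is `|sinc|`, which tends to `1`: at short distances the inverse of `γ`
is `K`-Lipschitz, for any `K > 1`. -/
lemma exists_expansion (h : UnitArc γ T κ) {K : NNReal} (hK : 1 < K) :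
    ∃ δ > 0, ∀ s t : ℝ, |t - s| < δ → |t - s| ≤ K * ‖γ t - γ s‖ := by
  have hK0 : (0 : ℝ) < K := by exact_mod_cast zero_lt_one.trans hK
  have hK1 : ((K : ℝ))⁻¹ < 1 := inv_lt_one_of_one_lt₀ (by exact_mod_cast hK)
  have hc : ContinuousAt (fun u : ℝ => Real.sinc (κ * u / 2)) 0 :=
    (Real.continuous_sinc.comp (by fun_prop)).continuousAt
  have : ∀ᶠ u in 𝓝 (0 : ℝ), (K : ℝ)⁻¹ < Real.sinc (κ * u / 2) :=
    hc.eventually_const_lt (by simpa using hK1)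
  obtain ⟨δ, hδ, hball⟩ := Metric.eventually_nhds_iff.1 this
  refine ⟨δ, hδ, fun s t hst => ?_⟩
  have h1 := hball (y := t - s) (by simpa using hst)
  rw [h.norm_chord]
  have h2 : 1 ≤ K * |Real.sinc (κ * (t - s) / 2)| := by
    have := h1.le.trans (le_abs_self _)
    rwa [inv_le_iff_one_le_mul₀' hK0] at this
  nlinarith [abs_nonneg (t - s)]

lemma hausdorffMeasure_image_le (h : UnitArc γ T κ) (S : Set ℝ) : μH[1] (γ '' S) ≤ volume S := by
  have := h.lipschitzWith.hausdorffMeasure_image_le zero_le_one S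
  simpa [hausdorffMeasure_real] using this

/-- The set is cut into pieces of diameter less than the `δ` of `exists_expansion`, on which the
inverse of `γ` is `K`-Lipschitz. Injectivity lets the measures of the images add up, and then `K`
tends to `1`. -/
lemma volume_le_hausdorffMeasure_image (h : UnitArc γ T κ) {S : Set ℝ} (hS : MeasurableSet S)
    (hi : InjOn γ S) : volume S ≤ μH[1] (γ '' S) := by
  have key : ∀ K : NNReal, 1 < K → volume S ≤ K * μH[1] (γ '' S) := by
    intro K hK
    obtain ⟨δ, hδ, hexp⟩ := h.exists_expansion hK
    set P : ℤ → Set ℝ := fun n => S ∩ Ico (n • δ) ((n + 1) • δ) with hP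
    have hPm : ∀ n, MeasurableSet (P n) := fun n => hS.inter measurableSet_Ico
    have hPd : Pairwise (Function.onFun Disjoint P) := by
      intro m n hmn
      have := pairwise_disjoint_Ico_zsmul δ hmn
      exact this.mono inter_subset_right inter_subset_right
    have hPU : ⋃ n, P n = S := by
      rw [hP, ← inter_iUnion, iUnion_Ico_zsmul hδ, inter_univ]
    have hPS : ∀ n, P n ⊆ S := fun n => inter_subset_left
    have h1 : ∀ n, volume (P n) ≤ K * μH[1] (γ '' P n) := by
      intro n
      have hL : LipschitzOnWith K (Function.invFunOn γ (P n)) (γ '' P n) := by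
        refine LipschitzOnWith.of_dist_le_mul ?_
        rintro _ ⟨t, ht, rfl⟩ _ ⟨s, hs, rfl⟩
        rw [(hi.mono (hPS n)).leftInvOn_invFunOn ht, (hi.mono (hPS n)).leftInvOn_invFunOn hs,
          Real.dist_eq, dist_eq_norm]
        refine hexp s t ?_
        have a1 := ht.2
        have a2 := hs.2
        simp only [mem_Ico, zsmul_eq_mul, Int.cast_add, Int.cast_one, add_mul, one_mul] at a1 a2
        rw [abs_lt]; constructor <;> linarith
      have := hL.hausdorffMeasure_image_le zero_le_one
      rw [(hi.mono (hPS n)).leftInvOn_invFunOn.image_image, hausdorffMeasure_real] at this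
      simpa using this
    have hPim : ∀ n, MeasurableSet (γ '' P n) := fun n =>
      (hPm n).image_of_continuousOn_injOn h.continuous.continuousOn (hi.mono (hPS n))
    have hPid : Pairwise (Function.onFun Disjoint fun n => γ '' P n) := by
      intro m n hmn
      have hd : Disjoint (P m) (P n) := hPd hmn
      change Disjoint (γ '' P m) (γ '' P n)
      rw [disjoint_iff_inter_eq_empty] at hd ⊢
      rw [← hi.image_inter (hPS m) (hPS n), hd, image_empty]
    calc volume S = ∑' n, volume (P n) := by rw [← measure_iUnion hPd hPm, hPU]
      _ ≤ ∑' n, K * μH[1] (γ '' P n) := ENNReal.tsum_le_tsum h1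
      _ = K * μH[1] (γ '' S) := by
        rw [ENNReal.tsum_mul_left, ← measure_iUnion hPid hPim, ← image_iUnion, hPU]
  have hlim : Tendsto (fun n : ℕ => ((1 + 1 / ((n : NNReal) + 1) : NNReal) : ENNReal) * μH[1] (γ '' S))
      atTop (𝓝 (((1 + 0 : NNReal) : ENNReal) * μH[1] (γ '' S))) := by
    refine ENNReal.Tendsto.mul_const (ENNReal.tendsto_coe.2 ?_) (Or.inl (by simp))
    exact tendsto_const_nhds.add tendsto_one_div_add_atTop_nhds_zero_nat
  have := ge_of_tendsto' hlim fun n => key _ (by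
    have : (0 : NNReal) < 1 / ((n : NNReal) + 1) := by positivity
    exact lt_add_of_pos_right 1 this)
  simpa using this

lemma hausdorffMeasure_image (h : UnitArc γ T κ) {S : Set ℝ} (hS : MeasurableSet S)
    (hi : InjOn γ S) : μH[1] (γ '' S) = volume S :=
  (h.hausdorffMeasure_image_le S).antisymm (h.volume_le_hausdorffMeasure_image hS hi)

lemma measurableSet_image (h : UnitArc γ T κ) {S : Set ℝ} (hS : MeasurableSet S)
    (hi : InjOn γ S) : MeasurableSet (γ '' S) :=
  hS.image_of_continuousOn_injOn h.continuous.continuousOn hi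

/-- Arc length is the one-dimensional Hausdorff measure. -/
lemma map_restrict (h : UnitArc γ T κ) {S : Set ℝ} (hS : MeasurableSet S)
    (hi : InjOn γ S) : (volume.restrict S).map γ = μH[1].restrict (γ '' S) := by
  ext A hA
  rw [Measure.map_apply h.continuous.measurable hA, Measure.restrict_apply
    (h.continuous.measurable hA), Measure.restrict_apply hA, ← image_preimage_inter,
    h.hausdorffMeasure_image ((h.continuous.measurable hA).inter hS) (hi.mono inter_subset_right)]

lemma setIntegral_image (h : UnitArc γ T κ) {S : Set ℝ} (hS : MeasurableSet S)
    (hi : InjOn γ S) {φ : ℂ → ℂ} (hφ : AEStronglyMeasurable φ (μH[1].restrict (γ '' S))) :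
    ∫ z in γ '' S, φ z ∂μH[1] = ∫ t in S, φ (γ t) := by
  rw [← h.map_restrict hS hi] at hφ ⊢
  rw [integral_map h.continuous.aemeasurable hφ]

end UnitArc
end

/-! ### Regular boundary points -/

noncomputable section
open Complex

/-- `p` is a regular boundary point of `E` with tangent `T`: near `p` the set `E` is the region to
the left of an oriented circle or line. -/
def RegularWith (E : Set ℂ) (p T : ℂ) : Prop :=
  ‖T‖ = 1 ∧ ∃ κ ρ : ℝ, 0 < ρ ∧ ∀ z ∈ Metric.ball p ρ, (z ∈ E ↔ 0 < lev p T κ z)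

/-- The regular boundary points of `E`. -/
def regBoundary (E : Set ℂ) : Set ℂ := {p | ∃ T, RegularWith E p T}

open Classical in
/-- The unit tangent at a regular boundary point, with `E` on the left. -/
def tangent (E : Set ℂ) (p : ℂ) : ℂ := if h : ∃ T, RegularWith E p T then h.choose else 0

/-- Near `p` the set `E` is null or conull. -/
def NullType (E : Set ℂ) (p : ℂ) : Prop :=
  ∃ ρ : ℝ, 0 < ρ ∧ (volume (Metric.ball p ρ ∩ E) = 0 ∨ volume (Metric.ball p ρ \ E) = 0)

lemma lev_add_smul (p T : ℂ) (κ : ℝ) (v : ℂ) (h : ℝ) :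
    lev p T κ (p + h * v) = h * (2 * (v * (starRingEnd ℂ) T).im - h * (κ * normSq v)) := by
  simp only [lev, normSq_apply, add_re, add_im, mul_re, mul_im, ofReal_re, ofReal_im,
      sub_re, sub_im, conj_re, conj_im]
  ring

/-- The sign of the level function along a ray is that of the slope. -/
lemma eventually_lev_pos {T v : ℂ} (p : ℂ) (κ : ℝ) (hv : 0 < (v * (starRingEnd ℂ) T).im) :
    ∀ᶠ h : ℝ in 𝓝[>] 0, 0 < lev p T κ (p + h * v) := by
  have hc : Tendsto (fun h : ℝ => 2 * (v * (starRingEnd ℂ) T).im - h * (κ * normSq v)) (𝓝[>] 0)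
      (𝓝 (2 * (v * (starRingEnd ℂ) T).im - 0 * (κ * normSq v))) :=
    ((Continuous.tendsto (by fun_prop) 0).mono_left nhdsWithin_le_nhds)
  filter_upwards [hc.eventually_const_lt (u := 0) (by linarith), self_mem_nhdsWithin] with h h1 h2
  rw [lev_add_smul]
  exact mul_pos h2 h1

lemma eventually_lev_neg {T v : ℂ} (p : ℂ) (κ : ℝ) (hv : (v * (starRingEnd ℂ) T).im < 0) :
    ∀ᶠ h : ℝ in 𝓝[>] 0, lev p T κ (p + h * v) < 0 := by
  have := eventually_lev_pos (T := -T) (v := v) p (-κ) (by simp at hv ⊢; linarith)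
  simpa only [lev_neg, Left.neg_pos_iff] using this

lemma eventually_ray_mem (p v : ℂ) {ρ : ℝ} (hρ : 0 < ρ) :
    ∀ᶠ h : ℝ in 𝓝[>] 0, p + h * v ∈ Metric.ball p ρ := by
  have hc : Tendsto (fun h : ℝ => p + h * v) (𝓝[>] 0) (𝓝 (p + (0 : ℝ) * v)) :=
    (Continuous.tendsto (by fun_prop) 0).mono_left nhdsWithin_le_nhds
  exact hc (by simpa using Metric.ball_mem_nhds p hρ)

/-- If `T ≠ T'`, the ray in the direction `I * (T - T')` enters the left side of one circle and the
right side of the other. -/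
lemma RegularWith.unique {E : Set ℂ} {p T T' : ℂ} (h : RegularWith E p T)
    (h' : RegularWith E p T') : T = T' := by
  obtain ⟨hT, κ, ρ, hρ, hE⟩ := h
  obtain ⟨hT', κ', ρ', hρ', hE'⟩ := h'
  by_contra hne
  have e1 := re_sq_add_im_sq_eq_one hT
  have e2 := re_sq_add_im_sq_eq_one hT'
  have hpos : 0 < (T.re - T'.re) ^ 2 + (T.im - T'.im) ^ 2 := by
    by_contra! hc
    refine hne (Complex.ext ?_ ?_)
    · nlinarith [sq_nonneg (T.re - T'.re), sq_nonneg (T.im - T'.im)]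
    · nlinarith [sq_nonneg (T.re - T'.re), sq_nonneg (T.im - T'.im)]
  have hv : 0 < (I * (T - T') * (starRingEnd ℂ) T).im := by
    simp; nlinarith
  have hv' : (I * (T - T') * (starRingEnd ℂ) T').im < 0 := by
    simp; nlinarith
  obtain ⟨s, h1, h2, h3, h4⟩ := ((eventually_lev_pos p κ hv).and ((eventually_lev_neg p κ' hv').and
    ((eventually_ray_mem p (I * (T - T')) hρ).and (eventually_ray_mem p (I * (T - T')) hρ')))).exists
  exact absurd ((hE' _ h4).1 ((hE _ h3).2 h1)) (not_lt.2 h2.le)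

lemma RegularWith.mem {E : Set ℂ} {p T : ℂ} (h : RegularWith E p T) : p ∈ regBoundary E := ⟨T, h⟩

lemma RegularWith.tangent_eq {E : Set ℂ} {p T : ℂ} (h : RegularWith E p T) : tangent E p = T := by
  have h1 : ∃ T, RegularWith E p T := ⟨T, h⟩
  rw [tangent, dif_pos h1]
  exact h1.choose_spec.unique h

/-- Regularity propagates along the circle. -/
lemma regularWith_of_lev_eq_zero {E : Set ℂ} {p T : ℂ} {κ ρ : ℝ} (hT : ‖T‖ = 1)
    (hE : ∀ z ∈ Metric.ball p ρ, (z ∈ E ↔ 0 < lev p T κ z)) {q : ℂ} (hq : q ∈ Metric.ball p ρ)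
    (h0 : lev p T κ q = 0) : RegularWith E q (T + I * κ * (q - p)) := by
  refine ⟨norm_tangent_of_lev_eq_zero hT h0, κ, ρ - dist q p, by simpa using hq, fun z hz => ?_⟩
  rw [lev_rebase h0]
  refine hE z ?_
  have := dist_triangle z q p
  simp at hz ⊢; linarith

/-- In the frame `(T, iT)` the ball lies above height `h / 2`, so the linear part of `2 y - κ (x² +
y²)` exceeds `h`, while the quadratic part is at most `4 |κ| h² < h`. -/
lemma ball_subset_lev_pos {p T : ℂ} (κ : ℝ) (hT : ‖T‖ = 1) :
    ∃ δ : ℝ, δ > 0 ∧ ∀ h : ℝ, 0 < h → h < δ → ∀ z ∈ Metric.ball (p + h * (I * T)) (h / 2),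
      z ∈ Metric.ball p (2 * h) ∧ 0 < lev p T κ z := by
  refine ⟨1 / (4 * (|κ| + 1)), by positivity, fun h h0 h1 z hz => ?_⟩
  rw [lt_div_iff₀ (by positivity)] at h1
  obtain ⟨x, y, rfl, -⟩ := exists_frame hT p z
  have hz' : ‖((x : ℂ) + (y - h : ℝ) * I) * T‖ < h / 2 := by
    rw [Metric.mem_ball, dist_eq_norm] at hz
    refine lt_of_eq_of_lt ?_ hz
    congr 1; push_cast; ring
  rw [norm_mul, hT, mul_one] at hz'
  have hx : |x| ≤ ‖(x : ℂ) + (y - h : ℝ) * I‖ := by simpa using abs_re_le_norm ((x : ℂ) + (y - h : ℝ) * I)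
  have hy : |y - h| ≤ ‖(x : ℂ) + (y - h : ℝ) * I‖ := by simpa using abs_im_le_norm ((x : ℂ) + (y - h : ℝ) * I)
  have hx1 := abs_lt.1 (hx.trans_lt hz')
  have hy1 := abs_lt.1 (hy.trans_lt hz')
  have hsq : ‖((x : ℂ) + y * I)‖ ^ 2 = x ^ 2 + y ^ 2 := by
    rw [← normSq_eq_norm_sq, normSq_add_mul_I]
  constructor
  · rw [Metric.mem_ball, dist_eq_norm, add_sub_cancel_left, norm_mul, hT, mul_one]
    refine lt_of_pow_lt_pow_left₀ 2 (by positivity) ?_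
    rw [hsq]; nlinarith
  · rw [lev_frame hT]
    have hk := le_abs_self κ
    have : x ^ 2 + y ^ 2 ≤ 4 * h ^ 2 := by nlinarith
    have h3 : κ * (x ^ 2 + y ^ 2) ≤ |κ| * (4 * h ^ 2) :=
      mul_le_mul hk this (by positivity) (abs_nonneg _)
    nlinarith

/-- Near a regular point both `E` and its complement contain balls of comparable size. -/
lemma RegularWith.exists_balls {E : Set ℂ} {p T : ℂ} (h : RegularWith E p T) :
    ∃ δ : ℝ, δ > 0 ∧ ∀ h : ℝ, 0 < h → h < δ →
      (Metric.ball (p + h * (I * T)) (h / 2) ⊆ Metric.ball p (2 * h) ∩ E) ∧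
      (Metric.ball (p - h * (I * T)) (h / 2) ⊆ Metric.ball p (2 * h) \ E) := by
  obtain ⟨hT, κ, ρ, hρ, hE⟩ := h
  obtain ⟨δ₁, hδ₁, h1⟩ := ball_subset_lev_pos (p := p) κ hT
  obtain ⟨δ₂, hδ₂, h2⟩ := ball_subset_lev_pos (p := p) (T := -T) (-κ) (by simpa using hT)
  refine ⟨min (ρ / 2) (min δ₁ δ₂), by positivity, fun h h0 hh => ?_⟩
  simp only [lt_min_iff] at hh
  constructor
  · intro z hz
    obtain ⟨a, b⟩ := h1 h h0 hh.2.1 z hz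
    exact ⟨a, (hE z (Metric.ball_subset_ball (by linarith) a)).2 b⟩
  · intro z hz
    obtain ⟨a, b⟩ := h2 h h0 hh.2.2 z (by
      convert hz using 2; ring)
    refine ⟨a, fun hz' => ?_⟩
    have := (hE z (Metric.ball_subset_ball (by linarith) a)).1 hz'
    rw [lev_neg] at b; linarith

lemma not_nullType_of_mem {E : Set ℂ} {p : ℂ} (h : p ∈ regBoundary E) : ¬ NullType E p := by
  rintro ⟨ρ, hρ, hn⟩
  obtain ⟨T, hT⟩ := h
  obtain ⟨δ, hδ, hb⟩ := hT.exists_balls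
  have hs : 0 < min δ ρ / 3 := by positivity
  have hs1 : min δ ρ / 3 < δ := by
    have := min_le_left δ ρ; linarith
  have hs2 : 2 * (min δ ρ / 3) ≤ ρ := by
    have := min_le_right δ ρ; linarith
  obtain ⟨h1, h2⟩ := hb _ hs hs1
  rcases hn with hn | hn
  · have := measure_mono_null (h1.trans (inter_subset_inter_left _ (Metric.ball_subset_ball hs2))) hn
    exact (Metric.measure_ball_pos volume _ (by positivity)).ne' this
  · have := measure_mono_null (h2.trans (sdiff_subset_sdiff_left (Metric.ball_subset_ball hs2))) hn
    exact (Metric.measure_ball_pos volume _ (by positivity)).ne' this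

lemma NullType.of_mem_ball {E : Set ℂ} {p : ℂ} {ρ : ℝ}
    (hn : volume (Metric.ball p ρ ∩ E) = 0 ∨ volume (Metric.ball p ρ \ E) = 0) {q : ℂ}
    (hq : q ∈ Metric.ball p ρ) : NullType E q := by
  have hsub : Metric.ball q (ρ - dist q p) ⊆ Metric.ball p ρ :=
    Metric.ball_subset_ball' (by linarith)
  refine ⟨ρ - dist q p, by simpa using hq, hn.imp ?_ ?_⟩
  · exact fun h => measure_mono_null (inter_subset_inter_left _ hsub) h
  · exact fun h => measure_mono_null (sdiff_subset_sdiff_left hsub) h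

lemma regBoundary_subset_frontier {E : Set ℂ} : regBoundary E ⊆ frontier E := by
  intro p hp
  by_contra hf
  refine not_nullType_of_mem hp ?_
  have hmem : p ∈ interior E ∨ p ∈ interior Eᶜ := by
    rw [frontier_eq_closure_inter_closure, mem_inter_iff, not_and_or, ← mem_compl_iff,
      ← mem_compl_iff, ← interior_compl, ← interior_compl, compl_compl] at hf
    exact hf.symm
  rcases hmem with h | h
  · obtain ⟨ρ, hρ, hb⟩ := Metric.isOpen_iff.1 isOpen_interior p h
    refine ⟨ρ, hρ, Or.inr ?_⟩
    rw [sdiff_eq_empty.2 (hb.trans interior_subset), measure_empty]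
  · obtain ⟨ρ, hρ, hb⟩ := Metric.isOpen_iff.1 isOpen_interior p h
    refine ⟨ρ, hρ, Or.inl ?_⟩
    rw [disjoint_iff_inter_eq_empty.1 (subset_compl_iff_disjoint_right.1 (hb.trans interior_subset)), measure_empty]

lemma nullType_of_notMem_frontier {E : Set ℂ} {p : ℂ} (hf : p ∉ frontier E) : NullType E p := by
  have hmem : p ∈ interior E ∨ p ∈ interior Eᶜ := by
    rw [frontier_eq_closure_inter_closure, mem_inter_iff, not_and_or, ← mem_compl_iff,
      ← mem_compl_iff, ← interior_compl, ← interior_compl, compl_compl] at hf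
    exact hf.symm
  rcases hmem with h | h
  · obtain ⟨ρ, hρ, hb⟩ := Metric.isOpen_iff.1 isOpen_interior p h
    refine ⟨ρ, hρ, Or.inr ?_⟩
    rw [sdiff_eq_empty.2 (hb.trans interior_subset), measure_empty]
  · obtain ⟨ρ, hρ, hb⟩ := Metric.isOpen_iff.1 isOpen_interior p h
    refine ⟨ρ, hρ, Or.inl ?_⟩
    rw [disjoint_iff_inter_eq_empty.1 (subset_compl_iff_disjoint_right.1 (hb.trans interior_subset)), measure_empty]

lemma volume_ball_quarter (p q : ℂ) {h : ℝ} (hh : 0 < h) :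
    volume (Metric.ball q (h / 2)) / volume (Metric.ball p (2 * h)) = ENNReal.ofReal (1 / 16) := by
  rw [Complex.volume_ball, Complex.volume_ball, ENNReal.mul_div_mul_right _ _ (by simp [NNReal.pi_ne_zero]) (by simp),
    ← ENNReal.ofReal_pow (by positivity), ← ENNReal.ofReal_pow (by positivity),
    ← ENNReal.ofReal_div_of_pos (by positivity)]
  congr 1; field_simp; norm_num

/-- The balls of `RegularWith.exists_balls` have a quarter of the radius, hence a sixteenth of the
area: at small radii the density ratio stays between `1/16` and `15/16`. -/
lemma regBoundary_subset_essBoundary {E : Set ℂ} (hEm : MeasurableSet E) :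
    regBoundary E ⊆ essBoundary E := by
  rintro p ⟨T, hT⟩
  obtain ⟨δ, hδ, hb⟩ := hT.exists_balls
  have hev : ∀ᶠ ρ : ℝ in 𝓝[>] 0, 0 < ρ ∧ ρ < 2 * δ :=
    Ioo_mem_nhdsGT (by positivity : (0:ℝ) < 2 * δ)
  have hlow : ∀ᶠ ρ : ℝ in 𝓝[>] 0, ENNReal.ofReal (1 / 16) ≤
      volume (E ∩ Metric.ball p ρ) / volume (Metric.ball p ρ) := by
    filter_upwards [hev] with ρ hρ
    have := (hb (ρ / 2) (by linarith) (by linarith)).1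
    rw [mul_div_cancel₀ _ two_ne_zero, inter_comm] at this
    have h2 := ENNReal.div_le_div_right (measure_mono (μ := volume) this) (volume (Metric.ball p ρ))
    rw [← volume_ball_quarter p (p + (ρ / 2 : ℝ) * (I * T)) (h := ρ / 2) (by linarith), mul_div_cancel₀ _ two_ne_zero]
    exact h2
  have hlow' : ∀ᶠ ρ : ℝ in 𝓝[>] 0, volume (E ∩ Metric.ball p ρ) / volume (Metric.ball p ρ) ≤
      1 - ENNReal.ofReal (1 / 16) := by
    filter_upwards [hev] with ρ hρ
    have := (hb (ρ / 2) (by linarith) (by linarith)).2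
    rw [mul_div_cancel₀ _ two_ne_zero] at this
    have h2 := ENNReal.div_le_div_right (measure_mono (μ := volume) this) (volume (Metric.ball p ρ))
    rw [← volume_ball_quarter p (p - (ρ / 2 : ℝ) * (I * T)) (h := ρ / 2) (by linarith), mul_div_cancel₀ _ two_ne_zero]
    refine ENNReal.le_sub_of_add_le_right (ne_top_of_le_ne_top ENNReal.one_ne_top
      (h2.trans ((ENNReal.div_le_div_right (measure_mono sdiff_subset) _).trans
        ENNReal.div_self_le_one))) ?_
    refine (add_le_add_right h2 _).trans ?_
    rw [ENNReal.div_add_div_same, inter_comm, measure_inter_add_sdiff _ hEm]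
    exact ENNReal.div_self_le_one
  constructor
  · intro hc
    have := ge_of_tendsto hc hlow
    simp at this
  · intro hc
    have := le_of_tendsto hc hlow'
    rw [← not_lt] at this
    refine this (ENNReal.sub_lt_self (by simp) (by simp) (by simp))

end

/-! ### All but finitely many points are regular or invisible to the measure -/

noncomputable section
open Complex

lemma mem_iff_of_isPreconnected {E S : Set ℂ} (hp : IsPreconnected S) (h : ∀ z ∈ S, z ∉ frontier E)
    {a b : ℂ} (ha : a ∈ S) (hb : b ∈ S) : a ∈ E ↔ b ∈ E := by
  have hcov : ∀ z ∈ S, z ∈ interior E ∨ z ∈ interior Eᶜ := by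
    intro z hz
    have hf := h z hz
    rw [frontier_eq_closure_inter_closure, mem_inter_iff, not_and_or, ← mem_compl_iff,
      ← mem_compl_iff, ← interior_compl, ← interior_compl, compl_compl] at hf
    exact hf.symm
  have aux : ∀ {a b : ℂ}, a ∈ S → b ∈ S → a ∈ E → b ∈ E := by
    intro a b ha hb haE
    by_contra hbE
    have h1 : a ∈ interior E := (hcov a ha).resolve_right fun h => interior_subset h haE
    have h2 : b ∈ interior Eᶜ := (hcov b hb).resolve_left fun h => hbE (interior_subset h)
    obtain ⟨z, -, hz, hz'⟩ := hp _ _ isOpen_interior isOpen_interior hcov ⟨a, ha, h1⟩ ⟨b, hb, h2⟩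
    exact interior_subset hz' (interior_subset hz)
  exact ⟨aux ha hb, aux hb ha⟩

lemma mem_iff_of_segment {E : Set ℂ} {a b : ℂ} (h : ∀ z ∈ segment ℝ a b, z ∉ frontier E) :
    a ∈ E ↔ b ∈ E :=
  mem_iff_of_isPreconnected (convex_segment a b).isPreconnected h (left_mem_segment ℝ a b)
    (right_mem_segment ℝ a b)

/-- If near `p` the frontier of `E` lies on an oriented circle, then the left side of the circle
is, near `p`, contained in `E` or disjoint from `E`. -/
lemma left_side_const {E : Set ℂ} {p T : ℂ} {κ ρ : ℝ} (hT : ‖T‖ = 1) (hρ : 0 < ρ)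
    (hF : ∀ z ∈ frontier E, z ∈ Metric.ball p ρ → lev p T κ z = 0) :
    ∃ ρ' > 0, (∀ z ∈ Metric.ball p ρ', 0 < lev p T κ z → z ∈ E) ∨
      (∀ z ∈ Metric.ball p ρ', 0 < lev p T κ z → z ∉ E) := by
  -- In the frame at `p`, the box of half-width `b` stays in the given ball because `2 b < ρ`, and
  -- the circle is nearly flat there because `|κ| b ≤ 1/4`.
  obtain ⟨b, hb0, hb1, hb2⟩ : ∃ b : ℝ, 0 < b ∧ 2 * b < ρ ∧ |κ| * b ≤ 1 / 4 := by
    refine ⟨min (ρ / 4) (1 / (4 * (|κ| + 1))), by positivity, ?_, ?_⟩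
    · have := min_le_left (ρ / 4) (1 / (4 * (|κ| + 1))); linarith
    · have h1 := min_le_right (ρ / 4) (1 / (4 * (|κ| + 1)))
      have h2 : |κ| * (1 / (4 * (|κ| + 1))) ≤ 1 / 4 := by
        rw [mul_one_div, div_le_div_iff₀ (by positivity) (by positivity)]
        nlinarith [abs_nonneg κ]
      exact (mul_le_mul_of_nonneg_left h1 (abs_nonneg κ)).trans h2
  have hin : ∀ x y : ℝ, |x| < b → |y| ≤ b → p + (x + y * I) * T ∈ Metric.ball p ρ := by
    intro x y hx hy
    rw [Metric.mem_ball, dist_eq_norm, add_sub_cancel_left]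
    have := norm_frame_le hT x y
    linarith
  have hseg : ∀ x y x' y' : ℝ, ∀ z ∈ segment ℝ (p + (x + y * I) * T) (p + (x' + y' * I) * T),
      ∃ s : ℝ, 0 ≤ s ∧ s ≤ 1 ∧ z = p + (((1 - s) * x + s * x' : ℝ) + ((1 - s) * y + s * y' : ℝ) * I) * T := by
    rintro x y x' y' z ⟨a, c, ha, hc, hac, rfl⟩
    refine ⟨c, hc, by linarith, ?_⟩
    have : a = 1 - c := by linarith
    subst this
    simp only [real_smul]; push_cast; ring
  -- A point on the left of the circle is joined to the point of the normal at height `b` by a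
  -- vertical and then a horizontal segment; both stay on the left, hence off the frontier.
  have key : ∀ z ∈ Metric.ball p b, 0 < lev p T κ z → (z ∈ E ↔ p + ((0 : ℝ) + b * I) * T ∈ E) := by
    intro z hz hpos
    obtain ⟨x, y, rfl, hxy⟩ := exists_frame hT p z
    rw [Metric.mem_ball, dist_eq_norm] at hz
    have hxy' : x ^ 2 + y ^ 2 < b ^ 2 := by
      rw [hxy]; exact pow_lt_pow_left₀ hz (norm_nonneg _) two_ne_zero
    have hx : |x| < b := abs_lt_of_sq_lt_sq (by nlinarith [sq_nonneg y]) hb0.le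
    have hy : |y| < b := abs_lt_of_sq_lt_sq (by nlinarith [sq_nonneg x]) hb0.le
    rw [lev_frame hT] at hpos
    have hx' := abs_lt.1 hx
    have hy' := abs_lt.1 hy
    trans p + (x + b * I) * T ∈ E
    · refine mem_iff_of_segment fun z hz hzF => ?_
      obtain ⟨s, hs0, hs1, rfl⟩ := hseg _ _ _ _ z hz
      have e1 : (1 - s) * x + s * x = x := by ring
      rw [e1] at hzF
      set u := (1 - s) * y + s * b with hu
      have hu1 : y ≤ u := by nlinarith
      have hu2 : u ≤ b := by nlinarith
      have := hF _ hzF (hin x u hx (abs_le.2 ⟨by linarith, hu2⟩))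
      rw [lev_frame hT] at this
      have h4 : κ * (u + y) ≤ 2 * (1 / 4) := by
        have h5 : |u + y| ≤ 2 * b := abs_le.2 ⟨by linarith, by linarith⟩
        calc κ * (u + y) ≤ |κ * (u + y)| := le_abs_self _
          _ = |κ| * |u + y| := abs_mul _ _
          _ ≤ |κ| * (2 * b) := mul_le_mul_of_nonneg_left h5 (abs_nonneg κ)
          _ ≤ _ := by linarith
      nlinarith [mul_nonneg (sub_nonneg.2 hu1) (by linarith : (0:ℝ) ≤ 2 - κ * (u + y))]
    · refine mem_iff_of_segment fun z hz hzF => ?_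
      obtain ⟨s, hs0, hs1, rfl⟩ := hseg _ _ _ _ z hz
      have e1 : (1 - s) * b + s * b = b := by ring
      rw [e1] at hzF
      set u := (1 - s) * x + s * 0 with hu
      have hu1 : |u| < b := by
        rw [hu, mul_zero, add_zero, abs_mul, abs_of_nonneg (by linarith : (0:ℝ) ≤ 1 - s)]
        nlinarith [abs_nonneg x]
      have hu2 : u ^ 2 ≤ b ^ 2 := sq_le_sq' (by linarith [(abs_lt.1 hu1).1]) (abs_lt.1 hu1).2.le
      have := hF _ hzF (hin u b hu1 (by rw [abs_of_pos hb0]))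
      rw [lev_frame hT] at this
      have h5 : κ * (u ^ 2 + b ^ 2) ≤ b / 2 := by
        calc κ * (u ^ 2 + b ^ 2) ≤ |κ| * (u ^ 2 + b ^ 2) :=
              mul_le_mul_of_nonneg_right (le_abs_self _) (by positivity)
          _ ≤ |κ| * (2 * b ^ 2) := mul_le_mul_of_nonneg_left (by linarith) (abs_nonneg κ)
          _ = (|κ| * b) * (2 * b) := by ring
          _ ≤ 1 / 4 * (2 * b) := mul_le_mul_of_nonneg_right hb2 (by positivity)
          _ = b / 2 := by ring
      linarith
  refine ⟨b, hb0, ?_⟩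
  by_cases hE : p + ((0 : ℝ) + b * I) * T ∈ E
  · exact Or.inl fun z hz hp => (key z hz hp).2 hE
  · exact Or.inr fun z hz hp hz' => hE ((key z hz hp).1 hz')

/-- Points of a circle are limits of points to its left. -/
lemma eventually_lev_pos_of_lev_eq_zero {p T q : ℂ} {κ : ℝ} (hT : ‖T‖ = 1) (hq : lev p T κ q = 0) :
    ∀ᶠ h : ℝ in 𝓝[>] 0, 0 < lev p T κ (q + h * (I * (T + I * κ * (q - p)))) := by
  have h1 := re_sq_add_im_sq_eq_one (norm_tangent_of_lev_eq_zero hT hq)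
  have h2 := eventually_lev_pos (T := T + I * κ * (q - p)) (v := I * (T + I * κ * (q - p))) q κ
    (by simp only [mul_im, mul_re, I_re, I_im, conj_re, conj_im]; nlinarith)
  filter_upwards [h2] with h hh
  rwa [lev_rebase hq] at hh

lemma exists_mem_lev_pos {E : Set ℂ} (hE : IsOpen E) {p T q : ℂ} {κ ρ : ℝ} (hT : ‖T‖ = 1)
    (hqE : q ∈ E) (hqb : q ∈ Metric.ball p ρ) (hq : lev p T κ q = 0) :
    ∃ z ∈ E, z ∈ Metric.ball p ρ ∧ 0 < lev p T κ z := by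
  obtain ⟨r, hr, hb⟩ := Metric.isOpen_iff.1 (hE.inter Metric.isOpen_ball) q ⟨hqE, hqb⟩
  obtain ⟨h, h1, h2⟩ := ((eventually_lev_pos_of_lev_eq_zero hT hq).and
    (eventually_ray_mem q (I * (T + I * κ * (q - p))) hr)).exists
  exact ⟨_, (hb h2).1, (hb h2).2, h1⟩

/-- Near a point where the frontier of the open set `E` lies on a circle, `E` is regular or null
or conull. -/
lemma regular_or_nullType {E : Set ℂ} (hE : IsOpen E) (hnull : volume (frontier E) = 0)
    {p T : ℂ} {κ ρ : ℝ} (hT : ‖T‖ = 1) (hρ : 0 < ρ)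
    (hF : ∀ z ∈ frontier E, z ∈ Metric.ball p ρ → lev p T κ z = 0) :
    p ∈ regBoundary E ∨ NullType E p := by
  have hT' : ‖-T‖ = 1 := by simpa using hT
  obtain ⟨r₁, hr₁, h1⟩ := left_side_const hT hρ hF
  obtain ⟨r₂, hr₂, h2⟩ := left_side_const (κ := -κ) hT' hρ (fun z hz hz' => by
    rw [lev_neg, hF z hz hz', neg_zero])
  simp only [lev_neg, Left.neg_pos_iff] at h2
  set r := min r₁ r₂
  have hr : 0 < r := by positivity
  have hs1 : Metric.ball p r ⊆ Metric.ball p r₁ := Metric.ball_subset_ball (min_le_left _ _)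
  have hs2 : Metric.ball p r ⊆ Metric.ball p r₂ := Metric.ball_subset_ball (min_le_right _ _)
  have hneg : ∀ q ∈ Metric.ball p r, q ∈ E → lev p T κ q = 0 →
      ∃ z ∈ E, z ∈ Metric.ball p r ∧ lev p T κ z < 0 := by
    intro q hq hqE h0
    obtain ⟨z, hz, hzb, hzl⟩ := exists_mem_lev_pos hE (κ := -κ) hT' hqE hq (by rw [lev_neg, h0, neg_zero])
    exact ⟨z, hz, hzb, by rw [lev_neg] at hzl; linarith⟩
  rcases h1 with h1 | h1 <;> rcases h2 with h2 | h2
  -- `E` lies on both sides: what it misses near `p` is a slit inside the frontier, which is null.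
  · right
    refine ⟨r, hr, Or.inr (measure_mono_null ?_ hnull)⟩
    rintro z ⟨hzb, hzE⟩
    have h0 : lev p T κ z = 0 := by
      by_contra hne
      rcases lt_or_gt_of_ne hne with hlt | hgt
      · exact hzE (h2 z (hs2 hzb) hlt)
      · exact hzE (h1 z (hs1 hzb) hgt)
    rw [hE.frontier_eq]
    refine ⟨?_, hzE⟩
    rw [Metric.mem_closure_iff]
    intro ε hε
    obtain ⟨h, a, b, c⟩ := ((eventually_lev_pos_of_lev_eq_zero hT h0).and
      ((eventually_ray_mem z (I * (T + I * κ * (z - p))) hε).and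
      ((eventually_ray_mem z (I * (T + I * κ * (z - p))) (ρ := r - dist z p) (by simpa using hzb))))).exists
    refine ⟨_, h1 _ (hs1 ?_) a, by rw [dist_comm]; exact b⟩
    exact Metric.ball_subset_ball' (by linarith) c
  · left
    refine ⟨T, hT, κ, r, hr, fun z hz => ⟨fun hzE => ?_, h1 z (hs1 hz)⟩⟩
    by_contra hle
    rcases (not_lt.1 hle).lt_or_eq with hlt | heq
    · exact h2 z (hs2 hz) hlt hzE
    · obtain ⟨w, hw, hwb, hwl⟩ := hneg z hz hzE heq
      exact h2 w (hs2 hwb) hwl hw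
  · left
    refine ⟨-T, hT', -κ, r, hr, fun z hz => ?_⟩
    rw [lev_neg, Left.neg_pos_iff]
    refine ⟨fun hzE => ?_, h2 z (hs2 hz)⟩
    by_contra hle
    rcases (not_lt.1 hle).lt_or_eq with hlt | heq
    · exact h1 z (hs1 hz) hlt hzE
    · obtain ⟨w, hw, hwb, hwl⟩ := exists_mem_lev_pos hE hT hzE hz heq.symm
      exact h1 w (hs1 hwb) hwl hw
  · right
    refine ⟨r, hr, Or.inl ?_⟩
    convert measure_empty (μ := (volume : Measure ℂ))
    rw [eq_empty_iff_forall_notMem]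
    rintro z ⟨hz, hzE⟩
    rcases lt_trichotomy (lev p T κ z) 0 with hlt | heq | hgt
    · exact h2 z (hs2 hz) hlt hzE
    · obtain ⟨w, hw, hwb, hwl⟩ := hneg z hz hzE heq
      exact h2 w (hs2 hwb) hwl hw
    · exact h1 z (hs1 hz) hgt hzE

lemma det_eq (A : ℂ →L[ℝ] ℂ) : A.det = (A 1).re * (A I).im - (A 1).im * (A I).re := by
  rw [ContinuousLinearMap.det, ← LinearMap.det_toMatrix basisOneI, Matrix.det_fin_two]
  simp [LinearMap.toMatrix_apply]
  ring

/-- The map `z ↦ γ z.re` of the plane has degenerate differential everywhere, so its image is null.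
-/
lemma UnitArc.volume_image_eq_zero {γ : ℝ → ℂ} {T : ℂ} {κ : ℝ} (h : UnitArc γ T κ) (S : Set ℝ) :
    volume (γ '' S) = 0 := by
  have hd : ∀ z ∈ (univ : Set ℂ), HasFDerivWithinAt (fun z : ℂ => γ z.re)
      ((ContinuousLinearMap.toSpanSingleton ℝ (T * exp (((κ * z.re : ℝ) : ℂ) * I))).comp reCLM)
      univ z := by
    intro z _
    exact (((h.hasDerivAt z.re).hasFDerivAt).comp z reCLM.hasFDerivAt).hasFDerivWithinAt
  have h0 := addHaar_image_eq_zero_of_det_fderivWithin_eq_zero (volume : Measure ℂ) hd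
    (fun z _ => by rw [det_eq]; simp)
  refine measure_mono_null ?_ h0
  rintro _ ⟨t, -, rfl⟩
  exact ⟨(t : ℂ), mem_univ _, by simp⟩

/-- The arcs making up the boundary. -/
lemma exists_arcs {A : Set ℂ} (h : HasPiecewiseConstCurvBoundary A) :
    ∃ S : Set (Set ℂ), S.Finite ∧ (∀ Γ ∈ S, ∃ (γ : ℝ → ℂ) (T : ℂ) (κ L : ℝ), UnitArc γ T κ ∧
      Γ = γ '' Icc 0 L) ∧ frontier A = ⋃₀ S := by
  obtain ⟨S, hS, hΓ, hA⟩ := h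
  refine ⟨S, hS, fun Γ hm => ?_, hA⟩
  obtain ⟨γ, κ, L, hγ, rfl⟩ := hΓ Γ hm
  obtain ⟨T, hT⟩ := hγ.exists_unitArc
  exact ⟨γ, T, κ, L, hT, rfl⟩

lemma volume_frontier_eq_zero {A : Set ℂ} (h : HasPiecewiseConstCurvBoundary A) :
    volume (frontier A) = 0 := by
  obtain ⟨S, hS, hΓ, hA⟩ := exists_arcs h
  rw [hA, measure_sUnion_null_iff hS.countable]
  intro Γ hm
  obtain ⟨γ, T, κ, L, hT, rfl⟩ := hΓ Γ hm
  exact hT.volume_image_eq_zero _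

lemma hausdorffMeasure_frontier_lt_top {A : Set ℂ} (h : HasPiecewiseConstCurvBoundary A) :
    μH[1] (frontier A) < ⊤ := by
  obtain ⟨S, hS, hΓ, hA⟩ := exists_arcs h
  rw [hA, sUnion_eq_biUnion]
  refine measure_biUnion_lt_top hS fun Γ hm => ?_
  obtain ⟨γ, T, κ, L, hT, rfl⟩ := hΓ Γ hm
  exact (hT.hausdorffMeasure_image_le _).trans_lt (by simp)

lemma isCompact_frontier {A : Set ℂ} (h : HasPiecewiseConstCurvBoundary A) :
    IsCompact (frontier A) := by
  obtain ⟨S, hS, hΓ, hA⟩ := exists_arcs h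
  rw [hA]
  refine hS.isCompact_sUnion fun Γ hm => ?_
  obtain ⟨γ, T, κ, L, hT, rfl⟩ := hΓ Γ hm
  exact isCompact_Icc.image hT.continuous

/-- All but finitely many points are regular boundary points or have a neighbourhood in which the
set is null or conull. -/
lemma exists_finite_bad {A : Set ℂ} (hA : IsOpen A) (h : HasPiecewiseConstCurvBoundary A) :
    ∃ B : Set ℂ, B.Finite ∧ ∀ p ∉ B, p ∈ regBoundary A ∨ NullType A p := by
  have hnull := volume_frontier_eq_zero h
  obtain ⟨S, hS, hΓ, hfr⟩ := exists_arcs h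
  choose! γ T κ L hγ hΓeq using hΓ
  -- The points where an arc meets another one that does not lie on the same circle. By analyticity
  -- there are finitely many for each pair.
  set bad : Set ℂ → Set ℂ → Set ℂ := fun Γ Γ' =>
    {p | p ∈ Γ ∧ p ∈ Γ' ∧ ∃ z ∈ Γ', lev (γ Γ 0) (T Γ) (κ Γ) z ≠ 0} with hbad
  have hfin : ∀ Γ ∈ S, ∀ Γ' ∈ S, (bad Γ Γ').Finite := by
    intro Γ hm Γ' hm'
    rcases (hγ Γ' hm').lev_eq_zero_or_finite (γ Γ 0) (T Γ) (κ Γ) 0 (L Γ') with hz | hf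
    · convert finite_empty
      rw [eq_empty_iff_forall_notMem]
      rintro p ⟨-, -, z, hz', hne⟩
      rw [hΓeq Γ' hm'] at hz'
      obtain ⟨t, -, rfl⟩ := hz'
      exact hne (hz t)
    · refine (hf.image (γ Γ')).subset ?_
      rintro p ⟨hp, hp', -⟩
      rw [hΓeq Γ' hm'] at hp'
      obtain ⟨t, ht, rfl⟩ := hp'
      refine ⟨t, ⟨ht, ?_⟩, rfl⟩
      rw [hΓeq Γ hm] at hp
      obtain ⟨s, -, hs⟩ := hp
      rw [← hs]
      exact (hγ Γ hm).lev_eq_zero s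
  refine ⟨⋃ Γ ∈ S, ⋃ Γ' ∈ S, bad Γ Γ', hS.biUnion fun Γ hm => hS.biUnion fun Γ' hm' =>
    hfin Γ hm Γ' hm', fun p hp => ?_⟩
  by_cases hpf : p ∈ frontier A
  swap
  · exact Or.inr (nullType_of_notMem_frontier hpf)
  rw [hfr] at hpf
  obtain ⟨Γ, hm, hpΓ⟩ := hpf
  have hl : lev (γ Γ 0) (T Γ) (κ Γ) p = 0 := by
    have := hpΓ
    rw [hΓeq Γ hm] at this
    obtain ⟨s, -, hs⟩ := this
    rw [← hs]
    exact (hγ Γ hm).lev_eq_zero s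
  -- A neighbourhood of `p` avoids the arcs that miss `p`. The arcs through `p` all lie on the
  -- circle of `Γ`, since `p` is not bad; so near `p` the frontier lies on one circle.
  have hclosed : IsClosed (⋃ Γ' ∈ {Γ' ∈ S | p ∉ Γ'}, Γ') := by
    refine (hS.subset (sep_subset _ _)).isClosed_biUnion fun Γ' hm' => ?_
    rw [hΓeq Γ' hm'.1]
    exact (isCompact_Icc.image (hγ Γ' hm'.1).continuous).isClosed
  have hpn : p ∈ (⋃ Γ' ∈ {Γ' ∈ S | p ∉ Γ'}, Γ')ᶜ := by
    simp only [mem_compl_iff, mem_iUnion, not_exists]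
    exact fun Γ' hm' => hm'.2
  obtain ⟨ρ, hρ, hb⟩ := Metric.isOpen_iff.1 hclosed.isOpen_compl p hpn
  refine regular_or_nullType hA hnull (norm_tangent_of_lev_eq_zero (hγ Γ hm).norm_one hl) hρ
    (κ := κ Γ) fun z hz hzb => ?_
  rw [lev_rebase hl]
  rw [hfr] at hz
  obtain ⟨Γ', hm', hz'⟩ := hz
  by_contra hne
  have hpΓ' : p ∈ Γ' := by
    by_contra hpn'
    refine hb hzb ?_
    simp only [mem_iUnion]
    exact ⟨Γ', ⟨hm', hpn'⟩, hz'⟩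
  refine hp ?_
  simp only [mem_iUnion]
  exact ⟨Γ, hm, Γ', hm', hpΓ, hpΓ', z, hz', hne⟩

/-- The complement of a large disk is connected and misses the compact frontier, so `A` contains it
or avoids it; finite area excludes the former. -/
lemma isBounded_of_finite_area {A : Set ℂ} (hA : volume A < ⊤)
    (h : HasPiecewiseConstCurvBoundary A) : Bornology.IsBounded A := by
  obtain ⟨R, hR⟩ := (isCompact_frontier h).isBounded.subset_closedBall (0 : ℂ)
  set R' := max R 0
  have hR' : frontier A ⊆ Metric.closedBall 0 R' := hR.trans (Metric.closedBall_subset_closedBall (le_max_left _ _))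
  have hpre : IsPreconnected ((Metric.closedBall (0 : ℂ) R')ᶜ) := by
    have h1 : IsPreconnected (Ioi R' ×ˢ (univ : Set ℝ)) := isPreconnected_Ioi.prod isPreconnected_univ
    have h2 := h1.image (fun x : ℝ × ℝ => (x.1 : ℂ) * exp (x.2 * I)) (by fun_prop)
    convert h2 using 1
    ext z
    simp only [mem_compl_iff, Metric.mem_closedBall, dist_zero_right, not_le, mem_image, mem_prod,
      mem_Ioi, mem_univ, and_true, Prod.exists]
    constructor
    · exact fun hz => ⟨‖z‖, z.arg, hz, norm_mul_exp_arg_mul_I z⟩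
    · rintro ⟨a, b, hab, rfl⟩
      rw [norm_mul, norm_exp_ofReal_mul_I, mul_one, norm_real]
      exact hab.trans_le (le_abs_self _)
  by_contra hb
  have hex : ∃ z ∈ A, z ∉ Metric.closedBall (0 : ℂ) R' := by
    by_contra! hc
    exact hb (Metric.isBounded_closedBall.subset hc)
  obtain ⟨z, hz, hz'⟩ := hex
  have hsub : (Metric.closedBall (0 : ℂ) R')ᶜ ⊆ A := fun w hw =>
    (mem_iff_of_isPreconnected hpre (fun w hw hwf => hw (hR' hwf)) hz' hw).1 hz
  have h1 : volume ((Metric.closedBall (0 : ℂ) R')ᶜ) < ⊤ := (measure_mono hsub).trans_lt hA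
  have h2 : volume (univ : Set ℂ) < ⊤ := by
    rw [← union_compl_self (Metric.closedBall (0 : ℂ) R')]
    exact (measure_union_le _ _).trans_lt (ENNReal.add_lt_top.2 ⟨measure_closedBall_lt_top, h1⟩)
  rw [measure_univ_of_isAddLeftInvariant] at h2
  exact h2.ne rfl

end

/-! ### Stokes' theorem on parametrised rectangles and normal coordinates -/

noncomputable section
open Complex

/-- Twice the derivative with respect to `z̄`. -/
def dbar (f : ℂ → ℂ) (z : ℂ) : ℂ := fderiv ℝ f z 1 + I * fderiv ℝ f z I

lemma dbar_eq_zero_of_notMem_tsupport {f : ℂ → ℂ} {z : ℂ} (hz : z ∉ tsupport f) : dbar f z = 0 := by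
  have : fderiv ℝ f z = 0 := by
    have h1 : f =ᶠ[𝓝 z] fun _ => 0 := notMem_tsupport_iff_eventuallyEq.1 hz
    rw [h1.fderiv_eq]; simp
  simp [dbar, this]

lemma continuous_dbar {f : ℂ → ℂ} (hf : ContDiff ℝ 1 f) : Continuous (dbar f) := by
  have := hf.continuous_fderiv one_ne_zero
  unfold dbar
  fun_prop

/-- The Jacobian of a linear map from the plane to `ℂ`. -/
def jac (A : ℝ × ℝ →L[ℝ] ℂ) : ℝ := (A (1, 0)).re * (A (0, 1)).im - (A (1, 0)).im * (A (0, 1)).re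

lemma setIntegral_image_param {H : ℝ × ℝ → ℂ} {H' : ℝ × ℝ → ℝ × ℝ →L[ℝ] ℂ} {S : Set (ℝ × ℝ)}
    (hS : MeasurableSet S) (hd : ∀ x ∈ S, HasFDerivAt H (H' x) x) (hi : InjOn H S) (g : ℂ → ℂ) :
    ∫ z in H '' S, g z = ∫ x in S, |jac (H' x)| • g (H x) := by
  have e1 : H '' S = (H ∘ equivRealProd) '' (equivRealProd ⁻¹' S) := by
    rw [image_comp, image_preimage_eq _ equivRealProd.surjective]
  have hm : MeasurableSet (equivRealProd ⁻¹' S) := measurableEquivRealProd.measurable hS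
  have h1 := integral_image_eq_integral_abs_det_fderiv_smul (volume : Measure ℂ) hm
    (f := H ∘ equivRealProd)
    (f' := fun z => (H' (equivRealProd z)).comp (equivRealProdCLM : ℂ →L[ℝ] ℝ × ℝ))
    (fun z hz => ((hd _ hz).comp z equivRealProdCLM.hasFDerivAt).hasFDerivWithinAt)
    (hi.comp equivRealProd.injective.injOn fun z hz => hz) g
  rw [e1, h1, ← volume_preserving_equiv_real_prod.setIntegral_preimage_emb
    measurableEquivRealProd.measurableEmbedding (fun x => |jac (H' x)| • g (H x)) S]
  refine integral_congr_ae (ae_of_all _ fun z => ?_)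
  simp only [det_eq, jac, ContinuousLinearMap.comp_apply, ContinuousLinearEquiv.coe_coe,
    equivRealProdCLM_apply, one_re, one_im, I_re, I_im]
  rfl

/-- Stokes' theorem on a parametrised rectangle. -/
lemma stokes_rect {H : ℝ × ℝ → ℂ} (hH : ContDiff ℝ 2 H) {f : ℂ → ℂ} (hf : ContDiff ℝ 1 f)
    {a b : ℝ × ℝ} (hab : a ≤ b) :
    ∫ x in Icc a b, jac (fderiv ℝ H x) • (I * dbar f (H x)) =
      (∫ t in a.1..b.1, f (H (t, a.2)) * fderiv ℝ H (t, a.2) (1, 0)) -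
      (∫ t in a.1..b.1, f (H (t, b.2)) * fderiv ℝ H (t, b.2) (1, 0)) +
      (∫ s in a.2..b.2, f (H (b.1, s)) * fderiv ℝ H (b.1, s) (0, 1)) -
      ∫ s in a.2..b.2, f (H (a.1, s)) * fderiv ℝ H (a.1, s) (0, 1) := by
  have hH1 : ContDiff ℝ 1 (fderiv ℝ H) := hH.fderiv_right (by norm_num)
  have hA : ∀ v, ContDiff ℝ 1 fun x => fderiv ℝ H x v := fun v => hH1.clm_apply contDiff_const
  have hfH : ContDiff ℝ 1 fun x => f (H x) := hf.comp (hH.of_le (by norm_num))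
  have hF : ContDiff ℝ 1 fun x => f (H x) * fderiv ℝ H x (0, 1) := hfH.mul (hA _)
  have hG : ContDiff ℝ 1 fun x => -(f (H x) * fderiv ℝ H x (1, 0)) := (hfH.mul (hA _)).neg
  have hFd := fun x => (hF.differentiable one_ne_zero x).hasFDerivAt
  have hGd := fun x => (hG.differentiable one_ne_zero x).hasFDerivAt
  -- The divergence of `(f(H) ∂₂H, -f(H) ∂₁H)`: the mixed second derivatives of `H` cancel and what
  -- is left is the Jacobian times `I * dbar f`.
  have key : ∀ x, fderiv ℝ (fun x => f (H x) * fderiv ℝ H x (0, 1)) x (1, 0) +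
      fderiv ℝ (fun x => -(f (H x) * fderiv ℝ H x (1, 0))) x (0, 1) =
      jac (fderiv ℝ H x) • (I * dbar f (H x)) := by
    intro x
    have hd1 : HasFDerivAt (fun x => f (H x)) ((fderiv ℝ f (H x)).comp (fderiv ℝ H x)) x :=
      ((hf.differentiable one_ne_zero (H x)).hasFDerivAt).comp x
        (hH.differentiable two_ne_zero x).hasFDerivAt
    have hd2 : ∀ v, HasFDerivAt (fun x => fderiv ℝ H x v)
        ((fderiv ℝ (fderiv ℝ H) x).flip v) x := fun v => by
      have := (hH1.differentiable one_ne_zero x).hasFDerivAt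
      have h2 := this.clm_apply (hasFDerivAt_const v x)
      simpa using h2
    have hsymm : fderiv ℝ (fderiv ℝ H) x (1, 0) (0, 1) = fderiv ℝ (fderiv ℝ H) x (0, 1) (1, 0) :=
      (hH.contDiffAt.isSymmSndFDerivAt (by simp)) _ _
    have hp : ∀ v, HasFDerivAt (fun x => f (H x) * fderiv ℝ H x v) _ x := fun v => hd1.mul (hd2 v)
    have hn : HasFDerivAt (fun x => -(f (H x) * fderiv ℝ H x (1, 0))) _ x := (hp (1, 0)).neg
    rw [(hp _).fderiv, hn.fderiv]
    have hlin : ∀ w : ℂ, fderiv ℝ f (H x) w = w.re * fderiv ℝ f (H x) 1 + w.im * fderiv ℝ f (H x) I := by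
      intro w
      conv_lhs => rw [← re_add_im w]
      have : (w.re : ℂ) + w.im * I = w.re • (1 : ℂ) + w.im • I := by simp
      rw [this, map_add, map_smul, map_smul]; simp
    simp only [add_apply, smul_apply,
      neg_apply, ContinuousLinearMap.comp_apply, ContinuousLinearMap.flip_apply,
      smul_eq_mul, hsymm]
    rw [hlin (fderiv ℝ H x (1, 0)), hlin (fderiv ℝ H x (0, 1))]
    simp only [jac, dbar, real_smul]
    generalize fderiv ℝ f (H x) 1 = f1
    generalize fderiv ℝ f (H x) I = f2
    generalize fderiv ℝ H x (1, 0) = A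
    generalize fderiv ℝ H x (0, 1) = B
    have e1 : A = A.re + A.im * I := (re_add_im A).symm
    have e2 : B = B.re + B.im * I := (re_add_im B).symm
    generalize A.re = a1 at *
    generalize A.im = a2 at *
    generalize B.re = b1 at *
    generalize B.im = b2 at *
    subst e1 e2
    push_cast
    linear_combination (-(a1 * b2 - a2 * b1) * f2 : ℂ) * I_mul_I
  have := integral_divergence_prod_Icc_of_hasFDerivAt_of_le
    (fun x => f (H x) * fderiv ℝ H x (0, 1)) (fun x => -(f (H x) * fderiv ℝ H x (1, 0)))
    _ _ a b hab hF.continuous.continuousOn hG.continuous.continuousOn (fun x _ => hFd x)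
    (fun x _ => hGd x) (by
      refine ContinuousOn.integrableOn_compact isCompact_Icc (Continuous.continuousOn ?_)
      have h1 := hF.continuous_fderiv one_ne_zero
      have h2 := hG.continuous_fderiv one_ne_zero
      fun_prop)
  simp only [key] at this
  rw [this]
  simp only [intervalIntegral.integral_neg]
  ring

/-- The number `σ` is the constant sign of the Jacobian: the change of variables uses its absolute
value, Stokes' theorem the signed one. -/
lemma gaussGreen_rect {H : ℝ × ℝ → ℂ} (hH : ContDiff ℝ 2 H) {f : ℂ → ℂ} (hf : ContDiff ℝ 1 f)
    {a b : ℝ × ℝ} (hab : a ≤ b) {σ : ℝ}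
    (hσ : ∀ x ∈ Ioo a.1 b.1 ×ˢ Ioo a.2 b.2, |jac (fderiv ℝ H x)| = σ * jac (fderiv ℝ H x))
    (hi : InjOn H (Ioo a.1 b.1 ×ˢ Ioo a.2 b.2)) :
    ∫ z in H '' (Ioo a.1 b.1 ×ˢ Ioo a.2 b.2), I * dbar f z = σ * (
      (∫ t in a.1..b.1, f (H (t, a.2)) * fderiv ℝ H (t, a.2) (1, 0)) -
      (∫ t in a.1..b.1, f (H (t, b.2)) * fderiv ℝ H (t, b.2) (1, 0)) +
      (∫ s in a.2..b.2, f (H (b.1, s)) * fderiv ℝ H (b.1, s) (0, 1)) -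
      ∫ s in a.2..b.2, f (H (a.1, s)) * fderiv ℝ H (a.1, s) (0, 1)) := by
  have hm : MeasurableSet (Ioo a.1 b.1 ×ˢ Ioo a.2 b.2) := measurableSet_Ioo.prod measurableSet_Ioo
  rw [setIntegral_image_param hm (fun x _ => (hH.differentiable two_ne_zero x).hasFDerivAt) hi,
    ← stokes_rect hH hf hab, ← integral_const_mul]
  have hae : (Icc a b : Set (ℝ × ℝ)) =ᵐ[volume] Ioo a.1 b.1 ×ˢ Ioo a.2 b.2 := by
    rw [Icc_prod_eq]
    exact (Measure.set_prod_ae_eq Ioo_ae_eq_Icc Ioo_ae_eq_Icc).symm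
  rw [setIntegral_congr_set hae]
  refine setIntegral_congr_fun hm fun x hx => ?_
  simp only [hσ x hx, real_smul]
  push_cast; ring

lemma UnitArc.contDiff {γ : ℝ → ℂ} {T : ℂ} {κ : ℝ} (h : UnitArc γ T κ) : ContDiff ℝ 2 γ :=
  contDiff_iff_contDiffAt.2 fun t => (h.analyticAt t).contDiffAt

/-- Normal coordinates along an arc. -/
def fermi (γ : ℝ → ℂ) (T : ℂ) (κ : ℝ) (x : ℝ × ℝ) : ℂ :=
  γ x.1 + x.2 * (I * (T * exp (((κ * x.1 : ℝ) : ℂ) * I)))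

section Fermi

variable {γ : ℝ → ℂ} {T : ℂ} {κ : ℝ}

lemma contDiff_fermi (h : UnitArc γ T κ) : ContDiff ℝ 2 (fermi γ T κ) := by
  have h1 : ContDiff ℝ 2 fun x : ℝ × ℝ => γ x.1 := h.contDiff.comp contDiff_fst
  have h2 : ContDiff ℝ 2 fun x : ℝ × ℝ => (x.2 : ℂ) := ofRealCLM.contDiff.comp contDiff_snd
  have h3 : ContDiff ℝ 2 fun x : ℝ × ℝ => ((κ * x.1 : ℝ) : ℂ) :=
    ofRealCLM.contDiff.comp (contDiff_const.mul contDiff_fst)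
  unfold fermi
  exact h1.add (h2.mul (contDiff_const.mul (contDiff_const.mul ((h3.mul contDiff_const).cexp))))

lemma fderiv_fermi_fst (h : UnitArc γ T κ) (x : ℝ × ℝ) :
    fderiv ℝ (fermi γ T κ) x (1, 0) = (1 - κ * x.2 : ℝ) * (T * exp (((κ * x.1 : ℝ) : ℂ) * I)) := by
  have hd := ((contDiff_fermi h).differentiable two_ne_zero x).hasFDerivAt
  have hc : HasDerivAt (fun t : ℝ => ((t, x.2) : ℝ × ℝ)) (1, 0) x.1 :=
    (hasDerivAt_id x.1).prodMk (hasDerivAt_const _ _)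
  have h1 : HasDerivAt (fermi γ T κ ∘ fun t : ℝ => ((t, x.2) : ℝ × ℝ))
      (fderiv ℝ (fermi γ T κ) x (1, 0)) x.1 := hd.comp_hasDerivAt x.1 hc
  have h0 : HasDerivAt (fun u : ℝ => ((κ * u : ℝ) : ℂ) * I) (κ * I) x.1 := by
    have := ((ofRealCLM.hasDerivAt (x := x.1)).const_mul (κ : ℂ)).mul_const I
    simpa using this
  have h2 := (h.hasDerivAt x.1).add (((h0.cexp.const_mul T).const_mul I).const_mul (x.2 : ℂ))
  rw [h1.unique h2]
  push_cast
  linear_combination (x.2 * T * exp (κ * x.1 * I) * κ) * I_mul_I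

lemma fderiv_fermi_snd (h : UnitArc γ T κ) (x : ℝ × ℝ) :
    fderiv ℝ (fermi γ T κ) x (0, 1) = I * (T * exp (((κ * x.1 : ℝ) : ℂ) * I)) := by
  have hd := ((contDiff_fermi h).differentiable two_ne_zero x).hasFDerivAt
  have hc : HasDerivAt (fun t : ℝ => ((x.1, t) : ℝ × ℝ)) (0, 1) x.2 :=
    (hasDerivAt_const _ _).prodMk (hasDerivAt_id x.2)
  have h1 : HasDerivAt (fermi γ T κ ∘ fun t : ℝ => ((x.1, t) : ℝ × ℝ))
      (fderiv ℝ (fermi γ T κ) x (0, 1)) x.2 := hd.comp_hasDerivAt x.2 hc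
  have h2 := (((ofRealCLM.hasDerivAt (x := x.2)).mul_const
    (I * (T * exp (((κ * x.1 : ℝ) : ℂ) * I)))).const_add (γ x.1))
  rw [h1.unique h2]
  simp

lemma jac_fermi (h : UnitArc γ T κ) (x : ℝ × ℝ) : jac (fderiv ℝ (fermi γ T κ) x) = 1 - κ * x.2 := by
  have h1 := re_sq_add_im_sq_eq_one (UnitArc.norm_deriv T h.norm_one (κ * x.1))
  rw [jac, fderiv_fermi_fst h, fderiv_fermi_snd h]
  generalize T * exp (((κ * x.1 : ℝ) : ℂ) * I) = D at *
  simp only [re_ofReal_mul, im_ofReal_mul, I_mul_re, I_mul_im]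
  linear_combination (1 - κ * x.2) * h1

lemma lev_fermi (h : UnitArc γ T κ) (x : ℝ × ℝ) :
    lev (γ 0) T κ (fermi γ T κ x) = x.2 * (2 - κ * x.2) := by
  rw [← lev_rebase (h.lev_eq_zero x.1), ← h.tangent_eq]
  have := lev_frame (p := γ x.1) (κ := κ) (UnitArc.norm_deriv T h.norm_one (κ * x.1)) 0 x.2
  rw [show fermi γ T κ x = γ x.1 + ((0 : ℝ) + x.2 * I) * (T * exp (((κ * x.1 : ℝ) : ℂ) * I)) by
    unfold fermi; push_cast; ring, this]
  ring

/-- In these coordinates the level function is `s (2 - κ s)`. For `|κ| a ≤ 1/4` it determines `s`;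
then `1 - κ s ≠ 0` determines `γ t`, and an arc shorter than a full turn determines `t`. The last
clause is the inverse function theorem at the origin. -/
lemma exists_fermi_square (h : UnitArc γ T κ) {ρ : ℝ} (hρ : 0 < ρ) :
    ∃ a : ℝ, 0 < a ∧ |κ| * a ≤ 1 / 4 ∧ InjOn (fermi γ T κ) (Icc (-a) a ×ˢ Icc (-a) a) ∧
      fermi γ T κ '' (Ioo (-a) a ×ˢ Ioo (-a) a) ⊆ Metric.ball (γ 0) ρ ∧
      fermi γ T κ '' (Ioo (-a) a ×ˢ Ioo (-a) a) ∈ 𝓝 (γ 0) := by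
  obtain ⟨a, ha0, ha1, ha2⟩ : ∃ a : ℝ, 0 < a ∧ 2 * a < ρ ∧ |κ| * a ≤ 1 / 4 := by
    refine ⟨min (ρ / 4) (1 / (4 * (|κ| + 1))), by positivity, ?_, ?_⟩
    · have := min_le_left (ρ / 4) (1 / (4 * (|κ| + 1))); linarith
    · have h1 := min_le_right (ρ / 4) (1 / (4 * (|κ| + 1)))
      have h2 : |κ| * (1 / (4 * (|κ| + 1))) ≤ 1 / 4 := by
        rw [mul_one_div, div_le_div_iff₀ (by positivity) (by positivity)]
        nlinarith [abs_nonneg κ]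
      exact (mul_le_mul_of_nonneg_left h1 (abs_nonneg κ)).trans h2
  have hκ : ∀ u : ℝ, |u| ≤ 2 * a → |κ * u| ≤ 1 / 2 := fun u hu => by
    rw [abs_mul]
    nlinarith [mul_le_mul_of_nonneg_left hu (abs_nonneg κ)]
  refine ⟨a, ha0, ha2, ?_, ?_, ?_⟩
  · rintro ⟨t, s⟩ ⟨⟨ht1, ht2⟩, ⟨hs1, hs2⟩⟩ ⟨t', s'⟩ ⟨⟨ht1', ht2'⟩, ⟨hs1', hs2'⟩⟩ heq
    dsimp only at *
    have hl : s * (2 - κ * s) = s' * (2 - κ * s') := by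
      rw [← lev_fermi h (t, s), ← lev_fermi h (t', s'), heq]
    have hs : s = s' := by
      have h1 := abs_le.1 (hκ (s + s') (abs_le.2 ⟨by linarith, by linarith⟩))
      have h2 : (s - s') * (2 - κ * (s + s')) = 0 := by linear_combination hl
      rcases mul_eq_zero.1 h2 with h3 | h3 <;> linarith
    subst hs
    have h1 := abs_le.1 (hκ s (abs_le.2 ⟨by linarith, by linarith⟩))
    have h2 : ((1 - κ * s : ℝ) : ℂ) * (γ t - γ t') = 0 := by
      unfold fermi at heq
      dsimp only at heq
      rw [h.tangent_eq, h.tangent_eq] at heq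
      push_cast
      linear_combination heq - s * κ * (γ t - γ t') * I_mul_I
    have h3 : γ t = γ t' := by
      rcases mul_eq_zero.1 h2 with h3 | h3
      · rw [ofReal_eq_zero] at h3; linarith
      · exact sub_eq_zero.1 h3
    rw [h.eq_of_eq ?_ h3]
    rw [← abs_mul]
    have := hκ (t - t') (abs_le.2 ⟨by linarith, by linarith⟩)
    linarith [Real.pi_gt_three]
  · rintro _ ⟨⟨t, s⟩, ⟨⟨ht1, ht2⟩, ⟨hs1, hs2⟩⟩, rfl⟩
    dsimp only at *
    rw [Metric.mem_ball, dist_eq_norm]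
    have h1 : ‖γ t - γ 0‖ ≤ |t| := by
      have := h.lipschitzWith.dist_le_mul t 0
      simpa [dist_eq_norm] using this
    have h2 : ‖(s : ℂ) * (I * (T * exp (((κ * t : ℝ) : ℂ) * I)))‖ = |s| := by
      rw [norm_mul, norm_mul, UnitArc.norm_deriv T h.norm_one]; simp
    have h3 : fermi γ T κ (t, s) - γ 0 = (γ t - γ 0) + (s : ℂ) * (I * (T * exp (((κ * t : ℝ) : ℂ) * I))) := by
      unfold fermi; ring
    rw [h3]
    refine (norm_add_le _ _).trans_lt ?_
    rw [h2]
    have := abs_lt.2 ⟨ht1, ht2⟩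
    have := abs_lt.2 ⟨hs1, hs2⟩
    linarith
  · have hst : HasStrictFDerivAt (fermi γ T κ) (fderiv ℝ (fermi γ T κ) (0, 0)) (0, 0) :=
      (contDiff_fermi h).contDiffAt.hasStrictFDerivAt two_ne_zero
    have hT0 : T ≠ 0 := by intro h0; have := h.norm_one; simp [h0] at this
    have hsurj : (fderiv ℝ (fermi γ T κ) (0, 0) : ℝ × ℝ →L[ℝ] ℂ).range = ⊤ := by
      rw [LinearMap.range_eq_top]
      intro w
      refine ⟨((w / T).re, (w / T).im), ?_⟩
      have e : (((w / T).re, (w / T).im) : ℝ × ℝ) = (w / T).re • ((1, 0) : ℝ × ℝ) + (w / T).im • ((0, 1) : ℝ × ℝ) := by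
        simp
      change fderiv ℝ (fermi γ T κ) (0, 0) _ = w
      rw [e, map_add, map_smul, map_smul, fderiv_fermi_fst h, fderiv_fermi_snd h]
      simp only [mul_zero, sub_zero, ofReal_one, one_mul, ofReal_zero, zero_mul, exp_zero, mul_one, real_smul]
      have := re_add_im (w / T)
      calc ((w / T).re : ℂ) * T + (w / T).im * (I * T) = ((w / T).re + (w / T).im * I) * T := by ring
        _ = w := by rw [this, div_mul_cancel₀ _ hT0]
    have hmap := hst.map_nhds_eq_of_surj hsurj
    have h0 : fermi γ T κ (0, 0) = γ 0 := by simp [fermi]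
    rw [h0] at hmap
    rw [← hmap]
    exact image_mem_map (prod_mem_nhds (Ioo_mem_nhds (by linarith) ha0) (Ioo_mem_nhds (by linarith) ha0))

end Fermi
end

/-! ### The Gauss-Green formula near a point -/

noncomputable section
open Complex

lemma lev_eq_zero_of_mem_frontier {E : Set ℂ} {p T : ℂ} {κ ρ : ℝ}
    (hE : ∀ w ∈ Metric.ball p ρ, (w ∈ E ↔ 0 < lev p T κ w)) {q : ℂ} (hq : q ∈ Metric.ball p ρ)
    (hqf : q ∈ frontier E) : lev p T κ q = 0 := by
  by_contra hne
  rcases lt_or_gt_of_ne hne with hlt | hgt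
  · have hop : IsOpen (Metric.ball p ρ ∩ {w | lev p T κ w < 0}) :=
      Metric.isOpen_ball.inter (isOpen_lt (continuous_lev _ _ _) continuous_const)
    have hsub : Metric.ball p ρ ∩ {w | lev p T κ w < 0} ⊆ Eᶜ := fun w hw hwE =>
      absurd ((hE w hw.1).1 hwE) (not_lt.2 (le_of_lt hw.2))
    rw [frontier_eq_closure_inter_closure, ← compl_compl E, closure_compl, compl_compl] at hqf
    exact hqf.1 (interior_maximal hsub hop ⟨hq, hlt⟩)
  · have hop : IsOpen (Metric.ball p ρ ∩ {w | 0 < lev p T κ w}) :=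
      Metric.isOpen_ball.inter (isOpen_lt continuous_const (continuous_lev _ _ _))
    have hsub : Metric.ball p ρ ∩ {w | 0 < lev p T κ w} ⊆ E := fun w hw => (hE w hw.1).2 hw.2
    exact hqf.2 (interior_maximal hsub hop ⟨hq, hgt⟩)

/-- Inside the ball of regularity around a regular point, every frontier point is on the circle and
hence regular. This makes the regular boundary measurable. -/
lemma exists_isOpen_regBoundary_eq {E : Set ℂ} : ∃ U : Set ℂ, IsOpen U ∧ regBoundary E = frontier E ∩ U := by
  refine ⟨⋃ p ∈ regBoundary E, {z | ∃ T κ ρ, ‖T‖ = 1 ∧ (∀ w ∈ Metric.ball p ρ, (w ∈ E ↔ 0 < lev p T κ w)) ∧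
    z ∈ Metric.ball p ρ}, ?_, ?_⟩
  · refine isOpen_biUnion fun p _ => ?_
    have : {z | ∃ T κ ρ, ‖T‖ = 1 ∧ (∀ w ∈ Metric.ball p ρ, (w ∈ E ↔ 0 < lev p T κ w)) ∧
        z ∈ Metric.ball p ρ} = ⋃ (T : ℂ) (κ : ℝ) (ρ : ℝ) (_ : ‖T‖ = 1 ∧
        ∀ w ∈ Metric.ball p ρ, (w ∈ E ↔ 0 < lev p T κ w)), Metric.ball p ρ := by
      ext z; simp only [mem_ofPred_eq, mem_iUnion, exists_prop, and_assoc]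
    rw [this]
    exact isOpen_iUnion fun _ => isOpen_iUnion fun _ => isOpen_iUnion fun _ => isOpen_iUnion fun _ =>
      Metric.isOpen_ball
  · ext q
    simp only [mem_inter_iff, mem_iUnion, exists_prop]
    constructor
    · intro hq
      refine ⟨regBoundary_subset_frontier hq, q, hq, ?_⟩
      obtain ⟨T, hT, κ, ρ, hρ, hE⟩ := hq
      exact ⟨T, κ, ρ, hT, hE, Metric.mem_ball_self hρ⟩
    · rintro ⟨hqf, p, -, T, κ, ρ, hT, hE, hq⟩
      exact (regularWith_of_lev_eq_zero hT hE hq (lev_eq_zero_of_mem_frontier hE hq hqf)).mem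

lemma measurableSet_regBoundary {E : Set ℂ} : MeasurableSet (regBoundary E) := by
  obtain ⟨U, hU, h⟩ := exists_isOpen_regBoundary_eq (E := E)
  rw [h]
  exact isClosed_frontier.measurableSet.inter hU.measurableSet

lemma continuousOn_tangent {E : Set ℂ} : ContinuousOn (tangent E) (regBoundary E) := by
  rintro p ⟨T, hT, κ, ρ, hρ, hE⟩
  have hc : ContinuousWithinAt (fun q => T + I * κ * (q - p)) (regBoundary E) p :=
    Continuous.continuousWithinAt (by fun_prop)
  refine hc.congr_of_eventuallyEq ?_ ?_
  · have h1 : Metric.ball p ρ ∈ 𝓝[regBoundary E] p := mem_nhdsWithin_of_mem_nhds (Metric.ball_mem_nhds p hρ)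
    filter_upwards [h1, self_mem_nhdsWithin] with q hq hqR
    exact (regularWith_of_lev_eq_zero hT hE hq
      (lev_eq_zero_of_mem_frontier hE hq (regBoundary_subset_frontier hqR))).tangent_eq
  · simpa using (RegularWith.tangent_eq ⟨hT, κ, ρ, hρ, hE⟩)

lemma norm_tangent_le (E : Set ℂ) (p : ℂ) : ‖tangent E p‖ ≤ 1 := by
  unfold tangent
  split_ifs with h
  · exact h.choose_spec.1.le
  · simp

lemma aestronglyMeasurable_tangent {E : Set ℂ} {f : ℂ → ℂ} (hf : Continuous f) {S : Set ℂ}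
    (hS : MeasurableSet S) (hSE : S ⊆ regBoundary E) (μ : Measure ℂ) :
    AEStronglyMeasurable (fun z => f z * tangent E z) (μ.restrict S) :=
  (hf.continuousOn.mul (continuousOn_tangent.mono hSE)).aestronglyMeasurable hS

/-- The Gauss-Green formula for `f` on `E`. -/
def GaussGreen (E : Set ℂ) (f : ℂ → ℂ) : Prop :=
  ∫ z in E, I * dbar f z = ∫ z in regBoundary E, f z * tangent E z ∂μH[1]

/-- In normal coordinates `E` is the half `s > 0` of a square. As `f` vanishes on the three outer
sides of this half, only the side `s = 0`, which is the boundary of `E`, survives in Stokes'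
theorem. -/
lemma gaussGreen_of_regular {E : Set ℂ} (hEm : MeasurableSet E) {p : ℂ} (hp : p ∈ regBoundary E) :
    ∃ ρ > 0, ∀ f : ℂ → ℂ, ContDiff ℝ 1 f → tsupport f ⊆ Metric.ball p ρ → GaussGreen E f := by
  obtain ⟨T, hT, κ, ρ, hρ, hE⟩ := hp
  obtain ⟨γ, hγ, rfl⟩ := UnitArc.exists_arc p hT κ
  obtain ⟨a, ha0, hκa, hinj, hball, hnhds⟩ := exists_fermi_square hγ hρ
  obtain ⟨r, hr, hrb⟩ := Metric.mem_nhds_iff.1 hnhds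
  set H := fermi γ T κ
  have hκ : ∀ u : ℝ, |u| ≤ a → |κ * u| ≤ 1 / 4 := fun u hu => by
    rw [abs_mul]
    exact (mul_le_mul_of_nonneg_left hu (abs_nonneg κ)).trans hκa
  have hlev : ∀ x ∈ Ioo (-a) a ×ˢ Ioo (-a) a, (H x ∈ E ↔ 0 < x.2) ∧ (lev (γ 0) T κ (H x) = 0 ↔ x.2 = 0) := by
    intro x hx
    have h1 := abs_le.1 (hκ x.2 (abs_le.2 ⟨hx.2.1.le, hx.2.2.le⟩))
    rw [hE _ (hball ⟨x, hx, rfl⟩), lev_fermi hγ]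
    constructor
    · exact mul_pos_iff_of_pos_right (by linarith)
    · rw [mul_eq_zero, or_iff_left (by linarith)]
  have hγH : ∀ t, γ t = H (t, 0) := fun t => by simp [H, fermi]
  have hreg : ∀ t ∈ Ioo (-a) a, RegularWith E (γ t) (T * exp (((κ * t : ℝ) : ℂ) * I)) := by
    intro t ht
    rw [hγ.tangent_eq]
    refine regularWith_of_lev_eq_zero hT hE (hball ⟨(t, 0), ⟨ht, by simpa using ha0⟩, (hγH t).symm⟩) (hγ.lev_eq_zero t)
  have hR : regBoundary E ∩ H '' (Ioo (-a) a ×ˢ Ioo (-a) a) = γ '' Ioo (-a) a := by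
    ext z
    constructor
    · rintro ⟨hz, x, hx, rfl⟩
      refine ⟨x.1, hx.1, ?_⟩
      rw [hγH]
      congr 1
      refine Prod.ext rfl ?_
      exact ((hlev x hx).2.1 (lev_eq_zero_of_mem_frontier hE (hball ⟨x, hx, rfl⟩)
        (regBoundary_subset_frontier hz))).symm
    · rintro ⟨t, ht, rfl⟩
      exact ⟨(hreg t ht).mem, (t, 0), ⟨ht, by simpa using ha0⟩, (hγH t).symm⟩
  have hEH : E ∩ H '' (Ioo (-a) a ×ˢ Ioo (-a) a) = H '' (Ioo (-a) a ×ˢ Ioo 0 a) := by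
    ext z
    constructor
    · rintro ⟨hz, x, hx, rfl⟩
      exact ⟨x, ⟨hx.1, (hlev x hx).1.1 hz, hx.2.2⟩, rfl⟩
    · rintro ⟨x, ⟨hx1, hx2⟩, rfl⟩
      have hx : x ∈ Ioo (-a) a ×ˢ Ioo (-a) a := ⟨hx1, by linarith [hx2.1], hx2.2⟩
      exact ⟨(hlev x hx).1.2 hx2.1, x, hx, rfl⟩
  refine ⟨r, hr, fun f hf hsupp => ?_⟩
  have hf0 : ∀ z ∉ H '' (Ioo (-a) a ×ˢ Ioo (-a) a), z ∉ tsupport f := fun z hz hzs =>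
    hz (hrb (hsupp hzs))
  have hf1 : ∀ x ∈ Icc (-a) a ×ˢ Icc (-a) a, x ∉ Ioo (-a) a ×ˢ Ioo (-a) a → f (H x) = 0 := by
    intro x hx hx'
    refine image_eq_zero_of_notMem_tsupport (hf0 _ ?_)
    rintro ⟨y, hy, hyx⟩
    rw [hinj ⟨Ioo_subset_Icc_self hy.1, Ioo_subset_Icc_self hy.2⟩ hx hyx] at hy
    exact hx' hy
  have hinjγ : InjOn γ (Ioo (-a) a) := by
    intro s hs t ht hst
    rw [hγH, hγH] at hst
    have := hinj ⟨Ioo_subset_Icc_self hs, by simp [ha0.le]⟩ ⟨Ioo_subset_Icc_self ht, by simp [ha0.le]⟩ hst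
    exact congrArg Prod.fst this
  unfold GaussGreen
  rw [setIntegral_eq_of_subset_of_forall_sdiff_eq_zero hEm (s := E ∩ H '' (Ioo (-a) a ×ˢ Ioo (-a) a))
      inter_subset_left (fun z hz => by
        rw [dbar_eq_zero_of_notMem_tsupport (hf0 z fun hzH => hz.2 ⟨hz.1, hzH⟩), mul_zero]),
    setIntegral_eq_of_subset_of_forall_sdiff_eq_zero measurableSet_regBoundary
      (s := regBoundary E ∩ H '' (Ioo (-a) a ×ˢ Ioo (-a) a))
      inter_subset_left (fun z hz => by
        rw [image_eq_zero_of_notMem_tsupport (hf0 z fun hzH => hz.2 ⟨hz.1, hzH⟩), zero_mul]), hEH, hR]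
  have hgg := gaussGreen_rect (contDiff_fermi hγ) hf (a := (-a, 0)) (b := (a, a))
    (Prod.mk_le_mk.2 ⟨by linarith, ha0.le⟩) (σ := 1) (fun x hx => by
      have h1 := abs_le.1 (hκ x.2 (abs_le.2 ⟨by linarith [hx.2.1], hx.2.2.le⟩))
      rw [jac_fermi hγ, one_mul, abs_of_pos (by linarith)])
    (hinj.mono (prod_mono Ioo_subset_Icc_self (Ioo_subset_Icc_self.trans (Icc_subset_Icc_left (by linarith)))))
  dsimp only at hgg
  rw [hgg, hγ.setIntegral_image measurableSet_Ioo hinjγ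
    (aestronglyMeasurable_tangent hf.continuous (hγ.measurableSet_image measurableSet_Ioo hinjγ)
      (hR ▸ inter_subset_left) _)]
  have hneg : -a ≤ a := by linarith
  have z1 : (∫ t in (-a)..a, f (fermi γ T κ (t, a)) * fderiv ℝ (fermi γ T κ) (t, a) (1, 0)) = 0 := by
    rw [intervalIntegral.integral_of_le hneg]
    refine setIntegral_eq_zero_of_forall_eq_zero fun t ht => ?_
    rw [show f (fermi γ T κ (t, a)) = 0 from hf1 (t, a) ⟨Ioc_subset_Icc_self ht, by simp [hneg]⟩ (fun h => lt_irrefl _ h.2.2), zero_mul]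
  have z2 : (∫ s in (0:ℝ)..a, f (fermi γ T κ (a, s)) * fderiv ℝ (fermi γ T κ) (a, s) (0, 1)) = 0 := by
    rw [intervalIntegral.integral_of_le ha0.le]
    refine setIntegral_eq_zero_of_forall_eq_zero fun t ht => ?_
    rw [show f (fermi γ T κ (a, t)) = 0 from hf1 (a, t) ⟨by simp [hneg], by linarith [ht.1], ht.2⟩ (fun h => lt_irrefl _ h.1.2), zero_mul]
  have z3 : (∫ s in (0:ℝ)..a, f (fermi γ T κ (-a, s)) * fderiv ℝ (fermi γ T κ) (-a, s) (0, 1)) = 0 := by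
    rw [intervalIntegral.integral_of_le ha0.le]
    refine setIntegral_eq_zero_of_forall_eq_zero fun t ht => ?_
    rw [show f (fermi γ T κ (-a, t)) = 0 from hf1 (-a, t) ⟨by simp [hneg], by linarith [ht.1], ht.2⟩ (fun h => lt_irrefl _ h.1.1), zero_mul]
  rw [z1, z2, z3, intervalIntegral.integral_of_le hneg, integral_Ioc_eq_integral_Ioo]
  simp only [ofReal_one, one_mul, sub_zero, add_zero]
  refine setIntegral_congr_fun measurableSet_Ioo fun t ht => ?_
  simp only [fderiv_fermi_fst hγ, mul_zero, sub_zero, ofReal_one, one_mul]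
  rw [(hreg t ht).tangent_eq, show fermi γ T κ (t, 0) = γ t from (hγH t).symm]

lemma integral_dbar_eq_zero {f : ℂ → ℂ} (hf : ContDiff ℝ 1 f) (hs : HasCompactSupport f) :
    ∫ z, I * dbar f z = 0 := by
  have hint : ∀ v, Integrable fun z => fderiv ℝ f z v := fun v =>
    ((hf.continuous_fderiv one_ne_zero).clm_apply continuous_const).integrable_of_hasCompactSupport
      (hs.fderiv_apply ℝ v)
  have h0 : ∀ v, ∫ z, fderiv ℝ f z v = 0 := by
    intro v
    obtain ⟨φ, hφ⟩ : ∃ φ : ℂ → ℂ, φ = fun _ => 1 := ⟨_, rfl⟩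
    have := integral_mul_fderiv_eq_neg_fderiv_mul_of_integrable (f := fun _ : ℂ => (1 : ℂ)) (g := f)
      (v := v) (μ := volume) (by simp) (by simpa using hint v)
      (by simpa using hf.continuous.integrable_of_hasCompactSupport hs) (fun _ _ => by fun_prop)
      (fun z _ => hf.differentiable one_ne_zero z)
    simpa using this
  rw [integral_const_mul]
  unfold dbar
  rw [integral_add (hint 1) ((hint I).const_mul I), integral_const_mul, h0, h0]
  simp

/-- The ball contains no regular boundary point, so the boundary term vanishes. The area term is an
integral over a null set or the integral of `I * dbar f` over the whole plane, which is zero. -/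
lemma gaussGreen_of_nullType {E : Set ℂ} (hEm : MeasurableSet E) {p : ℂ} (hp : NullType E p) :
    ∃ ρ > 0, ∀ f : ℂ → ℂ, ContDiff ℝ 1 f → tsupport f ⊆ Metric.ball p ρ → GaussGreen E f := by
  obtain ⟨ρ, hρ, hn⟩ := hp
  refine ⟨ρ, hρ, fun f hf hsupp => ?_⟩
  have hR : ∫ z in regBoundary E, f z * tangent E z ∂μH[1] = 0 := by
    refine setIntegral_eq_zero_of_forall_eq_zero fun z hz => ?_
    rw [image_eq_zero_of_notMem_tsupport (fun hzs => not_nullType_of_mem hz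
      (NullType.of_mem_ball hn (hsupp hzs))), zero_mul]
  have hcs : HasCompactSupport f := by
    refine HasCompactSupport.of_support_subset_isCompact (isCompact_closedBall p ρ) ?_
    exact (subset_tsupport f).trans (hsupp.trans Metric.ball_subset_closedBall)
  unfold GaussGreen
  rw [hR]
  have hz : ∀ z ∉ Metric.ball p ρ, I * dbar f z = 0 := fun z hz => by
    rw [dbar_eq_zero_of_notMem_tsupport fun h => hz (hsupp h), mul_zero]
  rw [setIntegral_eq_of_subset_of_forall_sdiff_eq_zero hEm (s := E ∩ Metric.ball p ρ)
      inter_subset_left (fun z hz' => hz z fun h => hz'.2 ⟨hz'.1, h⟩)]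
  rcases hn with hn | hn
  · rw [inter_comm] at hn
    exact setIntegral_measure_zero _ hn
  · have : (E ∩ Metric.ball p ρ : Set ℂ) =ᵐ[volume] Metric.ball p ρ := by
      rw [inter_comm]
      have := ae_eq_set (μ := volume) (s := Metric.ball p ρ ∩ E) (t := Metric.ball p ρ)
      rw [this]
      refine ⟨?_, ?_⟩
      · rw [sdiff_eq_empty.2 inter_subset_left, measure_empty]
      · rw [sdiff_self_inter]; exact hn
    rw [setIntegral_congr_set this, setIntegral_eq_integral_of_forall_compl_eq_zero hz,
      integral_dbar_eq_zero hf hcs]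

end

/-! ### The global Gauss-Green formula -/

noncomputable section
open Complex
open scoped ContDiff Manifold

lemma dbar_mul {f g : ℂ → ℂ} {z : ℂ} (hf : DifferentiableAt ℝ f z) (hg : DifferentiableAt ℝ g z) :
    dbar (fun w => f w * g w) z = f z * dbar g z + g z * dbar f z := by
  have h : HasFDerivAt (fun w => f w * g w) _ z := hf.hasFDerivAt.mul hg.hasFDerivAt
  rw [dbar, h.fderiv, dbar, dbar]
  simp only [add_apply, smul_apply, smul_eq_mul]
  ring

lemma dbar_sum {ι : Type*} (s : Finset ι) {g : ι → ℂ → ℂ} {z : ℂ}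
    (hg : ∀ i ∈ s, DifferentiableAt ℝ (g i) z) :
    dbar (fun w => ∑ i ∈ s, g i w) z = ∑ i ∈ s, dbar (g i) z := by
  have h : HasFDerivAt (fun w => ∑ i ∈ s, g i w) (∑ i ∈ s, fderiv ℝ (g i) z) z :=
    HasFDerivAt.fun_sum fun i hi => (hg i hi).hasFDerivAt
  rw [dbar, h.fderiv]
  simp only [dbar, sum_apply, Finset.mul_sum, Finset.sum_add_distrib]

lemma integrableOn_of_isBounded {E : Set ℂ} (hb : Bornology.IsBounded E) {g : ℂ → ℂ}
    (hg : Continuous g) : IntegrableOn g E := by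
  obtain ⟨R, hR⟩ := hb.subset_closedBall (0 : ℂ)
  exact (hg.continuousOn.integrableOn_compact (isCompact_closedBall 0 R)).mono_set hR

section Global

variable {E : Set ℂ}

lemma integrableOn_tangent (hb : Bornology.IsBounded E) (hfin : μH[1] (regBoundary E) < ⊤) {f : ℂ → ℂ}
    (hf : Continuous f) : IntegrableOn (fun z => f z * tangent E z) (regBoundary E) μH[1] := by
  obtain ⟨R, hR⟩ := hb.closure.subset_closedBall (0 : ℂ)
  obtain ⟨C, hC⟩ := (isCompact_closedBall (0 : ℂ) R).exists_bound_of_continuousOn hf.continuousOn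
  have : IsFiniteMeasure (μH[1].restrict (regBoundary E) : Measure ℂ) := ⟨by simpa using hfin⟩
  refine Integrable.of_bound ?_ C ?_
  · exact aestronglyMeasurable_tangent hf measurableSet_regBoundary subset_rfl _
  · rw [ae_restrict_iff' measurableSet_regBoundary]
    refine ae_of_all _ fun z hz => ?_
    rw [norm_mul]
    have h1 := hC z (hR (frontier_subset_closure (regBoundary_subset_frontier hz)))
    have h2 := norm_tangent_le E z
    nlinarith [norm_nonneg (f z), norm_nonneg (tangent E z)]

lemma gaussGreen_sum (hb : Bornology.IsBounded E) (hfin : μH[1] (regBoundary E) < ⊤) {ι : Type*}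
    (s : Finset ι) {g : ι → ℂ → ℂ} (hg : ∀ i ∈ s, ContDiff ℝ 1 (g i))
    (h : ∀ i ∈ s, GaussGreen E (g i)) : GaussGreen E (fun z => ∑ i ∈ s, g i z) := by
  unfold GaussGreen at *
  have h1 : ∀ z, I * dbar (fun w => ∑ i ∈ s, g i w) z = ∑ i ∈ s, I * dbar (g i) z := fun z => by
    rw [dbar_sum s fun i hi => (hg i hi).differentiable one_ne_zero z, Finset.mul_sum]
  simp only [h1, Finset.sum_mul]
  rw [integral_finsetSum, integral_finsetSum]
  · exact Finset.sum_congr rfl h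
  · exact fun i hi => integrableOn_tangent hb hfin (hg i hi).continuous
  · exact fun i hi => integrableOn_of_isBounded hb (continuous_const.mul (continuous_dbar (hg i hi)))

lemma gaussGreen_congr (hE : IsOpen E) {f g : ℂ → ℂ} (hfg : ∀ z ∈ closure E, f z = g z)
    (h : GaussGreen E g) : GaussGreen E f := by
  unfold GaussGreen at *
  have h1 : ∫ z in E, I * dbar f z = ∫ z in E, I * dbar g z := by
    refine setIntegral_congr_fun hE.measurableSet fun z hz => ?_
    have : f =ᶠ[𝓝 z] g := by
      filter_upwards [hE.mem_nhds hz] with w hw using hfg w (subset_closure hw)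
    simp only [dbar, this.fderiv_eq]
  have h2 : ∫ z in regBoundary E, f z * tangent E z ∂μH[1] = ∫ z in regBoundary E, g z * tangent E z ∂μH[1] := by
    refine setIntegral_congr_fun measurableSet_regBoundary fun z hz => ?_
    simp only [hfg z (frontier_subset_closure (regBoundary_subset_frontier hz))]
  rw [h1, h, h2]

/-- A partition of unity subordinate to the balls of the local formulas, over the compact set
`closure E ∩ tsupport f`. The pieces sum to `f` only on `closure E`, which suffices by
`gaussGreen_congr`. -/
lemma gaussGreen_of_local (hE : IsOpen E) (hb : Bornology.IsBounded E)
    (hfin : μH[1] (regBoundary E) < ⊤) {f : ℂ → ℂ} (hf : ContDiff ℝ 1 f)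
    (hloc : ∀ p ∈ tsupport f, p ∈ regBoundary E ∨ NullType E p) : GaussGreen E f := by
  have hex : ∀ p ∈ tsupport f, ∃ ρ > 0, ∀ f : ℂ → ℂ, ContDiff ℝ 1 f →
      tsupport f ⊆ Metric.ball p ρ → GaussGreen E f := fun p hp =>
    (hloc p hp).elim (gaussGreen_of_regular hE.measurableSet) (gaussGreen_of_nullType hE.measurableSet)
  choose! ρ hρ hgg using hex
  set s := closure E ∩ tsupport f with hs
  have hsc : IsCompact s := hb.isCompact_closure.inter_right (isClosed_tsupport f)
  obtain ⟨t, hts, hcov⟩ := hsc.elim_nhds_subcover (fun p => Metric.ball p (ρ p))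
    fun p hp => Metric.ball_mem_nhds p (hρ p hp.2)
  obtain ⟨φ, hφ⟩ := SmoothPartitionOfUnity.exists_isSubordinate 𝓘(ℝ, ℂ) hsc.isClosed
    (fun p : t => Metric.ball (p : ℂ) (ρ p)) (fun p => Metric.isOpen_ball) (by
      intro z hz
      have := hcov hz
      simp only [mem_iUnion] at this ⊢
      obtain ⟨p, hp, hzp⟩ := this
      exact ⟨⟨p, hp⟩, hzp⟩)
  have hg : ∀ i, ContDiff ℝ 1 (fun z => (φ i z : ℂ) * f z) := fun i =>
    (ofRealCLM.contDiff.comp ((φ i).contMDiff.contDiff.of_le (by simp))).mul hf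
  refine gaussGreen_congr hE (g := fun z => ∑ i, (φ i z : ℂ) * f z) (fun z hz => ?_)
    (gaussGreen_sum hb hfin _ (fun i _ => hg i) fun i _ => ?_)
  · by_cases hzs : z ∈ tsupport f
    · have := φ.sum_eq_one (x := z) ⟨hz, hzs⟩
      rw [finsum_eq_sum_of_fintype] at this
      rw [← Finset.sum_mul, ← ofReal_sum, this, ofReal_one, one_mul]
    · simp [image_eq_zero_of_notMem_tsupport hzs]
  · refine hgg i (hts i i.2).2 _ (hg i) ?_
    refine subset_trans ?_ (hφ i)
    refine closure_mono fun z hz => ?_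
    simp only [Function.mem_support] at hz ⊢
    intro h0
    simp [h0] at hz

/-- The formula holds for `(1 - u n) * f`, where the cutoff `u n` is `1` near `b` and vanishes at
distance `2 / (n + 1)` from `b`. Since `b` is null for both measures, the terms containing `1 - u n`
converge by domination. The term with the derivative of `u n` is a gradient of order `n` integrated
over an area of order `n⁻²`. -/
lemma gaussGreen_remove_point (hE : IsOpen E) (hb : Bornology.IsBounded E)
    (hfin : μH[1] (regBoundary E) < ⊤) {B : Set ℂ} {b : ℂ}
    (h : ∀ f : ℂ → ℂ, ContDiff ℝ 1 f → Disjoint (tsupport f) (insert b B) → GaussGreen E f)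
    {f : ℂ → ℂ} (hf : ContDiff ℝ 1 f) (hfB : Disjoint (tsupport f) B) : GaussGreen E f := by
  obtain ⟨χ, hin, hout⟩ : ∃ χ : ContDiffBump (0 : ℂ), χ.rIn = 1 ∧ χ.rOut = 2 :=
    ⟨⟨1, 2, one_pos, one_lt_two⟩, rfl, rfl⟩
  set c : ℂ → ℂ := fun z => (χ z : ℂ) with hc
  have hcC : ContDiff ℝ 1 c := ofRealCLM.contDiff.comp χ.contDiff
  have hcs : HasCompactSupport c := χ.hasCompactSupport.comp_left ofReal_zero
  obtain ⟨C, hC⟩ := (hcC.continuous_fderiv one_ne_zero).bounded_above_of_compact_support (hcs.fderiv ℝ)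
  have hC0 : 0 ≤ C := (norm_nonneg _).trans (hC 0)
  set u : ℕ → ℂ → ℂ := fun n z => c (((n + 1 : ℝ) : ℂ) * (z - b)) with hu
  have hlinC : ∀ n : ℕ, ContDiff ℝ 1 fun z : ℂ => ((n + 1 : ℝ) : ℂ) * (z - b) := fun n => by fun_prop
  have huC : ∀ n, ContDiff ℝ 1 (u n) := fun n => hcC.comp (hlinC n)
  have hu1 : ∀ n z, ‖u n z‖ ≤ 1 := fun n z => by
    simp only [hu, hc, norm_real, Real.norm_eq_abs, abs_of_nonneg χ.nonneg]
    exact χ.le_one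
  have hu0 : ∀ (n : ℕ) z, 2 ≤ (n + 1 : ℝ) * ‖z - b‖ → u n z = 0 := fun n z hz => by
    simp only [hu, hc]
    rw [χ.zero_of_le_dist, ofReal_zero]
    rw [hout, dist_zero_right, norm_mul, norm_real, Real.norm_of_nonneg (by positivity)]
    exact hz
  have hud : ∀ n z, ‖dbar (u n) z‖ ≤ 2 * ((n + 1) * C) := fun n z => by
    have h1 : HasFDerivAt (fun z : ℂ => ((n + 1 : ℝ) : ℂ) * (z - b))
        ((n + 1 : ℝ) • ContinuousLinearMap.id ℝ ℂ) z := by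
      have := ((hasFDerivAt_id (𝕜 := ℝ) z).sub_const b).const_smul (n + 1 : ℝ)
      refine this.congr_of_eventuallyEq (Eventually.of_forall fun w => ?_)
      simp
    have h2 : HasFDerivAt (u n) _ z := ((hcC.differentiable one_ne_zero _).hasFDerivAt).comp z h1
    have h3 : ∀ v : ℂ, ‖v‖ = 1 → ‖fderiv ℝ (u n) z v‖ ≤ (n + 1) * C := fun v hv => by
      rw [h2.fderiv]
      simp only [ContinuousLinearMap.comp_apply, smul_apply, ContinuousLinearMap.id_apply, map_smul]
      rw [norm_smul, Real.norm_of_nonneg (by positivity)]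
      refine mul_le_mul_of_nonneg_left ?_ (by positivity)
      refine (ContinuousLinearMap.le_opNorm _ _).trans ?_
      rw [hv, mul_one]; exact hC _
    unfold dbar
    refine (norm_add_le _ _).trans ?_
    rw [norm_mul, norm_I, one_mul]
    linarith [h3 1 (by simp), h3 I (by simp)]
  have hud0 : ∀ (n : ℕ) z, 2 < (n + 1 : ℝ) * ‖z - b‖ → dbar (u n) z = 0 := fun n z hz => by
    have : u n =ᶠ[𝓝 z] fun _ => 0 := by
      have hop : IsOpen {w : ℂ | 2 < (n + 1 : ℝ) * ‖w - b‖} :=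
        isOpen_lt continuous_const (by fun_prop)
      filter_upwards [hop.mem_nhds hz] with w hw using hu0 n w (le_of_lt hw)
    simp [dbar, this.fderiv_eq]
  have hlim : ∀ z, z ≠ b → ∀ᶠ n : ℕ in atTop, 2 ≤ (n + 1 : ℝ) * ‖z - b‖ := fun z hz => by
    have hpos : 0 < ‖z - b‖ := norm_pos_iff.2 (sub_ne_zero.2 hz)
    have : Tendsto (fun n : ℕ => ((n : ℝ) + 1) * ‖z - b‖) atTop atTop :=
      (tendsto_atTop_add_const_right _ _ tendsto_natCast_atTop_atTop).atTop_mul_const hpos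
    exact this.eventually_ge_atTop 2
  have hfn : ∀ n, GaussGreen E (fun z => (1 - u n z) * f z) := fun n => by
    refine h _ ((contDiff_const.sub (huC n)).mul hf) ?_
    rw [← disjoint_comm, disjoint_insert_left]
    refine ⟨?_, ?_⟩
    · rw [notMem_tsupport_iff_eventuallyEq]
      have hop : IsOpen {w : ℂ | ((n + 1 : ℝ) : ℂ) * (w - b) ∈ Metric.ball (0 : ℂ) 1} :=
        Metric.isOpen_ball.preimage (hlinC n).continuous
      filter_upwards [hop.mem_nhds (by simp)] with w hw
      have : χ (((n + 1 : ℝ) : ℂ) * (w - b)) = 1 := χ.one_of_mem_closedBall (by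
        rw [hin]; exact Metric.ball_subset_closedBall hw)
      simp only [hu, hc, this]; simp
    · refine hfB.symm.mono_right (closure_mono fun z hz => ?_)
      simp only [Function.mem_support] at hz ⊢
      exact right_ne_zero_of_mul hz
  have hdb : ∀ n z, I * dbar (fun z => (1 - u n z) * f z) z =
      (1 - u n z) * (I * dbar f z) - I * f z * dbar (u n) z := fun n z => by
    rw [dbar_mul (DifferentiableAt.const_sub ((huC n).differentiable one_ne_zero z) 1)
      (hf.differentiable one_ne_zero z)]
    have : dbar (fun z => 1 - u n z) z = - dbar (u n) z := by
      simp only [dbar, fderiv_const_sub, neg_apply]; ring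
    rw [this]; ring
  have hI1 := integrableOn_of_isBounded hb (continuous_const.mul (continuous_dbar hf) : Continuous fun z => I * dbar f z)
  have hb1 : ∀ n z, ‖1 - u n z‖ ≤ 2 := fun n z => by
    refine (norm_sub_le _ _).trans ?_
    rw [norm_one]; linarith [hu1 n z]
  have t1 : Tendsto (fun n => ∫ z in E, (1 - u n z) * (I * dbar f z)) atTop
      (𝓝 (∫ z in E, I * dbar f z)) := by
    refine tendsto_integral_of_dominated_convergence (fun z => 2 * ‖I * dbar f z‖) (fun n => ?_)
      (hI1.norm.const_mul 2) (fun n => ae_of_all _ fun z => ?_) ?_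
    · exact (Continuous.aestronglyMeasurable ((continuous_const.sub (huC n).continuous).mul
        (continuous_const.mul (continuous_dbar hf))))
    · rw [norm_mul]; exact mul_le_mul_of_nonneg_right (hb1 n z) (norm_nonneg _)
    · have : ∀ᵐ z ∂(volume.restrict E : Measure ℂ), z ≠ b := by
        simp [ae_iff]
      filter_upwards [this] with z hz
      refine tendsto_const_nhds.congr' ?_
      filter_upwards [hlim z hz] with n hn
      rw [hu0 n z hn]; ring
  have t2 : Tendsto (fun n => ∫ z in regBoundary E, (1 - u n z) * f z * tangent E z ∂μH[1]) atTop
      (𝓝 (∫ z in regBoundary E, f z * tangent E z ∂μH[1])) := by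
    refine tendsto_integral_of_dominated_convergence (fun z => 2 * ‖f z * tangent E z‖) (fun n => ?_)
      ((integrableOn_tangent hb hfin hf.continuous).norm.const_mul 2) (fun n => ae_of_all _ fun z => ?_) ?_
    · exact aestronglyMeasurable_tangent ((continuous_const.sub (huC n).continuous).mul hf.continuous)
        measurableSet_regBoundary subset_rfl _
    · rw [mul_assoc, norm_mul]; exact mul_le_mul_of_nonneg_right (hb1 n z) (norm_nonneg _)
    · have : ∀ᵐ z ∂(μH[1].restrict (regBoundary E) : Measure ℂ), z ≠ b := by
        refine ae_restrict_of_ae ?_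
        have := Measure.nullSingletonClass_hausdorff ℂ one_pos
        simp [ae_iff]
      filter_upwards [this] with z hz
      refine tendsto_const_nhds.congr' ?_
      filter_upwards [hlim z hz] with n hn
      rw [hu0 n z hn]; ring
  obtain ⟨R, hR⟩ := hb.subset_closedBall (0 : ℂ)
  obtain ⟨M, hM⟩ := (isCompact_closedBall (0 : ℂ) R).exists_bound_of_continuousOn hf.continuous.continuousOn
  have t3 : Tendsto (fun n => ∫ z in E, I * f z * dbar (u n) z) atTop (𝓝 0) := by
    refine squeeze_zero_norm (a := fun n : ℕ => (8 * |M| * C * Real.pi) * (1 / ((n : ℝ) + 1))) (fun n => ?_) ?_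
    · have hn : (0 : ℝ) < n + 1 := by positivity
      rw [setIntegral_eq_of_subset_of_forall_sdiff_eq_zero hE.measurableSet
        (s := E ∩ Metric.closedBall b (2 / (n + 1))) inter_subset_left (fun z hz => by
          rw [hud0 n z, mul_zero]
          by_contra hc
          refine hz.2 ⟨hz.1, ?_⟩
          rw [mem_closedBall_iff_norm, le_div_iff₀ hn]; linarith)]
      have hv : volume.real (E ∩ Metric.closedBall b (2 / (n + 1))) ≤ (2 / (n + 1)) ^ 2 * Real.pi := by
        refine (measureReal_mono inter_subset_right measure_closedBall_lt_top.ne).trans (le_of_eq ?_)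
        rw [measureReal_def, Complex.volume_closedBall, ENNReal.toReal_mul, ← ENNReal.ofReal_pow (by positivity),
          ENNReal.toReal_ofReal (by positivity)]
        simp
      refine (norm_setIntegral_le_of_norm_le_const (C := |M| * (2 * ((n + 1) * C)))
        ((measure_mono inter_subset_right).trans_lt measure_closedBall_lt_top) fun z hz => ?_).trans ?_
      · rw [norm_mul, norm_mul, norm_I, one_mul]
        exact mul_le_mul ((hM z (hR hz.1)).trans (le_abs_self _)) (hud n z) (norm_nonneg _) (abs_nonneg _)
      · refine (mul_le_mul_of_nonneg_left hv (by positivity)).trans (le_of_eq ?_)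
        field_simp; ring
    · simpa using (tendsto_one_div_add_atTop_nhds_zero_nat (𝕜 := ℝ)).const_mul (8 * |M| * C * Real.pi)
  unfold GaussGreen at hfn ⊢
  refine tendsto_nhds_unique ?_ t2
  have := t1.sub t3
  rw [sub_zero] at this
  refine this.congr fun n => ?_
  rw [← hfn n]
  simp only [hdb]
  rw [integral_sub]
  · exact integrableOn_of_isBounded hb ((continuous_const.sub (huC n).continuous).mul
        (continuous_const.mul (continuous_dbar hf)))
  · exact integrableOn_of_isBounded hb ((continuous_const.mul hf.continuous).mul (continuous_dbar (huC n)))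

/-- The Gauss-Green formula for a bounded open set with piecewise circular boundary. -/
theorem gaussGreen (hE : IsOpen E) (hb : Bornology.IsBounded E)
    (hA : HasPiecewiseConstCurvBoundary E) {f : ℂ → ℂ} (hf : ContDiff ℝ 1 f) : GaussGreen E f := by
  have hfin : μH[1] (regBoundary E) < ⊤ :=
    (measure_mono regBoundary_subset_frontier).trans_lt (hausdorffMeasure_frontier_lt_top hA)
  obtain ⟨B, hB, hloc⟩ := exists_finite_bad hE hA
  have key : ∀ B' : Set ℂ, B'.Finite → (∀ f : ℂ → ℂ, ContDiff ℝ 1 f → Disjoint (tsupport f) B' →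
      GaussGreen E f) → ∀ f : ℂ → ℂ, ContDiff ℝ 1 f → GaussGreen E f := by
    intro B' hB'
    induction B', hB' using Set.Finite.induction_on with
    | empty => exact fun h f hf => h f hf (disjoint_empty _)
    | insert _ _ ih => exact fun h => ih fun f hf hfB => gaussGreen_remove_point hE hb hfin h hf hfB
  exact key B hB (fun f hf hfB => gaussGreen_of_local hE hb hfin hf fun p hp =>
    hloc p (disjoint_left.1 hfB hp)) f hf

end Global
end

/-! ### Integer valued fields -/

noncomputable section
open Complex

/-- A bounded integer valued function with bounded support and negligible discontinuities. -/
structure IntField (n : ℂ → ℝ) : Prop where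
  integer : ∀ z, ∃ m : ℤ, n z = m
  measurable : Measurable n
  bounded : ∃ C, ∀ z, |n z| ≤ C
  support : ∃ R, ∀ z, R < ‖z‖ → n z = 0
  continuousAt : ∀ᵐ z, ContinuousAt n z

namespace IntField

variable {n m : ℂ → ℝ}

lemma zero : IntField fun _ => 0 :=
  ⟨fun _ => ⟨0, by simp⟩, measurable_const, ⟨0, by simp⟩, ⟨0, by simp⟩,
    ae_of_all _ fun _ => continuousAt_const⟩

lemma neg (hn : IntField n) : IntField fun z => -n z := by
  obtain ⟨C, hC⟩ := hn.bounded
  obtain ⟨R, hR⟩ := hn.support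
  refine ⟨fun z => ?_, hn.measurable.neg, ⟨C, fun z => by simpa using hC z⟩,
    ⟨R, fun z hz => by simp [hR z hz]⟩, ?_⟩
  · obtain ⟨k, hk⟩ := hn.integer z
    exact ⟨-k, by simp [hk]⟩
  · filter_upwards [hn.continuousAt] with z hz using hz.neg

lemma add (hn : IntField n) (hm : IntField m) : IntField fun z => n z + m z := by
  obtain ⟨C, hC⟩ := hn.bounded
  obtain ⟨R, hR⟩ := hn.support
  obtain ⟨C', hC'⟩ := hm.bounded
  obtain ⟨R', hR'⟩ := hm.support
  refine ⟨fun z => ?_, hn.measurable.add hm.measurable,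
    ⟨C + C', fun z => (abs_add_le _ _).trans (add_le_add (hC z) (hC' z))⟩,
    ⟨max R R', fun z hz => ?_⟩, ?_⟩
  · obtain ⟨k, hk⟩ := hn.integer z
    obtain ⟨l, hl⟩ := hm.integer z
    exact ⟨k + l, by simp [hk, hl]⟩
  · rw [hR z ((le_max_left _ _).trans_lt hz), hR' z ((le_max_right _ _).trans_lt hz), add_zero]
  · filter_upwards [hn.continuousAt, hm.continuousAt] with z hz hz' using hz.add hz'

lemma sum {ι : Type*} (s : Finset ι) {n : ι → ℂ → ℝ} (hn : ∀ i ∈ s, IntField (n i)) :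
    IntField fun z => ∑ i ∈ s, n i z := by
  classical
  induction s using Finset.induction_on with
  | empty => simpa using zero
  | insert i s hi ih =>
    simp only [Finset.sum_insert hi]
    exact (hn i (Finset.mem_insert_self i s)).add (ih fun j hj => hn j (Finset.mem_insert_of_mem hj))

lemma indicator {S : Set ℂ} (hS : MeasurableSet S) (hb : Bornology.IsBounded S)
    (hf : volume (frontier S) = 0) : IntField (S.indicator fun _ => 1) := by
  classical
  obtain ⟨R, hR⟩ := hb.subset_closedBall (0 : ℂ)
  refine ⟨fun z => ?_, measurable_const.indicator hS, ⟨1, fun z => ?_⟩, ⟨R, fun z hz => ?_⟩, ?_⟩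
  · by_cases hz : z ∈ S
    · exact ⟨1, by simp [hz]⟩
    · exact ⟨0, by simp [hz]⟩
  · by_cases hz : z ∈ S <;> simp [hz]
  · refine indicator_of_notMem (fun hzS => ?_) _
    have := hR hzS
    rw [Metric.mem_closedBall, dist_zero_right] at this
    linarith
  · have : ∀ᵐ z, z ∉ frontier S := by rw [ae_iff]; simpa using hf
    filter_upwards [this] with z hz
    have hmem : z ∈ interior S ∨ z ∈ interior Sᶜ := by
      rw [frontier_eq_closure_inter_closure, mem_inter_iff, not_and_or, ← mem_compl_iff,
        ← mem_compl_iff, ← interior_compl, ← interior_compl, compl_compl] at hz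
      exact hz.symm
    rcases hmem with h | h
    · refine (continuousAt_const (y := (1 : ℝ))).congr ?_
      filter_upwards [isOpen_interior.mem_nhds h] with w hw
      simp [interior_subset hw]
    · refine (continuousAt_const (y := (0 : ℝ))).congr ?_
      filter_upwards [isOpen_interior.mem_nhds h] with w hw
      have : w ∉ S := interior_subset hw
      simp [this]

lemma integrable_mul (hn : IntField n) {g : ℂ → ℂ} (hg : Continuous g) :
    Integrable fun z => (n z : ℂ) * g z := by
  obtain ⟨C, hC⟩ := hn.bounded
  obtain ⟨R, hR⟩ := hn.support
  have h1 : IntegrableOn g (Metric.closedBall 0 R) :=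
    hg.continuousOn.integrableOn_compact (isCompact_closedBall 0 R)
  have h2 : IntegrableOn (fun z => (n z : ℂ) * g z) (Metric.closedBall 0 R) := by
    refine Integrable.bdd_mul (c := C) h1 (measurable_ofReal.comp hn.measurable).aestronglyMeasurable ?_
    exact ae_of_all _ fun z => by simpa using hC z
  refine (integrableOn_iff_integrable_of_support_subset fun z hz => ?_).1 h2
  by_contra hc
  refine hz ?_
  change (n z : ℂ) * g z = 0
  rw [hR z (by simpa using hc)]; simp

lemma integrable (hn : IntField n) : Integrable n := by
  have := (hn.integrable_mul (g := fun _ => 1) continuous_const).re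
  simpa using this

end IntField

/-! ### The signed region between an arc and its chord -/

lemma image_null_of_null {H : ℝ × ℝ → ℂ} (hH : Differentiable ℝ H) {N : Set (ℝ × ℝ)}
    (hN : volume N = 0) : volume (H '' N) = 0 := by
  have e1 : H '' N = (H ∘ equivRealProd) '' (equivRealProd ⁻¹' N) := by
    rw [image_comp, image_preimage_eq _ equivRealProd.surjective]
  rw [e1]
  refine addHaar_image_eq_zero_of_differentiableOn_of_addHaar_eq_zero volume ?_ ?_
  · exact (hH.comp (equivRealProdCLM : ℂ →L[ℝ] ℝ × ℝ).differentiable).differentiableOn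
  · exact volume_preserving_equiv_real_prod.quasiMeasurePreserving.preimage_null hN

lemma image_mem_nhds_of_jac_ne_zero {H : ℝ × ℝ → ℂ} (hH : ContDiff ℝ 2 H) {U : Set (ℝ × ℝ)}
    {x : ℝ × ℝ} (hU : U ∈ 𝓝 x) (hx : jac (fderiv ℝ H x) ≠ 0) : H '' U ∈ 𝓝 (H x) := by
  have hst := hH.contDiffAt.hasStrictFDerivAt (x := x) two_ne_zero
  have hsurj : (fderiv ℝ H x : ℝ × ℝ →L[ℝ] ℂ).range = ⊤ := by
    rw [LinearMap.range_eq_top]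
    intro w
    set A := fderiv ℝ H x (1, 0) with hA
    set B := fderiv ℝ H x (0, 1) with hB
    set J := jac (fderiv ℝ H x) with hJ
    have hJ' : J = A.re * B.im - A.im * B.re := rfl
    refine ⟨((w.re * B.im - w.im * B.re) / J, (A.re * w.im - A.im * w.re) / J), ?_⟩
    have e : (((w.re * B.im - w.im * B.re) / J, (A.re * w.im - A.im * w.re) / J) : ℝ × ℝ) =
      ((w.re * B.im - w.im * B.re) / J) • ((1, 0) : ℝ × ℝ) + ((A.re * w.im - A.im * w.re) / J) • ((0, 1) : ℝ × ℝ) := by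
      simp
    change fderiv ℝ H x _ = w
    rw [e, map_add, map_smul, map_smul, ← hA, ← hB]
    apply Complex.ext
    · simp only [add_re, real_smul, re_ofReal_mul]
      field_simp; rw [hJ']; ring
    · simp only [add_im, real_smul, im_ofReal_mul]
      field_simp; rw [hJ']; ring
  rw [← hst.map_nhds_eq_of_surj hsurj]
  exact image_mem_map hU

/-- The signed area between an arc of curvature `κ` and length `ℓ` and its chord. -/
def segArea (κ ℓ : ℝ) : ℝ := (κ * ℓ - Real.sin (κ * ℓ)) / (2 * κ ^ 2)

/-- The fan from the initial point of an arc. -/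
def fan (γ : ℝ → ℂ) (x : ℝ × ℝ) : ℂ := γ 0 + x.2 * (γ x.1 - γ 0)

section Fan

variable {γ : ℝ → ℂ} {T : ℂ} {κ : ℝ}

lemma contDiff_fan (h : UnitArc γ T κ) : ContDiff ℝ 2 (fan γ) := by
  have h1 : ContDiff ℝ 2 fun x : ℝ × ℝ => γ x.1 := h.contDiff.comp contDiff_fst
  have h2 : ContDiff ℝ 2 fun x : ℝ × ℝ => (x.2 : ℂ) := ofRealCLM.contDiff.comp contDiff_snd
  unfold fan
  exact contDiff_const.add (h2.mul (h1.sub contDiff_const))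

lemma fderiv_fan_fst (h : UnitArc γ T κ) (x : ℝ × ℝ) :
    fderiv ℝ (fan γ) x (1, 0) = x.2 * (T * exp (((κ * x.1 : ℝ) : ℂ) * I)) := by
  have hd := ((contDiff_fan h).differentiable two_ne_zero x).hasFDerivAt
  have hc : HasDerivAt (fun t : ℝ => ((t, x.2) : ℝ × ℝ)) (1, 0) x.1 :=
    (hasDerivAt_id x.1).prodMk (hasDerivAt_const _ _)
  have h1 : HasDerivAt (fan γ ∘ fun t : ℝ => ((t, x.2) : ℝ × ℝ))
      (fderiv ℝ (fan γ) x (1, 0)) x.1 := hd.comp_hasDerivAt x.1 hc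
  exact h1.unique ((((h.hasDerivAt x.1).sub_const (γ 0)).const_mul (x.2 : ℂ)).const_add (γ 0))

lemma fderiv_fan_snd (h : UnitArc γ T κ) (x : ℝ × ℝ) :
    fderiv ℝ (fan γ) x (0, 1) = γ x.1 - γ 0 := by
  have hd := ((contDiff_fan h).differentiable two_ne_zero x).hasFDerivAt
  have hc : HasDerivAt (fun t : ℝ => ((x.1, t) : ℝ × ℝ)) (0, 1) x.2 :=
    (hasDerivAt_const _ _).prodMk (hasDerivAt_id x.2)
  have h1 : HasDerivAt (fan γ ∘ fun t : ℝ => ((x.1, t) : ℝ × ℝ))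
      (fderiv ℝ (fan γ) x (0, 1)) x.2 := hd.comp_hasDerivAt x.2 hc
  rw [h1.unique (((ofRealCLM.hasDerivAt (x := x.2)).mul_const (γ x.1 - γ 0)).const_add (γ 0))]
  simp

lemma conj_chord_mul_deriv (h : UnitArc γ T κ) (t : ℝ) :
    (starRingEnd ℂ) (γ t - γ 0) * (T * exp (((κ * t : ℝ) : ℂ) * I)) =
      (t * Real.sinc (κ * t / 2) : ℝ) * exp (((κ * t / 2 : ℝ) : ℂ) * I) := by
  have hc := h.chord 0 t
  rw [sub_zero, add_zero] at hc
  rw [hc, map_mul, map_mul, conj_ofReal, ← exp_conj, map_mul, conj_ofReal, conj_I]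
  have h1 : (starRingEnd ℂ) T * T = 1 := by
    rw [mul_comm, mul_conj, normSq_eq_norm_sq, h.norm_one]; simp
  have h2 : exp (((κ * t / 2 : ℝ) : ℂ) * -I) * exp (((κ * t : ℝ) : ℂ) * I) = exp (((κ * t / 2 : ℝ) : ℂ) * I) := by
    rw [← exp_add]; push_cast; ring_nf
  linear_combination (t * Real.sinc (κ * t / 2) : ℝ) * (exp (((κ * t / 2 : ℝ) : ℂ) * -I) * exp (((κ * t : ℝ) : ℂ) * I)) * h1 +
    (t * Real.sinc (κ * t / 2) : ℝ) * h2

lemma conj_chord_mul_deriv_im (h : UnitArc γ T κ) (hκ : κ ≠ 0) (t : ℝ) :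
    ((starRingEnd ℂ) (γ t - γ 0) * (T * exp (((κ * t : ℝ) : ℂ) * I))).im =
      (1 - Real.cos (κ * t)) / κ := by
  rw [conj_chord_mul_deriv h, im_ofReal_mul, exp_ofReal_mul_I_im, eq_div_iff hκ]
  have h1 := UnitArc.mul_sinc_half κ t
  have h2 : Real.cos (κ * t) = 1 - 2 * Real.sin (κ * t / 2) ^ 2 := by
    rw [show κ * t = 2 * (κ * t / 2) by ring, Real.cos_two_mul, Real.cos_sq']
    ring_nf
  rw [h2]
  linear_combination Real.sin (κ * t / 2) * h1

lemma jac_fan (h : UnitArc γ T κ) (hκ : κ ≠ 0) (x : ℝ × ℝ) :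
    jac (fderiv ℝ (fan γ) x) = -(x.2 * ((1 - Real.cos (κ * x.1)) / κ)) := by
  rw [← conj_chord_mul_deriv_im h hκ, jac, fderiv_fan_fst h, fderiv_fan_snd h]
  generalize T * exp (((κ * x.1 : ℝ) : ℂ) * I) = D
  simp only [re_ofReal_mul, mul_im, conj_re, conj_im, ofReal_re, ofReal_im]
  ring

/-- Seen from `γ 0`, the point `γ t` has direction angle `κ t / 2` relative to `T`. This is strictly
monotone and sweeps at most `π`, so distinct rays of the fan do not meet. -/
lemma injOn_fan (h : UnitArc γ T κ) {ℓ : ℝ} (hκℓ : |κ| * ℓ ≤ 2 * Real.pi) (hκ : κ ≠ 0) :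
    InjOn (fan γ) (Ioo 0 ℓ ×ˢ Ioo 0 1) := by
  have hκ0 : 0 < |κ| := abs_pos.2 hκ
  have hpos : ∀ t ∈ Ioo 0 ℓ, 0 < t * Real.sinc (κ * t / 2) := by
    intro t ht
    have h1 : |κ| * t < 2 * Real.pi := (mul_lt_mul_of_pos_left ht.2 hκ0).trans_le hκℓ
    refine mul_pos ht.1 ?_
    have h2 : Real.sinc (κ * t / 2) = Real.sinc (|κ| * t / 2) := by
      rcases abs_cases κ with ⟨hk, _⟩ | ⟨hk, _⟩
      · rw [hk]
      · rw [hk, ← Real.sinc_neg]; congr 1; ring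
    have h3 : 0 < |κ| * t / 2 := by have := ht.1; positivity
    rw [h2, Real.sinc_of_ne_zero h3.ne']
    exact div_pos (Real.sin_pos_of_pos_of_lt_pi h3 (by linarith)) h3
  rintro ⟨t, s⟩ ⟨ht, hs⟩ ⟨t', s'⟩ ⟨ht', hs'⟩ heq
  dsimp only at *
  have hT0 : T ≠ 0 := by intro h0; have := h.norm_one; simp [h0] at this
  have hc := h.chord 0 t
  have hc' := h.chord 0 t'
  rw [sub_zero, add_zero] at hc hc'
  unfold fan at heq
  dsimp only at heq
  rw [hc, hc'] at heq
  set a := s * (t * Real.sinc (κ * t / 2)) with ha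
  set a' := s' * (t' * Real.sinc (κ * t' / 2)) with ha'
  have ha0 : 0 < a := mul_pos hs.1 (hpos t ht)
  have h1 : (a : ℂ) * exp (((κ * t / 2 : ℝ) : ℂ) * I) = a' * exp (((κ * t' / 2 : ℝ) : ℂ) * I) := by
    refine mul_left_cancel₀ hT0 ?_
    rw [ha, ha']
    push_cast at heq ⊢
    linear_combination heq
  have h2 : (a : ℂ) * exp (((κ * (t - t') / 2 : ℝ) : ℂ) * I) = a' := by
    have e1 : exp (((κ * t' / 2 : ℝ) : ℂ) * I) * exp (((-(κ * t' / 2) : ℝ) : ℂ) * I) = 1 := by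
      rw [← exp_add]; push_cast; ring_nf; exact exp_zero
    have e2 : exp (((κ * t / 2 : ℝ) : ℂ) * I) * exp (((-(κ * t' / 2) : ℝ) : ℂ) * I) =
        exp (((κ * (t - t') / 2 : ℝ) : ℂ) * I) := by
      rw [← exp_add]; push_cast; ring_nf
    rw [← e2]
    linear_combination exp (((-(κ * t' / 2) : ℝ) : ℂ) * I) * h1 + a' * e1
  have h3 : Real.sin (κ * (t - t') / 2) = 0 := by
    have := congrArg Complex.im h2
    rw [im_ofReal_mul, exp_ofReal_mul_I_im, ofReal_im] at this
    exact (mul_eq_zero.1 this).resolve_left ha0.ne'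
  have h4 : |κ * (t - t') / 2| < Real.pi := by
    rw [abs_div, abs_mul, abs_two]
    have : |t - t'| < ℓ := abs_lt.2 ⟨by linarith [ht.1, ht'.2], by linarith [ht.2, ht'.1]⟩
    have := mul_lt_mul_of_pos_left this hκ0
    linarith
  have h5 := (Real.sin_eq_zero_iff_of_lt_of_lt (abs_lt.1 h4).1 (abs_lt.1 h4).2).1 h3
  have h6 : t = t' := by
    have : κ * (t - t') = 0 := by linarith
    linarith [(mul_eq_zero.1 this).resolve_left hκ]
  subst h6
  have h7 : a = a' := by
    have : (a : ℂ) = a' := by rw [← h2, h5]; simp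
    exact_mod_cast this
  rw [ha, ha'] at h7
  rw [mul_right_cancel₀ (hpos t ht).ne' h7]

/-- The region between an arc and its chord, with multiplicity. -/
lemma exists_segment_field (h : UnitArc γ T κ) {ℓ : ℝ} (hℓ : 0 ≤ ℓ) (hκℓ : |κ| * ℓ ≤ 2 * Real.pi) :
    ∃ n : ℂ → ℝ, IntField n ∧ (∫ z, n z = segArea κ ℓ) ∧ ∀ f : ℂ → ℂ, ContDiff ℝ 1 f →
      ∫ z, (n z : ℂ) * (I * dbar f z) =
        (∫ t in (0:ℝ)..ℓ, f (γ t) * (T * exp (((κ * t : ℝ) : ℂ) * I))) -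
        ∫ s in (0:ℝ)..1, f (γ 0 + s * (γ ℓ - γ 0)) * (γ ℓ - γ 0) := by
  rcases eq_or_ne κ 0 with rfl | hκ
  · refine ⟨fun _ => 0, IntField.zero, by simp [segArea], fun f hf => ?_⟩
    have hγ : ∀ t, γ t = γ 0 + t * T := fun t => by
      have := h.chord 0 t
      simp only [zero_mul, zero_div, Real.sinc_zero, mul_one, ofReal_zero, exp_zero, sub_zero] at this
      rw [← this]; ring
    have h1 := intervalIntegral.smul_integral_comp_mul_right (a := 0) (b := 1)
      (fun t : ℝ => f (γ 0 + t * T) * T) ℓ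
    rw [zero_mul, one_mul] at h1
    simp only [ofReal_zero, zero_mul, integral_zero, exp_zero, mul_one]
    rw [eq_comm, sub_eq_zero]
    calc ∫ t in (0:ℝ)..ℓ, f (γ t) * T = ∫ t in (0:ℝ)..ℓ, f (γ 0 + t * T) * T := by simp only [← hγ]
      _ = _ := h1.symm
      _ = _ := by
        rw [← intervalIntegral.integral_smul]
        refine intervalIntegral.integral_congr fun s _ => ?_
        simp only [hγ ℓ, real_smul]
        push_cast
        rw [show (s : ℂ) * ℓ * T = s * (γ 0 + ℓ * T - γ 0) by ring]
        ring
  · have hκ0 : 0 < |κ| := abs_pos.2 hκ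
    set U : Set (ℝ × ℝ) := Ioo 0 ℓ ×ˢ Ioo 0 1 with hU
    have hUm : MeasurableSet U := measurableSet_Ioo.prod measurableSet_Ioo
    have hUo : IsOpen U := isOpen_Ioo.prod isOpen_Ioo
    have hinj : InjOn (fan γ) U := injOn_fan h hκℓ hκ
    set S := fan γ '' U with hS
    have hSm : MeasurableSet S := hUm.image_of_continuousOn_injOn
      (contDiff_fan h).continuous.continuousOn hinj
    have hcos : ∀ x ∈ U, 0 < 1 - Real.cos (κ * x.1) := fun x hx => by
      have h1 : |κ| * x.1 < 2 * Real.pi := (mul_lt_mul_of_pos_left hx.1.2 hκ0).trans_le hκℓ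
      have h2 : |κ * x.1| = |κ| * x.1 := by rw [abs_mul, abs_of_pos hx.1.1]
      rw [sub_pos]
      refine lt_of_le_of_ne (Real.cos_le_one _) fun hc => ?_
      rw [Real.cos_eq_one_iff_of_lt_of_lt (by linarith [neg_abs_le (κ * x.1)])
        (by linarith [le_abs_self (κ * x.1)])] at hc
      have := hx.1.1
      rcases mul_eq_zero.1 hc with h | h
      · exact hκ h
      · linarith
    have hSo : IsOpen S := by
      rw [isOpen_iff_mem_nhds]
      rintro _ ⟨x, hx, rfl⟩
      refine image_mem_nhds_of_jac_ne_zero (contDiff_fan h) (hUo.mem_nhds hx) ?_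
      rw [jac_fan h hκ]
      exact neg_ne_zero.2 (mul_ne_zero hx.2.1.ne' (div_ne_zero (hcos x hx).ne' hκ))
    have hKc : IsCompact (fan γ '' (Icc 0 ℓ ×ˢ Icc 0 1)) :=
      (isCompact_Icc.prod isCompact_Icc).image (contDiff_fan h).continuous
    have hSK : S ⊆ fan γ '' (Icc 0 ℓ ×ˢ Icc 0 1) :=
      image_mono (prod_mono Ioo_subset_Icc_self Ioo_subset_Icc_self)
    have hSb : Bornology.IsBounded S := hKc.isBounded.subset hSK
    have hSf : volume (frontier S) = 0 := by
      have hnull : volume ((Icc 0 ℓ ×ˢ Icc 0 1 : Set (ℝ × ℝ)) \ U) = 0 :=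
        (ae_eq_set.1 (Measure.set_prod_ae_eq (μ := (volume : Measure ℝ)) (ν := (volume : Measure ℝ)) Ioo_ae_eq_Icc Ioo_ae_eq_Icc)).2
      refine measure_mono_null ?_ (image_null_of_null ((contDiff_fan h).differentiable two_ne_zero) hnull)
      rintro z hz
      rw [hSo.frontier_eq] at hz
      obtain ⟨x, hx, rfl⟩ := closure_minimal hSK hKc.isClosed hz.1
      exact ⟨x, ⟨hx, fun hxU => hz.2 ⟨x, hxU, rfl⟩⟩, rfl⟩
    have hind : IntField (S.indicator fun _ => 1) := IntField.indicator hSm hSb hSf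
    -- The multiplicity is the sign `|κ| / κ`: the arc followed by the reversed chord runs
    -- counterclockwise exactly when `κ > 0`.
    obtain ⟨n, hn, hnσ⟩ : ∃ n, IntField n ∧ ∀ z, n z = (|κ| / κ) * S.indicator (fun _ => (1 : ℝ)) z := by
      rcases abs_cases κ with ⟨hk, _⟩ | ⟨hk, _⟩
      · exact ⟨_, hind, fun z => by rw [hk, div_self hκ, one_mul]⟩
      · exact ⟨_, hind.neg, fun z => by rw [hk, neg_div, div_self hκ, neg_one_mul]⟩
    have hform : ∀ f : ℂ → ℂ, ContDiff ℝ 1 f →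
      ∫ z, (n z : ℂ) * (I * dbar f z) =
        (∫ t in (0:ℝ)..ℓ, f (γ t) * (T * exp (((κ * t : ℝ) : ℂ) * I))) -
        ∫ s in (0:ℝ)..1, f (γ 0 + s * (γ ℓ - γ 0)) * (γ ℓ - γ 0) := by
      intro f hf
      have h1 : ∀ z, (n z : ℂ) * (I * dbar f z) = ((|κ| / κ : ℝ) : ℂ) * S.indicator (fun z => I * dbar f z) z := by
        intro z
        rw [hnσ]
        by_cases hz : z ∈ S <;> simp [hz]
      simp only [h1]
      rw [integral_const_mul, integral_indicator hSm]
      have hgg := gaussGreen_rect (contDiff_fan h) hf (a := (0, 0)) (b := (ℓ, 1))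
        (Prod.mk_le_mk.2 ⟨hℓ, zero_le_one⟩) (σ := -(|κ| / κ)) (fun x hx => by
          rw [jac_fan h hκ, abs_neg, abs_mul, abs_of_pos hx.2.1, abs_div, abs_of_pos (hcos x hx)]
          have : |κ| * |κ| = κ * κ := abs_mul_abs_self κ
          field_simp
          linear_combination -x.2 * (1 - Real.cos (κ * x.1)) * this) hinj
      dsimp only at hgg
      rw [hgg]
      have hsq : ((|κ| / κ : ℝ) : ℂ) * ((|κ| / κ : ℝ) : ℂ) = 1 := by
        rw [← ofReal_mul, div_mul_div_comm, abs_mul_abs_self, div_self (mul_ne_zero hκ hκ), ofReal_one]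
      -- The sides `s = 0` and `t = 0` of the rectangle collapse to the point `γ 0`; the side `s =
      -- 1` is the arc and the side `t = ℓ` is the chord.
      simp only [fderiv_fan_fst h, fderiv_fan_snd h, ofReal_zero, ofReal_one, zero_mul, mul_zero,
        intervalIntegral.integral_zero, one_mul, sub_self, fan, sub_zero, zero_sub, add_sub_cancel]
      push_cast at hsq ⊢
      linear_combination ((∫ t in (0:ℝ)..ℓ, f (γ t) * (T * exp (κ * t * I))) -
        ∫ s in (0:ℝ)..1, f (γ 0 + s * (γ ℓ - γ 0)) * (γ ℓ - γ 0)) * hsq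
    refine ⟨n, hn, ?_, hform⟩
    -- The area is read off by testing with `conj (z - γ 0)`, whose `dbar` is `2`. The chord
    -- contributes a real number, so it disappears from the imaginary part.
    have hcc : ContDiff ℝ 1 fun z : ℂ => (starRingEnd ℂ) (z - γ 0) :=
      (conjCLE : ℂ →L[ℝ] ℂ).contDiff.comp (contDiff_id.sub contDiff_const)
    have h1 := hform _ hcc
    have h2 : ∀ z, dbar (fun z : ℂ => (starRingEnd ℂ) (z - γ 0)) z = 2 := by
      intro z
      have : HasFDerivAt (fun z : ℂ => (starRingEnd ℂ) (z - γ 0)) (conjCLE : ℂ →L[ℝ] ℂ) z :=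
        (conjCLE : ℂ →L[ℝ] ℂ).hasFDerivAt.comp z ((hasFDerivAt_id z).sub_const (γ 0))
      rw [dbar, this.fderiv]
      simp
      norm_num
    simp only [h2] at h1
    rw [integral_mul_const, integral_complex_ofReal] at h1
    have h3 := congrArg Complex.im h1
    have h4 : (∫ t in (0:ℝ)..ℓ, (starRingEnd ℂ) (γ t - γ 0) * (T * exp (((κ * t : ℝ) : ℂ) * I))).im =
        2 * segArea κ ℓ := by
      have hci : IntervalIntegrable (fun t : ℝ => (starRingEnd ℂ) (γ t - γ 0) * (T * exp (((κ * t : ℝ) : ℂ) * I))) volume 0 ℓ := by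
        refine Continuous.intervalIntegrable ?_ _ _
        have := h.continuous
        fun_prop
      have := ContinuousLinearMap.intervalIntegral_comp_comm imCLM hci
      simp only [imCLM_apply, conj_chord_mul_deriv_im h hκ] at this
      rw [← this]
      have hd : ∀ t ∈ uIcc 0 ℓ, HasDerivAt (fun t => (t - Real.sin (κ * t) / κ) / κ) ((1 - Real.cos (κ * t)) / κ) t := by
        intro t _
        have h0 : HasDerivAt (fun t => κ * t) κ t := by simpa using (hasDerivAt_id t).const_mul κ
        have := ((hasDerivAt_id t).sub (h0.sin.div_const κ)).div_const κ
        refine this.congr_deriv ?_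
        field_simp
      rw [intervalIntegral.integral_eq_sub_of_hasDerivAt hd (Continuous.intervalIntegrable (by fun_prop) _ _)]
      simp only [mul_zero, Real.sin_zero, zero_div, sub_zero, segArea]
      field_simp
    have h5 : (∫ s in (0:ℝ)..1, (starRingEnd ℂ) (γ 0 + s * (γ ℓ - γ 0) - γ 0) * (γ ℓ - γ 0)).im = 0 := by
      have : ∀ s : ℝ, (starRingEnd ℂ) (γ 0 + s * (γ ℓ - γ 0) - γ 0) * (γ ℓ - γ 0) = ((s * normSq (γ ℓ - γ 0) : ℝ) : ℂ) := by
        intro s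
        rw [add_sub_cancel_left, map_mul, conj_ofReal, ofReal_mul, ← mul_conj]; ring
      simp only [this]
      rw [intervalIntegral.integral_ofReal, ofReal_im]
    rw [sub_im, h4, h5] at h3
    simp at h3
    linarith

end Fan
end

/-! ### The isoperimetric inequality for integer valued fields -/

noncomputable section
open Complex

/-- `f` is real differentiable at `z` and `d` is twice its derivative with respect to `z̄`. -/
def HasDbarAt (f : ℂ → ℂ) (d z : ℂ) : Prop :=
  ∃ f' : ℂ →L[ℝ] ℂ, HasFDerivAt f f' z ∧ f' 1 + I * f' I = d

namespace HasDbarAt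

variable {f g : ℂ → ℂ} {d e z : ℂ}

lemma dbar (h : HasDbarAt f d z) : dbar f z = d := by
  obtain ⟨f', h1, h2⟩ := h
  rw [_root_.dbar, h1.fderiv, h2]

lemma const (c : ℂ) : HasDbarAt (fun _ => c) 0 z := ⟨0, hasFDerivAt_const c z, by simp⟩

lemma id : HasDbarAt (fun w => w) 0 z :=
  ⟨ContinuousLinearMap.id ℝ ℂ, hasFDerivAt_id z, by simp⟩

lemma conj : HasDbarAt (fun w => (starRingEnd ℂ) w) 2 z :=
  ⟨(conjCLE : ℂ →L[ℝ] ℂ), (conjCLE : ℂ →L[ℝ] ℂ).hasFDerivAt, by simp; norm_num⟩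

lemma add (hf : HasDbarAt f d z) (hg : HasDbarAt g e z) :
    HasDbarAt (fun w => f w + g w) (d + e) z := by
  obtain ⟨f', h1, h2⟩ := hf
  obtain ⟨g', h3, h4⟩ := hg
  exact ⟨f' + g', h1.add h3, by simp only [add_apply]; linear_combination h2 + h4⟩

lemma mul (hf : HasDbarAt f d z) (hg : HasDbarAt g e z) :
    HasDbarAt (fun w => f w * g w) (d * g z + f z * e) z := by
  obtain ⟨f', h1, h2⟩ := hf
  obtain ⟨g', h3, h4⟩ := hg
  refine ⟨_, h1.mul h3, ?_⟩
  simp only [add_apply, smul_apply, smul_eq_mul]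
  linear_combination g z * h2 + f z * h4

lemma inv (hf : HasDbarAt f d z) (h0 : f z ≠ 0) :
    HasDbarAt (fun w => (f w)⁻¹) (-d / f z ^ 2) z := by
  obtain ⟨f', h1, h2⟩ := hf
  have h3 : HasFDerivAt (fun w : ℂ => w⁻¹) ((ContinuousLinearMap.toSpanSingleton ℂ (-(f z ^ 2)⁻¹)).restrictScalars ℝ) (f z) :=
    ((hasDerivAt_inv h0).hasFDerivAt).restrictScalars ℝ
  refine ⟨_, h3.comp z h1, ?_⟩
  simp
  rw [← h2]; field_simp; ring

end HasDbarAt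

section Kernel

variable (δ : ℝ)

/-- The bounded kernel whose second `z̄`-derivative is an approximate identity. -/
def kern (u : ℂ) : ℂ := (starRingEnd ℂ) u * (starRingEnd ℂ) u * (u * (starRingEnd ℂ) u + (δ : ℂ) ^ 2)⁻¹

/-- The first `z̄`-derivative of `kern`. -/
def kern₁ (u : ℂ) : ℂ := 2 * (starRingEnd ℂ) u * (u * (starRingEnd ℂ) u + 2 * (δ : ℂ) ^ 2) *
  ((u * (starRingEnd ℂ) u + (δ : ℂ) ^ 2)⁻¹ * (u * (starRingEnd ℂ) u + (δ : ℂ) ^ 2)⁻¹)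

variable {δ}

lemma kern_denom_eq (u : ℂ) : u * (starRingEnd ℂ) u + (δ : ℂ) ^ 2 = ((‖u‖ ^ 2 + δ ^ 2 : ℝ) : ℂ) := by
  rw [mul_conj, normSq_eq_norm_sq]; push_cast; ring

lemma kern_denom_ne_zero (hδ : 0 < δ) (u : ℂ) : u * (starRingEnd ℂ) u + (δ : ℂ) ^ 2 ≠ 0 := by
  rw [kern_denom_eq, ofReal_ne_zero]; positivity

lemma norm_kern_le (hδ : 0 < δ) (u : ℂ) : ‖kern δ u‖ ≤ 1 := by
  rw [kern, kern_denom_eq, norm_mul, norm_mul, norm_inv, RCLike.norm_conj, norm_real,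
    Real.norm_of_nonneg (by positivity), ← div_eq_mul_inv, div_le_one (by positivity)]
  nlinarith [sq_nonneg δ]

lemma contDiff_conj' : ContDiff ℝ 2 fun u : ℂ => (starRingEnd ℂ) u := (conjCLE : ℂ →L[ℝ] ℂ).contDiff

lemma contDiff_kern_denom (hδ : 0 < δ) :
    ContDiff ℝ 2 fun u : ℂ => (u * (starRingEnd ℂ) u + (δ : ℂ) ^ 2)⁻¹ :=
  ((contDiff_id.mul contDiff_conj').add contDiff_const).inv (kern_denom_ne_zero hδ)

lemma contDiff_kern (hδ : 0 < δ) : ContDiff ℝ 2 (kern δ) :=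
  (contDiff_conj'.mul contDiff_conj').mul (contDiff_kern_denom hδ)

lemma contDiff_kern₁ (hδ : 0 < δ) : ContDiff ℝ 2 (kern₁ δ) :=
  ((contDiff_const.mul contDiff_conj').mul ((contDiff_id.mul contDiff_conj').add contDiff_const)).mul
    ((contDiff_kern_denom hδ).mul (contDiff_kern_denom hδ))

lemma hasDbarAt_kern (hδ : 0 < δ) (u : ℂ) : HasDbarAt (kern δ) (kern₁ δ u) u := by
  have h0 := kern_denom_ne_zero hδ u
  have hD := (HasDbarAt.id.mul HasDbarAt.conj).add (HasDbarAt.const ((δ : ℂ) ^ 2) (z := u))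
  have h : HasDbarAt (kern δ) _ u := (HasDbarAt.conj.mul HasDbarAt.conj).mul (hD.inv h0)
  convert h using 1
  rw [kern₁]
  field_simp
  ring

lemma hasDbarAt_kern₁ (hδ : 0 < δ) (u : ℂ) :
    HasDbarAt (kern₁ δ) ((8 * δ ^ 4 / (‖u‖ ^ 2 + δ ^ 2) ^ 3 : ℝ) : ℂ) u := by
  have h0 := kern_denom_ne_zero hδ u
  have hD := (HasDbarAt.id.mul HasDbarAt.conj).add (HasDbarAt.const ((δ : ℂ) ^ 2) (z := u))
  have hD' := (HasDbarAt.id.mul HasDbarAt.conj).add (HasDbarAt.const (2 * (δ : ℂ) ^ 2) (z := u))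
  have h : HasDbarAt (kern₁ δ) _ u := (((HasDbarAt.const 2).mul HasDbarAt.conj).mul hD').mul ((hD.inv h0).mul (hD.inv h0))
  convert h using 1
  push_cast
  have := kern_denom_eq (δ := δ) u
  push_cast at this
  rw [← this]
  field_simp
  ring

end Kernel

/-- The profile of the approximate identity. -/
def profile (u : ℂ) : ℝ := 8 / (‖u‖ ^ 2 + 1) ^ 3

lemma profile_pos (u : ℂ) : 0 < profile u := by unfold profile; positivity

lemma integral_profile : ∫ u, profile u = 4 * Real.pi := by
  have h := integral_fun_norm_addHaar (volume : Measure ℂ) (fun r : ℝ => 8 / (r ^ 2 + 1) ^ 3)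
  have h1 : ∫ r in Ioi (0 : ℝ), r * (8 / (r ^ 2 + 1) ^ 3) = 2 := by
    have hd : ∀ r ∈ Ici (0 : ℝ), HasDerivAt (fun r : ℝ => -2 / (r ^ 2 + 1) ^ 2) (r * (8 / (r ^ 2 + 1) ^ 3)) r := by
      intro r _
      have h0 : HasDerivAt (fun r : ℝ => (r ^ 2 + 1) ^ 2) (2 * (r ^ 2 + 1) * (2 * r)) r := by
        have := (((hasDerivAt_id r).pow 2).add_const 1).pow 2
        refine this.congr_deriv ?_
        simp
      have := (hasDerivAt_const r (-2 : ℝ)).div h0 (by positivity)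
      refine this.congr_deriv ?_
      field_simp; ring
    have hl : Tendsto (fun r : ℝ => -2 / (r ^ 2 + 1) ^ 2) atTop (𝓝 0) := by
      refine Tendsto.const_div_atTop ?_ _
      refine tendsto_atTop_mono (f := fun r : ℝ => r) (fun r => ?_) tendsto_id
      nlinarith [sq_nonneg (r - 1), sq_nonneg (r ^ 2), sq_nonneg r]
    rw [integral_Ioi_of_hasDerivAt_of_nonneg' hd (fun r hr => by
      have : 0 < r := hr
      positivity) hl]
    norm_num
  unfold profile
  rw [h]
  simp only [finrank_real_complex, Nat.add_one_sub_one, pow_one, smul_eq_mul, nsmul_eq_mul, h1,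
    measureReal_def, Complex.volume_ball]
  simp
  ring

/-- With `δ = 1/c`, the second derivative of the kernel is the rescaling of one fixed profile, of
total mass `4π`: an approximate identity as `c → ∞`. -/
lemma kernel_scaling {c : ℝ} (hc : 0 < c) (u : ℂ) :
    8 * c⁻¹ ^ 4 / (‖u‖ ^ 2 + c⁻¹ ^ 2) ^ 3 = c ^ 2 * profile (c • u) := by
  rw [profile, norm_smul, Real.norm_of_nonneg hc.le]
  field_simp

/-- Differentiation under the integral sign. -/
lemma IntField.hasFDerivAt_integral {n : ℂ → ℝ} (hn : IntField n) {g : ℂ → ℂ} (hg : ContDiff ℝ 1 g) :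
    (∀ w, HasFDerivAt (fun w => ∫ z, (n z : ℂ) * g (z - w))
      (∫ z, (n z) • -(fderiv ℝ g (z - w))) w) ∧
    Continuous (fun w => ∫ z, (n z) • -(fderiv ℝ g (z - w))) := by
  obtain ⟨C, hC⟩ := hn.bounded
  obtain ⟨R, hR⟩ := hn.support
  have hg' := hg.continuous_fderiv one_ne_zero
  have hbd : ∀ w₀ : ℂ, ∃ B, 0 ≤ B ∧ ∀ w ∈ Metric.ball w₀ 1, ∀ z, ‖(n z) • -(fderiv ℝ g (z - w))‖ ≤ B * ‖n z‖ := by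
    intro w₀
    obtain ⟨B, hB⟩ := (isCompact_closedBall (0 : ℂ) (R + ‖w₀‖ + 1)).exists_bound_of_continuousOn hg'.continuousOn
    refine ⟨|B|, abs_nonneg B, fun w hw z => ?_⟩
    rw [norm_smul, norm_neg, mul_comm]
    by_cases hz : R < ‖z‖
    · rw [hR z hz]; simp
    · refine mul_le_mul_of_nonneg_right ((hB _ ?_).trans (le_abs_self B)) (norm_nonneg _)
      rw [Metric.mem_closedBall, dist_zero_right]
      rw [Metric.mem_ball, dist_eq_norm] at hw
      have h1 := norm_sub_le z w
      have h2 := norm_le_norm_add_norm_sub' w w₀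
      push Not at hz
      linarith
  have hmeas : ∀ w, AEStronglyMeasurable (fun z => (n z) • -(fderiv ℝ g (z - w))) volume := fun w => by
    refine AEStronglyMeasurable.smul hn.measurable.aestronglyMeasurable ?_
    exact (hg'.comp (continuous_id.sub continuous_const)).neg.aestronglyMeasurable
  constructor
  · intro w₀
    obtain ⟨B, hB0, hB⟩ := hbd w₀
    refine hasFDerivAt_integral_of_dominated_of_fderiv_le (s := Metric.ball w₀ 1)
      (bound := fun z => B * ‖n z‖) (F' := fun w z => (n z) • -(fderiv ℝ g (z - w)))
      (Metric.ball_mem_nhds w₀ one_pos) ?_ ?_ (hmeas w₀) (ae_of_all _ fun z w hw => hB w hw z)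
      (hn.integrable.norm.const_mul B) (ae_of_all _ fun z w _ => ?_)
    · exact Eventually.of_forall fun w => (hn.integrable_mul
        (hg.continuous.comp (continuous_id.sub continuous_const))).aestronglyMeasurable
    · exact hn.integrable_mul (hg.continuous.comp (continuous_id.sub continuous_const))
    · have h1 : HasFDerivAt (fun w : ℂ => z - w) (-ContinuousLinearMap.id ℝ ℂ) w :=
        (hasFDerivAt_id w).const_sub z
      have h2 := ((hg.differentiable one_ne_zero (z - w)).hasFDerivAt.comp w h1).const_mul (n z : ℂ)
      refine h2.congr_fderiv ?_
      ext; simp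
  · rw [continuous_iff_continuousAt]
    intro w₀
    obtain ⟨B, hB0, hB⟩ := hbd w₀
    refine continuousAt_of_dominated (bound := fun z => B * ‖n z‖) (Eventually.of_forall hmeas) ?_
      (hn.integrable.norm.const_mul B) (ae_of_all _ fun z => ?_)
    · filter_upwards [Metric.ball_mem_nhds w₀ one_pos] with w hw
      exact ae_of_all _ (hB w hw)
    · exact Continuous.continuousAt ((hg'.comp (continuous_const.sub continuous_id)).neg.const_smul (n z))

/-- The isoperimetric inequality: if the boundary of `n` has mass at most `M`, then
`4 π ∫ n² ≤ M²`. -/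
theorem IntField.isoperimetric {n : ℂ → ℝ} (hn : IntField n) {M : ℝ}
    (hM : ∀ f : ℂ → ℂ, ContDiff ℝ 1 f → ∀ B : ℝ, 0 ≤ B → (∀ z, ‖f z‖ ≤ B) →
      ‖∫ z, (n z : ℂ) * (I * dbar f z)‖ ≤ M * B) :
    4 * Real.pi * ∫ z, n z ^ 2 ≤ M ^ 2 := by
  obtain ⟨C, hC⟩ := hn.bounded
  have hM0 : 0 ≤ M := by
    have := hM (fun _ => 0) contDiff_const 1 zero_le_one (by simp)
    rw [mul_one] at this
    exact (norm_nonneg _).trans this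
  -- A function that is not integrable has integral `0` by convention, whereas this integral is
  -- `4π`.
  have hint_prof : Integrable profile := by
    by_contra h
    have := integral_profile
    rw [integral_undef h] at this
    linarith [Real.pi_pos]
  set K : ℝ → ℂ → ℝ := fun c w => ∫ z, n z * (c ^ 2 * profile (c • (z - w))) with hK
  have hstep : ∀ c : ℝ, 0 < c → Continuous (K c) ∧ ∫ w, n w * K c w ≤ M ^ 2 := by
    intro c hc
    have hδ : 0 < c⁻¹ := inv_pos.2 hc
    set φ : ℂ → ℂ := fun w => ∫ z, (n z : ℂ) * (I * kern₁ c⁻¹ (z - w)) with hφ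
    have hg : ContDiff ℝ 1 fun u => I * kern₁ c⁻¹ u := contDiff_const.mul ((contDiff_kern₁ hδ).of_le (by norm_num))
    obtain ⟨hd, hcont⟩ := hn.hasFDerivAt_integral hg
    have hφ1 : ContDiff ℝ 1 φ := by
      rw [contDiff_one_iff_fderiv]
      refine ⟨fun w => (hd w).differentiableAt, ?_⟩
      exact hcont.congr fun w => (hd w).fderiv.symm
    have hφM : ∀ w, ‖φ w‖ ≤ M := by
      intro w
      -- First use of the hypothesis: the test function is a translate of the kernel, of modulus at
      -- most `1`, and the resulting bound is on the potential `φ`.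
      have h1 := hM (fun z => kern c⁻¹ (z - w))
        (((contDiff_kern hδ).of_le (by norm_num)).comp (contDiff_id.sub contDiff_const)) 1 zero_le_one
        (fun z => norm_kern_le hδ _)
      rw [mul_one] at h1
      have h2 : ∀ z, dbar (fun z => kern c⁻¹ (z - w)) z = kern₁ c⁻¹ (z - w) := fun z => by
        obtain ⟨f', h3, h4⟩ := hasDbarAt_kern hδ (z - w)
        have h5 := h3.comp z ((hasFDerivAt_id z).sub_const w)
        exact HasDbarAt.dbar ⟨f', h5.congr_fderiv (ContinuousLinearMap.comp_id f'), h4⟩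
      simpa only [h2] using h1
    have hdb : ∀ w, I * dbar φ w = (K c w : ℂ) := by
      intro w
      have hi : ∀ v, Integrable fun z => (n z : ℂ) * fderiv ℝ (fun u => I * kern₁ c⁻¹ u) (z - w) v := fun v =>
        hn.integrable_mul (((hg.continuous_fderiv one_ne_zero).clm_apply continuous_const).comp
          (continuous_id.sub continuous_const))
      have hi' : Integrable fun z => (n z) • -(fderiv ℝ (fun u => I * kern₁ c⁻¹ u) (z - w)) := by
        obtain ⟨R, hR⟩ := hn.support
        have hc' : Continuous fun z => -(fderiv ℝ (fun u => I * kern₁ c⁻¹ u) (z - w)) :=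
          ((hg.continuous_fderiv one_ne_zero).comp (continuous_id.sub continuous_const)).neg
        have h1 : IntegrableOn (fun z => (n z) • -(fderiv ℝ (fun u => I * kern₁ c⁻¹ u) (z - w)))
            (Metric.closedBall 0 R) :=
          Integrable.bdd_smul (hc'.continuousOn.integrableOn_compact (isCompact_closedBall 0 R)) C
            hn.measurable.aestronglyMeasurable (ae_of_all _ hC)
        refine (integrableOn_iff_integrable_of_support_subset fun z hz => ?_).1 h1
        by_contra hcz
        refine hz ?_
        change (n z) • -(fderiv ℝ (fun u => I * kern₁ c⁻¹ u) (z - w)) = 0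
        rw [hR z (by simpa using hcz), zero_smul]
      have hap : ∀ v, fderiv ℝ φ w v = -∫ z, (n z : ℂ) * fderiv ℝ (fun u => I * kern₁ c⁻¹ u) (z - w) v := by
        intro v
        rw [show fderiv ℝ φ w = _ from (hd w).fderiv, ContinuousLinearMap.integral_apply hi' v, ← integral_neg]
        refine integral_congr_ae (ae_of_all _ fun z => ?_)
        simp
      have hk2 : ∀ u, fderiv ℝ (fun u => I * kern₁ c⁻¹ u) u 1 + I * fderiv ℝ (fun u => I * kern₁ c⁻¹ u) u I =
          I * ((c ^ 2 * profile (c • u) : ℝ) : ℂ) := by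
        intro u
        have h1 := ((HasDbarAt.const I).mul (hasDbarAt_kern₁ hδ u)).dbar
        rw [kernel_scaling hc] at h1
        rw [dbar] at h1
        rw [h1]; ring
      have h6 : dbar φ w = -(I * K c w) := by
        rw [dbar, hap, hap, mul_neg, ← integral_const_mul, ← neg_add, ← integral_add (hi 1) ((hi I).const_mul I)]
        congr 1
        rw [hK]
        dsimp only
        rw [← integral_complex_ofReal, ← integral_const_mul]
        refine integral_congr_ae (ae_of_all _ fun z => ?_)
        dsimp only
        have := hk2 (z - w)
        push_cast at this ⊢
        linear_combination (n z : ℂ) * this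
      rw [h6]
      linear_combination -(K c w : ℂ) * I_mul_I
    refine ⟨?_, ?_⟩
    · have h1 : Continuous fun w => (I * dbar φ w).re :=
        continuous_re.comp (continuous_const.mul (continuous_dbar hφ1))
      simpa only [hdb, ofReal_re] using h1
    -- Second use: the potential itself is the test function, with bound `M`, and `I * dbar φ` is
    -- the mollification of `n`.
    · have h1 := hM φ hφ1 M hM0 hφM
      simp only [hdb] at h1
      have h2 : ∫ w, (n w : ℂ) * (K c w : ℂ) = ((∫ w, n w * K c w : ℝ) : ℂ) := by
        rw [← integral_complex_ofReal]; simp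
      rw [h2, norm_real, ← sq] at h1
      exact (le_abs_self _).trans h1
  have hshift : ∀ c w, K c w = ∫ x, (c ^ 2 * profile (c • x)) • n (w + x) := by
    intro c w
    rw [hK]
    dsimp only
    rw [← integral_add_left_eq_self _ w]
    refine integral_congr_ae (ae_of_all _ fun x => ?_)
    dsimp only
    rw [add_sub_cancel_left, smul_eq_mul]; ring
  -- The mollifications converge at every continuity point of `n`, hence almost everywhere.
  have hlim : ∀ᵐ w, Tendsto (fun c => K c w) atTop (𝓝 (4 * Real.pi * n w)) := by
    filter_upwards [hn.continuousAt] with w hw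
    have hpi := Real.pi_pos
    have hdec : Tendsto (fun x : ℂ => ‖x‖ ^ Module.finrank ℝ ℂ * (profile x / (4 * Real.pi)))
        (Bornology.cobounded ℂ) (𝓝 0) := by
      rw [finrank_real_complex]
      have h1 : Tendsto (fun x : ℂ => (8 / (4 * Real.pi)) * (‖x‖)⁻¹) (Bornology.cobounded ℂ) (𝓝 ((8 / (4 * Real.pi)) * 0)) :=
        (tendsto_inv_atTop_zero.comp tendsto_norm_cobounded_atTop).const_mul _
      rw [mul_zero] at h1
      refine squeeze_zero' (Eventually.of_forall fun x => by have := profile_pos x; positivity) ?_ h1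
      filter_upwards [tendsto_norm_cobounded_atTop.eventually_ge_atTop 1] with x hx
      rw [profile]
      have hx0 : 0 < ‖x‖ := by linarith
      rw [div_div, ← mul_div_assoc, div_mul_eq_mul_div, mul_comm (‖x‖ ^ 2), ← div_eq_mul_inv, div_div,
        div_le_div_iff₀ (by positivity) (by positivity)]
      have h3 : ‖x‖ ^ 3 ≤ (‖x‖ ^ 2 + 1) ^ 3 := by
        refine pow_le_pow_left₀ hx0.le ?_ 3
        nlinarith
      nlinarith [mul_le_mul_of_nonneg_left h3 hpi.le]
    have h2 := tendsto_integral_comp_smul_smul_of_integrable (μ := (volume : Measure ℂ))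
      (φ := fun x => profile x / (4 * Real.pi)) (fun x => by have := profile_pos x; positivity)
      (by rw [integral_div, integral_profile]; field_simp) hdec (g := fun x => n (w + x))
      (hn.integrable.comp_add_left w) (by
        have : ContinuousAt n (w + 0) := by simpa using hw
        exact ContinuousAt.comp (f := fun x => w + x) this (by fun_prop))
    have h3 := h2.const_mul (4 * Real.pi)
    rw [add_zero] at h3
    refine h3.congr fun c => ?_
    rw [hshift, ← integral_const_mul, finrank_real_complex]
    refine integral_congr_ae (ae_of_all _ fun x => ?_)
    simp only [smul_eq_mul]
    field_simp
  have hKb : ∀ c : ℝ, 0 < c → ∀ w, |K c w| ≤ 4 * Real.pi * C := by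
    intro c hc w
    rw [hshift]
    have hic : Integrable fun x : ℂ => c ^ 2 * profile (c • x) * C :=
      ((hint_prof.comp_smul hc.ne').const_mul _).mul_const _
    refine (norm_integral_le_of_norm_le (f := fun x => (c ^ 2 * profile (c • x)) • n (w + x)) hic (ae_of_all _ fun x => ?_)).trans (le_of_eq ?_)
    · rw [norm_smul, Real.norm_of_nonneg (by have := profile_pos (c • x); positivity)]
      exact mul_le_mul_of_nonneg_left (hC _) (by have := profile_pos (c • x); positivity)
    · rw [integral_mul_const, integral_const_mul, Measure.integral_comp_smul, integral_profile,
        finrank_real_complex, abs_of_pos (by positivity), smul_eq_mul]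
      field_simp
  have hfin : Tendsto (fun c => ∫ w, n w * K c w) atTop (𝓝 (∫ w, n w * (4 * Real.pi * n w))) := by
    refine tendsto_integral_filter_of_dominated_convergence (fun w => |n w| * (4 * Real.pi * C)) ?_ ?_
      (hn.integrable.abs.mul_const _) ?_
    · filter_upwards [eventually_gt_atTop 0] with c hc
      exact hn.measurable.aestronglyMeasurable.mul (hstep c hc).1.aestronglyMeasurable
    · filter_upwards [eventually_gt_atTop 0] with c hc
      refine ae_of_all _ fun w => ?_
      rw [norm_mul]
      exact mul_le_mul_of_nonneg_left (hKb c hc w) (abs_nonneg _)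
    · filter_upwards [hlim] with w hw using hw.const_mul _
  have := le_of_tendsto hfin (by
    filter_upwards [eventually_gt_atTop 0] with c hc using (hstep c hc).2)
  refine le_trans (le_of_eq ?_) this
  rw [← integral_const_mul]
  refine integral_congr_ae (ae_of_all _ fun w => ?_)
  dsimp only
  ring

end

/-! ### Replacing boundary arcs -/

noncomputable section
open Complex

/-- `γ` runs along the regular boundary of `E`, with `E` on its left, for the parameters in
`(0, ℓ)` outside the finite set `F`. -/
structure BoundaryArc (E : Set ℂ) (γ : ℝ → ℂ) (T : ℂ) (κ ℓ : ℝ) (F : Set ℝ) : Prop where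
  arc : UnitArc γ T κ
  nonneg : 0 ≤ ℓ
  curv_le : |κ| * ℓ ≤ 2 * Real.pi
  finite : F.Finite
  regular : ∀ t ∈ Ioo 0 ℓ \ F, RegularWith E (γ t) (T * exp (((κ * t : ℝ) : ℂ) * I))

namespace BoundaryArc

variable {E : Set ℂ} {γ : ℝ → ℂ} {T : ℂ} {κ ℓ : ℝ} {F : Set ℝ}

lemma injOn (h : BoundaryArc E γ T κ ℓ F) : InjOn γ (Ioo 0 ℓ \ F) := by
  intro s hs t ht hst
  refine (h.arc.eq_of_eq ?_ hst.symm).symm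
  have h1 : |t - s| < ℓ := by
    rw [abs_lt]
    exact ⟨by linarith [hs.1.2, ht.1.1], by linarith [hs.1.1, ht.1.2]⟩
  rcases eq_or_ne κ 0 with rfl | hκ
  · simp [Real.pi_pos]
  · exact (mul_lt_mul_of_pos_left h1 (abs_pos.2 hκ)).trans_le h.curv_le

lemma measurableSet (h : BoundaryArc E γ T κ ℓ F) : MeasurableSet (Ioo 0 ℓ \ F) :=
  measurableSet_Ioo.diff h.finite.measurableSet

lemma ae_eq (h : BoundaryArc E γ T κ ℓ F) : (Ioo 0 ℓ \ F : Set ℝ) =ᵐ[volume] Ioc 0 ℓ :=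
  (sdiff_null_ae_eq_self (h.finite.measure_zero volume)).trans Ioo_ae_eq_Ioc

lemma image_subset (h : BoundaryArc E γ T κ ℓ F) : γ '' (Ioo 0 ℓ \ F) ⊆ regBoundary E := by
  rintro _ ⟨t, ht, rfl⟩
  exact (h.regular t ht).mem

lemma measurableSet_image (h : BoundaryArc E γ T κ ℓ F) : MeasurableSet (γ '' (Ioo 0 ℓ \ F)) :=
  h.arc.measurableSet_image h.measurableSet h.injOn

lemma hausdorffMeasure_image (h : BoundaryArc E γ T κ ℓ F) :
    μH[1] (γ '' (Ioo 0 ℓ \ F)) = ENNReal.ofReal ℓ := by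
  rw [h.arc.hausdorffMeasure_image h.measurableSet h.injOn, measure_congr h.ae_eq]
  simp

lemma setIntegral_image (h : BoundaryArc E γ T κ ℓ F) {f : ℂ → ℂ} (hf : Continuous f) :
    ∫ z in γ '' (Ioo 0 ℓ \ F), f z * tangent E z ∂μH[1] =
      ∫ t in (0 : ℝ)..ℓ, f (γ t) * (T * exp (((κ * t : ℝ) : ℂ) * I)) := by
  rw [h.arc.setIntegral_image h.measurableSet h.injOn
    (aestronglyMeasurable_tangent hf h.measurableSet_image h.image_subset _),
    intervalIntegral.integral_of_le h.nonneg, ← setIntegral_congr_set h.ae_eq]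
  refine setIntegral_congr_fun h.measurableSet fun t ht => ?_
  rw [(h.regular t ht).tangent_eq]

end BoundaryArc

/-- Replacing an arc by another one with the same endpoints. -/
lemma UnitArc.exists_replacement_field {γ γ' : ℝ → ℂ} {T T' : ℂ} {κ κ' ℓ ℓ' : ℝ} (h : UnitArc γ T κ)
    (h' : UnitArc γ' T' κ') (hℓ : 0 ≤ ℓ) (hℓ' : 0 ≤ ℓ') (hκ : |κ| * ℓ ≤ 2 * Real.pi)
    (hκ' : |κ'| * ℓ' ≤ 2 * Real.pi) (h0 : γ' 0 = γ 0) (h1 : γ' ℓ' = γ ℓ) :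
    ∃ n : ℂ → ℝ, IntField n ∧ (∫ z, n z = segArea κ' ℓ' - segArea κ ℓ) ∧
      ∀ f : ℂ → ℂ, ContDiff ℝ 1 f → ∫ z, (n z : ℂ) * (I * dbar f z) =
        (∫ t in (0:ℝ)..ℓ', f (γ' t) * (T' * exp (((κ' * t : ℝ) : ℂ) * I))) -
        ∫ t in (0:ℝ)..ℓ, f (γ t) * (T * exp (((κ * t : ℝ) : ℂ) * I)) := by
  obtain ⟨n, hn, hn1, hn2⟩ := exists_segment_field h hℓ hκ
  obtain ⟨n', hn', hn1', hn2'⟩ := exists_segment_field h' hℓ' hκ'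
  refine ⟨fun z => n' z + -n z, hn'.add hn.neg, ?_, fun f hf => ?_⟩
  · simp only [← sub_eq_add_neg]
    rw [integral_sub hn'.integrable hn.integrable, hn1, hn1']
  · have hc : Continuous fun z => I * dbar f z := continuous_const.mul (continuous_dbar hf)
    have h2 := hn2 f hf
    have h3 := hn2' f hf
    rw [h0, h1] at h3
    have h4 : ∀ z, ((n' z + -n z : ℝ) : ℂ) * (I * dbar f z) =
        (n' z : ℂ) * (I * dbar f z) - (n z : ℂ) * (I * dbar f z) := fun z => by push_cast; ring
    simp only [h4]
    rw [integral_sub (hn'.integrable_mul hc) (hn.integrable_mul hc), h2, h3]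
    ring

lemma UnitArc.norm_integral_le {γ : ℝ → ℂ} {T : ℂ} {κ ℓ B : ℝ} (h : UnitArc γ T κ) (hℓ : 0 ≤ ℓ)
    {f : ℂ → ℂ} (hB : ∀ z, ‖f z‖ ≤ B) :
    ‖∫ t in (0:ℝ)..ℓ, f (γ t) * (T * exp (((κ * t : ℝ) : ℂ) * I))‖ ≤ ℓ * B := by
  have := intervalIntegral.norm_integral_le_of_norm_le_const (a := 0) (b := ℓ) (C := B)
    (f := fun t => f (γ t) * (T * exp (((κ * t : ℝ) : ℂ) * I))) fun t _ => by
      rw [norm_mul, norm_deriv T h.norm_one, mul_one]; exact hB _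
  rwa [sub_zero, abs_of_nonneg hℓ, mul_comm] at this

/-- The isoperimetric inequality after replacing some boundary arcs. -/
theorem isoperimetric_of_replacement {E : Set ℂ} (hE : IsOpen E) (hb : Bornology.IsBounded E)
    (hA : HasPiecewiseConstCurvBoundary E) {ι : Type*} [Fintype ι] {γ γ' : ι → ℝ → ℂ} {T T' : ι → ℂ}
    {κ κ' ℓ ℓ' : ι → ℝ} {F : ι → Set ℝ} (h : ∀ i, BoundaryArc E (γ i) (T i) (κ i) (ℓ i) (F i))
    (hd : Pairwise fun i j => Disjoint (γ i '' (Ioo 0 (ℓ i) \ F i)) (γ j '' (Ioo 0 (ℓ j) \ F j)))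
    (h' : ∀ i, UnitArc (γ' i) (T' i) (κ' i)) (hℓ' : ∀ i, 0 ≤ ℓ' i)
    (hκ' : ∀ i, |κ' i| * ℓ' i ≤ 2 * Real.pi) (h0 : ∀ i, γ' i 0 = γ i 0)
    (h1 : ∀ i, γ' i (ℓ' i) = γ i (ℓ i)) :
    0 ≤ (μH[1] (regBoundary E)).toReal + ∑ i, (ℓ' i - ℓ i) ∧
    4 * Real.pi * ((volume E).toReal + ∑ i, (segArea (κ' i) (ℓ' i) - segArea (κ i) (ℓ i))) ≤
      ((μH[1] (regBoundary E)).toReal + ∑ i, (ℓ' i - ℓ i)) ^ 2 := by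
  set R := regBoundary E
  set A : ι → Set ℂ := fun i => γ i '' (Ioo 0 (ℓ i) \ F i) with hAdef
  have hfin : μH[1] R < ⊤ :=
    (measure_mono regBoundary_subset_frontier).trans_lt (hausdorffMeasure_frontier_lt_top hA)
  have hAm : ∀ i, MeasurableSet (A i) := fun i => (h i).measurableSet_image
  have hAR : (⋃ i, A i) ⊆ R := iUnion_subset fun i => (h i).image_subset
  have hAU : MeasurableSet (⋃ i, A i) := MeasurableSet.iUnion hAm
  have hmeas : μH[1] (⋃ i, A i) = ENNReal.ofReal (∑ i, ℓ i) := by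
    rw [measure_iUnion hd hAm, tsum_fintype, ENNReal.ofReal_sum_of_nonneg fun i _ => (h i).nonneg]
    exact Finset.sum_congr rfl fun i _ => (h i).hausdorffMeasure_image
  have hdiff : (μH[1] (R \ ⋃ i, A i)).toReal = (μH[1] R).toReal - ∑ i, ℓ i := by
    rw [measure_sdiff hAR hAU.nullMeasurableSet (by rw [hmeas]; exact ENNReal.ofReal_ne_top),
      ENNReal.toReal_sub_of_le (measure_mono hAR) hfin.ne, hmeas,
      ENNReal.toReal_ofReal (Finset.sum_nonneg fun i _ => (h i).nonneg)]
  -- The mass of the new boundary is what remains of the old one plus the new arcs.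
  have hM : (μH[1] R).toReal + ∑ i, (ℓ' i - ℓ i) = (μH[1] (R \ ⋃ i, A i)).toReal + ∑ i, ℓ' i := by
    rw [hdiff, Finset.sum_sub_distrib]; ring
  have hM0 : 0 ≤ (μH[1] R).toReal + ∑ i, (ℓ' i - ℓ i) := by
    rw [hM]
    exact add_nonneg ENNReal.toReal_nonneg (Finset.sum_nonneg fun i _ => hℓ' i)
  refine ⟨hM0, ?_⟩
  choose m hm1 hm2 hm3 using fun i => (h i).arc.exists_replacement_field (h' i) (h i).nonneg (hℓ' i)
    (h i).curv_le (hκ' i) (h0 i) (h1 i)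
  have hEf : IntField (E.indicator fun _ => (1 : ℝ)) :=
    IntField.indicator hE.measurableSet hb (volume_frontier_eq_zero hA)
  have hsum : IntField fun z => ∑ i, m i z := IntField.sum _ fun i _ => hm1 i
  set n : ℂ → ℝ := fun z => E.indicator (fun _ => (1 : ℝ)) z + ∑ i, m i z with hn_def
  have hn : IntField n := hEf.add hsum
  have hint : ∫ z, n z = (volume E).toReal + ∑ i, (segArea (κ' i) (ℓ' i) - segArea (κ i) (ℓ i)) := by
    rw [hn_def, integral_add hEf.integrable hsum.integrable, integral_finsetSum _ fun i _ => (hm1 i).integrable,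
      integral_indicator hE.measurableSet]
    simp [hm2, Measure.real]
  have hiso := hn.isoperimetric (M := (μH[1] R).toReal + ∑ i, (ℓ' i - ℓ i)) fun f hf B hB0 hB => ?_
  · refine le_trans ?_ hiso
    rw [← hint]
    -- An integer is at most its square, so the signed area `∫ n` is at most `∫ n²`.
    refine mul_le_mul_of_nonneg_left (integral_mono hn.integrable ?_ fun z => ?_) (by positivity)
    · obtain ⟨C, hC⟩ := hn.bounded
      refine (hn.integrable.bdd_mul hn.measurable.aestronglyMeasurable (ae_of_all _ hC)).congr ?_
      exact ae_of_all _ fun z => (sq _).symm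
    · obtain ⟨k, hk⟩ := hn.integer z
      dsimp only
      rw [hk]
      exact_mod_cast Int.le_self_sq k
  · have hc : Continuous fun z => I * dbar f z := continuous_const.mul (continuous_dbar hf)
    have h2 : ∫ z, (n z : ℂ) * (I * dbar f z) = (∫ z in E, I * dbar f z) +
        ∑ i, ∫ z, (m i z : ℂ) * (I * dbar f z) := by
      have h3 : ∀ z, (n z : ℂ) * (I * dbar f z) =
          E.indicator (fun z => I * dbar f z) z + ∑ i, (m i z : ℂ) * (I * dbar f z) := by
        intro z
        rw [hn_def]
        push_cast
        rw [add_mul, Finset.sum_mul]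
        congr 1
        by_cases hz : z ∈ E <;> simp [hz]
      simp only [h3]
      rw [integral_add ((integrableOn_of_isBounded hb hc).integrable_indicator hE.measurableSet)
        (integrable_finsetSum _ fun i _ => (hm1 i).integrable_mul hc),
        integral_finsetSum _ fun i _ => (hm1 i).integrable_mul hc, integral_indicator hE.measurableSet]
    have hgi := integrableOn_tangent hb hfin hf.continuous
    have hgg : ∫ z in E, I * dbar f z = (∫ z in R \ ⋃ i, A i, f z * tangent E z ∂μH[1]) +
        ∑ i, ∫ t in (0 : ℝ)..ℓ i, f (γ i t) * (T i * exp (((κ i * t : ℝ) : ℂ) * I)) := by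
      rw [gaussGreen hE hb hA hf, setIntegral_sdiff hAU hgi hAR,
        integral_iUnion_fintype hAm hd fun i => hgi.mono_set ((h i).image_subset)]
      simp only [hAdef, fun i => (h i).setIntegral_image hf.continuous]
      ring
    -- The integrals over the old arcs cancel between the boundary of `E` and the replacement
    -- fields.
    have h5 : ∫ z, (n z : ℂ) * (I * dbar f z) = (∫ z in R \ ⋃ i, A i, f z * tangent E z ∂μH[1]) +
        ∑ i, ∫ t in (0 : ℝ)..ℓ' i, f (γ' i t) * (T' i * exp (((κ' i * t : ℝ) : ℂ) * I)) := by
      rw [h2, hgg, Finset.sum_congr rfl fun i _ => hm3 i f hf, Finset.sum_sub_distrib]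
      ring
    rw [h5, hM, add_mul, Finset.sum_mul]
    refine (norm_add_le _ _).trans (add_le_add ?_ ((norm_sum_le _ _).trans
      (Finset.sum_le_sum fun i _ => (h' i).norm_integral_le (hℓ' i) hB)))
    rw [mul_comm]
    refine norm_setIntegral_le_of_norm_le_const ((measure_mono sdiff_subset).trans_lt hfin) fun z _ => ?_
    rw [norm_mul]
    exact (mul_le_mul (hB z) (norm_tangent_le E z) (norm_nonneg _) hB0).trans_eq (mul_one B)

end

/-! ### Arcs shared by two chambers -/

noncomputable section
open Complex

/-- Each of the disjoint open sets has positive measure in every ball around a common limit point,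
so the first one is neither null nor conull there. -/
lemma not_nullType_of_mem_closure {A B : Set ℂ} (hA : IsOpen A) (hB : IsOpen B) (hd : Disjoint A B)
    {p : ℂ} (hpA : p ∈ closure A) (hpB : p ∈ closure B) : ¬ NullType A p := by
  rintro ⟨ρ, hρ, h | h⟩
  · have hne : (Metric.ball p ρ ∩ A).Nonempty :=
      mem_closure_iff.1 hpA _ Metric.isOpen_ball (Metric.mem_ball_self hρ)
    exact (Metric.isOpen_ball.inter hA).measure_ne_zero volume hne h
  · have hne : (Metric.ball p ρ ∩ B).Nonempty :=
      mem_closure_iff.1 hpB _ Metric.isOpen_ball (Metric.mem_ball_self hρ)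
    refine (Metric.isOpen_ball.inter hB).measure_ne_zero volume hne (measure_mono_null ?_ h)
    exact fun z hz => ⟨hz.1, fun hzA => disjoint_left.1 hd hzA hz.2⟩

lemma RegularWith.not_disjoint {A B : Set ℂ} {p T : ℂ} (hA : RegularWith A p T)
    (hB : RegularWith B p T) : ¬ Disjoint A B := by
  obtain ⟨δ, hδ, h1⟩ := hA.exists_balls
  obtain ⟨δ', hδ', h2⟩ := hB.exists_balls
  have hs : 0 < min δ δ' / 2 := by positivity
  have hs1 : min δ δ' / 2 < δ := by have := min_le_left δ δ'; linarith
  have hs2 : min δ δ' / 2 < δ' := by have := min_le_right δ δ'; linarith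
  have hm := Metric.mem_ball_self (x := p + (min δ δ' / 2 : ℝ) * (I * T)) (half_pos hs)
  exact fun hd => disjoint_left.1 hd ((h1 _ hs hs1).1 hm).2 ((h2 _ hs hs2).1 hm).2

/-- A regular boundary point at which an arc inside the frontier passes, with a normal ray in the
set. -/
lemma regularWith_of_ray {A : Set ℂ} {γ : ℝ → ℂ} {t : ℝ} {v σ : ℂ} (hreg : γ t ∈ regBoundary A)
    (hγ : HasDerivAt γ v t) (hfr : ∀ᶠ s in 𝓝 t, γ s ∈ frontier A) (hσ : ‖σ‖ = 1)
    (hv : v = σ ∨ v = -σ) (hray : ∀ᶠ h : ℝ in 𝓝[>] 0, γ t + h * (I * σ) ∈ A) :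
    RegularWith A (γ t) σ := by
  obtain ⟨T, hT⟩ := hreg
  obtain ⟨hT1, k, ρ, hρ, hE⟩ := id hT
  -- The arc stays on the boundary circle of `A`, so differentiating shows that its velocity is
  -- parallel to the tangent `T` of `A`, that is, `σ = ± T`. The ray into `A` then selects the sign.
  have hlev : ∀ᶠ s in 𝓝 t, lev (γ t) T k (γ s) = 0 := by
    filter_upwards [hfr, hγ.continuousAt.eventually (Metric.ball_mem_nhds (γ t) hρ)] with s hs hs'
    exact lev_eq_zero_of_mem_frontier hE hs' hs
  have hd : HasDerivAt (fun s => lev (γ t) T k (γ s)) (2 * (v * (starRingEnd ℂ) T).im) t := by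
    have h1 : HasDerivAt (fun s => γ s - γ t) v t := hγ.sub_const _
    have h2 : HasDerivAt (fun s => ((γ s - γ t) * (starRingEnd ℂ) T).im) (v * (starRingEnd ℂ) T).im t :=
      imCLM.hasFDerivAt.comp_hasDerivAt t (h1.mul_const _)
    have h3 : HasDerivAt (fun s => (γ s - γ t).re) v.re t := reCLM.hasFDerivAt.comp_hasDerivAt t h1
    have h4 : HasDerivAt (fun s => (γ s - γ t).im) v.im t := imCLM.hasFDerivAt.comp_hasDerivAt t h1
    have h5 := (h2.const_mul 2).sub (((h3.mul h3).add (h4.mul h4)).const_mul k)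
    refine h5.congr_deriv ?_
    simp
  have hz : (v * (starRingEnd ℂ) T).im = 0 := by
    have := hd.unique ((hasDerivAt_const t (0 : ℝ)).congr_of_eventuallyEq hlev)
    linarith
  have hz' : (σ * (starRingEnd ℂ) T).im = 0 := by
    rcases hv with rfl | rfl
    · exact hz
    · rwa [neg_mul, neg_im, neg_eq_zero] at hz
  have hre : ‖σ * (starRingEnd ℂ) T‖ = 1 := by rw [norm_mul, RCLike.norm_conj, hσ, hT1, mul_one]
  have hTT : T * (starRingEnd ℂ) T = 1 := by rw [mul_conj, normSq_eq_norm_sq, hT1]; simp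
  have hreal : σ * (starRingEnd ℂ) T = ((σ * (starRingEnd ℂ) T).re : ℂ) := by
    apply Complex.ext <;> simp [hz']
  have hσT : σ = ((σ * (starRingEnd ℂ) T).re : ℂ) * T := by
    rw [← hreal]; linear_combination -σ * hTT
  have habs : |(σ * (starRingEnd ℂ) T).re| = 1 := by
    rw [hreal, norm_real] at hre; exact hre
  rcases (abs_eq zero_le_one).1 habs with h1 | h1
  · rw [h1] at hσT
    rw [hσT]; simpa using hT
  · exfalso
    have hneg : ((I * σ) * (starRingEnd ℂ) T).im < 0 := by
      rw [mul_assoc, I_mul_im, h1]; norm_num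
    have h2 := eventually_lev_neg (γ t) k hneg
    have h3 := eventually_ray_mem (γ t) (I * σ) hρ
    obtain ⟨h, h4, h5, h6⟩ := (hray.and (h2.and h3)).exists
    have := (hE _ h6).1 h4
    linarith

/-- An arc which runs along the regular boundaries of `A`, on its left, and of `B`, on its right,
up to finitely many parameters. -/
structure SharedArc (A B : Set ℂ) (γ : ℝ → ℂ) (T : ℂ) (κ ℓ : ℝ) (F : Set ℝ) : Prop where
  left : BoundaryArc A γ T κ ℓ F
  right : ∀ t ∈ Ioo 0 ℓ \ F, RegularWith B (γ t) (-(T * exp (((κ * t : ℝ) : ℂ) * I)))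

namespace SharedArc

variable {A B : Set ℂ} {γ : ℝ → ℂ} {T : ℂ} {κ ℓ : ℝ} {F : Set ℝ}

lemma reverse (h : SharedArc A B γ T κ ℓ F) :
    SharedArc B A (fun t => γ (ℓ - t)) (-(T * exp (((κ * ℓ : ℝ) : ℂ) * I))) (-κ) ℓ
      ((fun t => ℓ - t) '' F) := by
  have key : ∀ t, -(T * exp (((κ * ℓ : ℝ) : ℂ) * I)) * exp (((-κ * t : ℝ) : ℂ) * I) =
      -(T * exp (((κ * (ℓ - t) : ℝ) : ℂ) * I)) := fun t => by
    rw [neg_mul, mul_assoc, ← exp_add]; push_cast; ring_nf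
  have hmem : ∀ t ∈ Ioo 0 ℓ \ (fun t => ℓ - t) '' F, ℓ - t ∈ Ioo 0 ℓ \ F := fun t ht =>
    ⟨⟨by linarith [ht.1.2], by linarith [ht.1.1]⟩, fun h => ht.2 ⟨ℓ - t, h, by simp⟩⟩
  refine ⟨⟨h.left.arc.reverse ℓ, h.left.nonneg, by rw [abs_neg]; exact h.left.curv_le,
    h.left.finite.image _, fun t ht => ?_⟩, fun t ht => ?_⟩
  · rw [key]
    exact h.right _ (hmem t ht)
  · rw [key, neg_neg]
    exact h.left.regular _ (hmem t ht)

/-- Degenerate arcs fill the places of an indexed family where there is nothing to replace. -/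
lemma trivial (hA : UnitArc γ T κ) : SharedArc A B γ T κ 0 ∅ :=
  ⟨⟨hA, le_rfl, by simp [Real.pi_pos.le], finite_empty, by simp⟩, by simp⟩

/-- Arcs shared with disjoint sets are disjoint. -/
lemma disjoint_image {B' : Set ℂ} {γ' : ℝ → ℂ} {T' : ℂ} {κ' ℓ' : ℝ} {F' : Set ℝ}
    (h : SharedArc A B γ T κ ℓ F) (h' : SharedArc A B' γ' T' κ' ℓ' F') (hd : Disjoint B B') :
    Disjoint (γ '' (Ioo 0 ℓ \ F)) (γ' '' (Ioo 0 ℓ' \ F')) := by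
  rw [disjoint_left]
  rintro _ ⟨t, ht, rfl⟩ ⟨t', ht', he⟩
  have h1 := h.left.regular t ht
  have h2 := h'.left.regular t' ht'
  have h3 := h.right t ht
  have h4 := h'.right t' ht'
  rw [he] at h2 h4
  rw [h2.unique h1] at h4
  exact h3.not_disjoint h4 hd

end SharedArc

/-- A shared arc of the boundaries, and all its initial sub-arcs, in the sense of `SharedArc`. -/
lemma exists_sharedArc {A B : Set ℂ} (hA : IsOpen A) (hB : IsOpen B) (hd : Disjoint A B)
    (hcA : HasPiecewiseConstCurvBoundary A) (hcB : HasPiecewiseConstCurvBoundary B) {γ : ℝ → ℂ}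
    {κ L : ℝ} (hγ : IsCurvatureArc γ κ L) (hfr : γ '' Icc 0 L ⊆ frontier A ∩ frontier B)
    (hrun : RunsBetween γ L A B) :
    ∃ (T : ℂ) (F : Set ℝ), ∀ m, 0 ≤ m → m ≤ L → SharedArc A B γ T κ m F := by
  obtain ⟨T, hT⟩ := hγ.exists_unitArc
  obtain ⟨S, hS, hrun⟩ := hrun
  obtain ⟨bA, hbA, hrA⟩ := exists_finite_bad hA hcA
  obtain ⟨bB, hbB, hrB⟩ := exists_finite_bad hB hcB
  have hcurv := hT.curv_mul_le hγ.length_pos hγ.injOn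
  -- Injectivity of the arc on `[0, L)` pulls the finitely many bad points back to finitely many
  -- parameters.
  have hbad : ({t | t ∈ Ico 0 L ∧ γ t ∈ bA ∪ bB}).Finite := by
    refine Finite.of_finite_image (f := γ) ((hbA.union hbB).subset ?_)
      (hγ.injOn.mono fun t ht => ht.1)
    rintro _ ⟨t, ht, rfl⟩
    exact ht.2
  have hreg : ∀ t ∈ Ioo 0 L \ (S ∪ {t | t ∈ Ico 0 L ∧ γ t ∈ bA ∪ bB}),
      RegularWith A (γ t) (T * exp (((κ * t : ℝ) : ℂ) * I)) ∧
      RegularWith B (γ t) (-(T * exp (((κ * t : ℝ) : ℂ) * I))) := by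
    rintro t ⟨ht, htF⟩
    rw [mem_union, not_or] at htF
    have htb : γ t ∉ bA ∧ γ t ∉ bB := by
      rw [← not_or]
      exact fun h => htF.2 ⟨Ioo_subset_Ico_self ht, h⟩
    have hnear : ∀ᶠ s in 𝓝 t, γ s ∈ frontier A ∩ frontier B := by
      filter_upwards [isOpen_Ioo.mem_nhds ht] with s hs
      exact hfr ⟨s, Ioo_subset_Icc_self hs, rfl⟩
    have hcl := hnear.self_of_nhds
    -- A common frontier point of two disjoint open sets cannot be of null type for either, so it is
    -- regular for both.
    have h1 := (hrA _ htb.1).resolve_right (not_nullType_of_mem_closure hA hB hd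
      (frontier_subset_closure hcl.1) (frontier_subset_closure hcl.2))
    have h2 := (hrB _ htb.2).resolve_right (not_nullType_of_mem_closure hB hA hd.symm
      (frontier_subset_closure hcl.2) (frontier_subset_closure hcl.1))
    have hn := UnitArc.norm_deriv T hT.norm_one (κ * t)
    have hray := hrun t ⟨ht, htF.1⟩
    rw [hT.deriv_eq] at hray
    refine ⟨regularWith_of_ray h1 (hT.hasDerivAt t) (hnear.mono fun s hs => hs.1) hn (Or.inl rfl)
      (hray.mono fun h hh => hh.1), regularWith_of_ray h2 (hT.hasDerivAt t)
      (hnear.mono fun s hs => hs.2) (by rwa [norm_neg]) (Or.inr (neg_neg _).symm)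
      (hray.mono fun h hh => ?_)⟩
    have := hh.2
    rwa [sub_eq_add_neg, ← mul_neg, ← mul_neg] at this
  refine ⟨T, _, fun m hm hmL => ⟨⟨hT, hm, ?_, hS.union hbad, fun t ht => (hreg t ?_).1⟩,
    fun t ht => (hreg t ?_).2⟩⟩
  · exact (mul_le_mul_of_nonneg_left hmL (abs_nonneg κ)).trans hcurv
  all_goals exact ⟨⟨ht.1.1, ht.1.2.trans_le hmL⟩, ht.2⟩

/-- The arc of half opening angle `b ‖v‖ / 2` over a given chord. -/
lemma exists_arc_of_chord (p v : ℂ) {b : ℝ} (hb : 0 < b) (hv : b * ‖v‖ / 2 < Real.pi) :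
    ∃ (γ : ℝ → ℂ) (T : ℂ), UnitArc γ T (b * Real.sinc (b * ‖v‖ / 2)) ∧ γ 0 = p ∧
      γ (‖v‖ / Real.sinc (b * ‖v‖ / 2)) = p + v := by
  rcases eq_or_ne v 0 with rfl | hv0
  · obtain ⟨γ, hγ, h0⟩ := UnitArc.exists_arc p (T := 1) (by simp) (b * Real.sinc (b * ‖(0 : ℂ)‖ / 2))
    exact ⟨γ, 1, hγ, h0, by simp [h0]⟩
  have hn : ‖v‖ ≠ 0 := norm_ne_zero_iff.2 hv0
  set y := b * ‖v‖ / 2 with hy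
  have hs : Real.sinc y ≠ 0 := UnitArc.sinc_ne_zero (by rwa [abs_of_nonneg (by positivity)])
  -- The initial tangent is the chord direction turned back by half the opening angle.
  have hT : ‖v / ‖v‖ * exp (((-y : ℝ) : ℂ) * I)‖ = 1 := by
    refine UnitArc.norm_deriv _ ?_ _
    rw [norm_div, norm_real, norm_norm, div_self hn]
  obtain ⟨γ, hγ, h0⟩ := UnitArc.exists_arc p hT (b * Real.sinc y)
  refine ⟨γ, _, hγ, h0, ?_⟩
  have hc := hγ.chord 0 (‖v‖ / Real.sinc y)
  have h1 : b * Real.sinc y * (‖v‖ / Real.sinc y) / 2 = y := by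
    have : Real.sinc y * (‖v‖ / Real.sinc y) = ‖v‖ := by field_simp
    rw [mul_assoc, this, hy]
  rw [sub_zero, add_zero, h1, h0] at hc
  have h2 : (‖v‖ / Real.sinc y * Real.sinc y : ℝ) = ‖v‖ := by field_simp
  rw [h2] at hc
  have h3 : exp (((-y : ℝ) : ℂ) * I) * exp ((y : ℂ) * I) = 1 := by
    rw [← exp_add]; push_cast; simp
  have h4 : (‖v‖ : ℂ) ≠ 0 := by exact_mod_cast hn
  rw [← sub_eq_iff_eq_add', hc, mul_assoc (v / _), h3]
  field_simp

end

/-! ### Taylor estimates and the deficit of an arc -/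

noncomputable section
open Complex

section Trigonometric

lemma nonneg_of_deriv_nonneg {f f' : ℝ → ℝ} (hd : ∀ x, HasDerivAt f (f' x) x) (h0 : f 0 = 0)
    (hf' : ∀ x, 0 ≤ x → 0 ≤ f' x) {x : ℝ} (hx : 0 ≤ x) : 0 ≤ f x := by
  have hm : MonotoneOn f (Ici 0) := by
    refine monotoneOn_of_deriv_nonneg (convex_Ici 0)
      (fun x _ => (hd x).continuousAt.continuousWithinAt)
      (fun x _ => (hd x).differentiableAt.differentiableWithinAt) fun x hx => ?_
    rw [(hd x).deriv]
    rw [interior_Ici] at hx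
    exact hf' x (le_of_lt hx)
  rw [← h0]
  exact hm self_mem_Ici hx hx

lemma cos_le_quartic {x : ℝ} (hx : 0 ≤ x) : Real.cos x ≤ 1 - x ^ 2 / 2 + x ^ 4 / 24 := by
  have h := nonneg_of_deriv_nonneg (f := fun x => 1 - x ^ 2 / 2 + x ^ 4 / 24 - Real.cos x)
    (f' := fun x => Real.sin x - (x - x ^ 3 / 6)) (fun x => ?_) (by simp)
    (fun x hx => by linarith [Real.sin_ge_sub_cube hx]) hx
  · linarith
  · refine ((((hasDerivAt_const x (1 : ℝ)).sub (((hasDerivAt_id x).pow 2).div_const 2)).add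
      (((hasDerivAt_id x).pow 4).div_const 24)).sub (Real.hasDerivAt_cos x)).congr_deriv ?_
    simp; ring

lemma sin_le_quintic {x : ℝ} (hx : 0 ≤ x) : Real.sin x ≤ x - x ^ 3 / 6 + x ^ 5 / 120 := by
  have h := nonneg_of_deriv_nonneg (f := fun x => x - x ^ 3 / 6 + x ^ 5 / 120 - Real.sin x)
    (f' := fun x => 1 - x ^ 2 / 2 + x ^ 4 / 24 - Real.cos x) (fun x => ?_) (by simp)
    (fun x hx => by linarith [cos_le_quartic hx]) hx
  · linarith
  · refine ((((hasDerivAt_id x).sub (((hasDerivAt_id x).pow 3).div_const 6)).add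
      (((hasDerivAt_id x).pow 5).div_const 120)).sub (Real.hasDerivAt_sin x)).congr_deriv ?_
    simp; ring

lemma le_sinc (x : ℝ) : 1 - x ^ 2 / 6 ≤ Real.sinc x := by
  wlog hx : 0 ≤ x generalizing x
  · have := this (-x) (by linarith)
    rwa [Real.sinc_neg, neg_sq] at this
  rcases hx.eq_or_lt with rfl | hx0
  · simp
  rw [Real.sinc_of_ne_zero hx0.ne', le_div_iff₀ hx0]
  linarith [Real.sin_ge_sub_cube hx]

lemma sinc_le_quartic (x : ℝ) : Real.sinc x ≤ 1 - x ^ 2 / 6 + x ^ 4 / 120 := by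
  wlog hx : 0 ≤ x generalizing x
  · have := this (-x) (by linarith)
    rwa [Real.sinc_neg, neg_sq, Even.neg_pow (by decide)] at this
  rcases hx.eq_or_lt with rfl | hx0
  · simp
  rw [Real.sinc_of_ne_zero hx0.ne', div_le_iff₀ hx0]
  linarith [sin_le_quintic hx]

/-- In the quartic bound, `x⁴ / 120 ≤ x² / 12` because `x² ≤ π² ≤ 10`. This weaker but global
estimate serves arcs of large curvature. -/
lemma sinc_le_of_abs_le_pi {x : ℝ} (hx : |x| ≤ Real.pi) : Real.sinc x ≤ 1 - x ^ 2 / 12 := by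
  have h1 := sinc_le_quartic x
  have h2 : x ^ 2 ≤ 10 := by
    rw [← sq_abs]
    nlinarith [abs_nonneg x, Real.pi_lt_d2]
  nlinarith [sq_nonneg x]

lemma sinc_nonneg_of_abs_le_pi {x : ℝ} (hx : |x| ≤ Real.pi) : 0 ≤ Real.sinc x := by
  wlog hx0 : 0 ≤ x generalizing x
  · have := this (x := -x) (by rwa [abs_neg]) (by linarith)
    rwa [Real.sinc_neg] at this
  rcases hx0.eq_or_lt with rfl | hx1
  · simp
  rw [Real.sinc_of_ne_zero hx1.ne']
  exact div_nonneg (Real.sin_nonneg_of_nonneg_of_le_pi hx0 ((le_abs_self x).trans hx)) hx0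

lemma segArea_neg (κ ℓ : ℝ) : segArea (-κ) ℓ = -segArea κ ℓ := by
  simp only [segArea, neg_mul, Real.sin_neg, neg_sq]; ring

lemma segArea_zero_right (κ : ℝ) : segArea κ 0 = 0 := by simp [segArea]

lemma segArea_bounds {κ ℓ : ℝ} (hκ : 0 ≤ κ) (hℓ : 0 ≤ ℓ) :
    0 ≤ segArea κ ℓ ∧ segArea κ ℓ ≤ κ * ℓ ^ 3 / 12 ∧
      κ * ℓ ^ 3 / 12 - κ ^ 3 * ℓ ^ 5 / 240 ≤ segArea κ ℓ := by
  rcases hκ.eq_or_lt with rfl | hκ0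
  · simp [segArea]
  have h0 := Real.sin_le (mul_nonneg hκ hℓ)
  have h1 := Real.sin_ge_sub_cube (mul_nonneg hκ hℓ)
  have h2 := sin_le_quintic (mul_nonneg hκ hℓ)
  have hp : 0 < 2 * κ ^ 2 := by positivity
  refine ⟨div_nonneg (by linarith) hp.le, ?_, ?_⟩
  · rw [segArea, div_le_iff₀ hp]; linarith
  · rw [segArea, le_div_iff₀ hp]; linarith

lemma abs_segArea_le (κ : ℝ) {ℓ : ℝ} (hℓ : 0 ≤ ℓ) : |segArea κ ℓ| ≤ |κ| * ℓ ^ 3 / 12 := by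
  wlog hκ : 0 ≤ κ generalizing κ
  · have := this (-κ) (by linarith)
    rwa [segArea_neg, abs_neg, abs_neg] at this
  obtain ⟨h0, h1, -⟩ := segArea_bounds hκ hℓ
  rwa [abs_of_nonneg h0, abs_of_nonneg hκ]

lemma abs_segArea_sub_le (κ : ℝ) {ℓ : ℝ} (hℓ : 0 ≤ ℓ) :
    |segArea κ ℓ - κ * ℓ ^ 3 / 12| ≤ |κ| ^ 3 * ℓ ^ 5 / 240 := by
  wlog hκ : 0 ≤ κ generalizing κ
  · have := this (-κ) (by linarith)
    rwa [segArea_neg, abs_neg, ← abs_neg, show -(-segArea κ ℓ - -κ * ℓ ^ 3 / 12) =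
      segArea κ ℓ - κ * ℓ ^ 3 / 12 by ring] at this
  obtain ⟨h0, h1, h2⟩ := segArea_bounds hκ hℓ
  rw [abs_of_nonneg hκ, abs_le]
  constructor
  · linarith
  · have : 0 ≤ κ ^ 3 * ℓ ^ 5 / 240 := by positivity
    linarith

end Trigonometric

/-- The lower bound for the perimeter gained by replacing an arc of length `ℓ` and curvature `κ`
in the boundary of a set whose equivalent disk has curvature `b`; `n` is the number of arcs. -/
def deficit (n b κ ℓ : ℝ) : ℝ :=
  let d := ℓ * Real.sinc (κ * ℓ / 2)
  let ℓ' := d / Real.sinc (b * d / 2)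
  let a := segArea (b * Real.sinc (b * d / 2)) ℓ' - segArea κ ℓ
  ℓ - ℓ' + b * a - n * b ^ 3 * a ^ 2

/-- The new arc, up to order five in its chord. -/
lemma new_arc_bounds {b d : ℝ} (hb : 0 < b) (hd : 0 ≤ d) (hbd : b * d ≤ 1) :
    d / Real.sinc (b * d / 2) ≤ d + b ^ 2 * d ^ 3 / 24 + b ^ 4 * d ^ 5 / 288 ∧
    b * d ^ 3 / 12 - b ^ 3 * d ^ 5 / 240 ≤
      segArea (b * Real.sinc (b * d / 2)) (d / Real.sinc (b * d / 2)) ∧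
    segArea (b * Real.sinc (b * d / 2)) (d / Real.sinc (b * d / 2)) ≤ b * d ^ 3 / 6 := by
  set y := b * d / 2 with hy
  have hy0 : 0 ≤ y := by positivity
  have hy1 : y ≤ 1 / 2 := by linarith
  have hs := le_sinc y
  have hs1 := Real.sinc_le_one y
  set s := Real.sinc y
  have hs2 : 23 / 24 ≤ s := by nlinarith
  have hs0 : 0 < s := by linarith
  have harea : segArea (b * s) (d / s) = (2 * y - Real.sin (2 * y)) / (2 * (b * s) ^ 2) := by
    have : b * s * (d / s) = 2 * y := by rw [hy]; field_simp
    rw [segArea, this]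
  have h0 := Real.sin_le (x := 2 * y) (by linarith)
  have h1 := Real.sin_ge_sub_cube (x := 2 * y) (by linarith)
  have h2 := sin_le_quintic (x := 2 * y) (by linarith)
  refine ⟨?_, ?_, ?_⟩
  · rw [div_le_iff₀ hs0]
    -- This is `1 / sinc y ≤ 1 + y²/6 + y⁴/18`; with `y = b d / 2` the coefficients become `1/24`
    -- and `1/288`.
    have h3 : 1 ≤ (1 + y ^ 2 / 6 + y ^ 4 / 18) * s := by
      have hw : 0 ≤ y ^ 2 := sq_nonneg y
      have hw1 : y ^ 2 ≤ 1 / 4 := by nlinarith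
      have h4 : (1 + y ^ 2 / 6 + y ^ 4 / 18) * (1 - y ^ 2 / 6) ≤ (1 + y ^ 2 / 6 + y ^ 4 / 18) * s :=
        mul_le_mul_of_nonneg_left hs (by positivity)
      nlinarith [mul_nonneg hw hw, mul_nonneg (mul_nonneg hw hw) (sub_nonneg.2 hw1)]
    calc d = d * 1 := (mul_one d).symm
      _ ≤ d * ((1 + y ^ 2 / 6 + y ^ 4 / 18) * s) := mul_le_mul_of_nonneg_left h3 hd
      _ = _ := by rw [hy]; ring
  · have hlow : (2 * y - Real.sin (2 * y)) / (2 * b ^ 2) ≤ segArea (b * s) (d / s) := by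
      rw [harea]
      refine div_le_div_of_nonneg_left (by linarith) (by positivity) ?_
      rw [mul_pow]
      have : s ^ 2 ≤ 1 := by nlinarith
      nlinarith [sq_nonneg b]
    refine le_trans ?_ hlow
    rw [le_div_iff₀ (by positivity)]
    have h3 : (b * d ^ 3 / 12 - b ^ 3 * d ^ 5 / 240) * (2 * b ^ 2) =
        (2 * y) ^ 3 / 6 - (2 * y) ^ 5 / 120 := by rw [hy]; ring
    linarith
  · rw [harea, div_le_iff₀ (by positivity)]
    have h3 : b * d ^ 3 / 6 * (2 * (b * s) ^ 2) = (2 * y) ^ 3 / 3 * s ^ 2 := by rw [hy]; ring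
    rw [h3]
    have h4 : 1 / 2 ≤ s ^ 2 := by nlinarith
    have h5 : 0 ≤ (2 * y) ^ 3 := by positivity
    nlinarith

/-- In the chord `d`, the new arc contributes `-b² d³ / 24` through its length and `b² d³ / 12`
through its area, up to order `b⁴ d⁵`. The contribution of the old arc is left exact, as no bound on
`κ` by `b` is available; only its squared area is estimated. -/
lemma le_deficit {n b κ ℓ : ℝ} (hn : 0 ≤ n) (hb : 0 < b) (hℓ : 0 ≤ ℓ) (hbℓ : b * ℓ ≤ 1)
    (hκ : |κ| * ℓ ≤ 2 * Real.pi) :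
    ℓ - ℓ * Real.sinc (κ * ℓ / 2) + b ^ 2 * (ℓ * Real.sinc (κ * ℓ / 2)) ^ 3 / 24 - b * segArea κ ℓ
      - (1 + n) * b ^ 4 * ℓ ^ 5 - n * b ^ 3 * (κ ^ 2 * ℓ ^ 6) ≤ deficit n b κ ℓ := by
  have hx : |κ * ℓ / 2| ≤ Real.pi := by
    rw [abs_div, abs_mul, abs_of_nonneg hℓ, abs_two]; linarith
  have hs0 := sinc_nonneg_of_abs_le_pi hx
  have hs1 := Real.sinc_le_one (κ * ℓ / 2)
  rw [deficit]
  set d := ℓ * Real.sinc (κ * ℓ / 2) with hd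
  have hd0 : 0 ≤ d := mul_nonneg hℓ hs0
  have hdℓ : d ≤ ℓ := mul_le_of_le_one_right hℓ hs1
  have hbd : b * d ≤ 1 := (mul_le_mul_of_nonneg_left hdℓ hb.le).trans hbℓ
  obtain ⟨h1, h2, h3⟩ := new_arc_bounds hb hd0 hbd
  set A' := segArea (b * Real.sinc (b * d / 2)) (d / Real.sinc (b * d / 2))
  set A := segArea κ ℓ
  have hA := abs_segArea_le κ hℓ
  have hA2 : A ^ 2 ≤ κ ^ 2 * ℓ ^ 6 / 144 := by
    rw [← sq_abs]
    refine (pow_le_pow_left₀ (abs_nonneg _) hA 2).trans_eq ?_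
    rw [← sq_abs κ]; ring
  have hd5 : d ^ 5 ≤ ℓ ^ 5 := pow_le_pow_left₀ hd0 hdℓ 5
  have hd3 : d ^ 3 ≤ ℓ ^ 3 := pow_le_pow_left₀ hd0 hdℓ 3
  have hA'0 : 0 ≤ A' := by
    refine le_trans ?_ h2
    have : b * d ^ 3 / 12 - b ^ 3 * d ^ 5 / 240 = b * d ^ 3 * (20 - (b * d) ^ 2) / 240 := by ring
    rw [this]
    have : (b * d) ^ 2 ≤ 1 := pow_le_one₀ (by positivity) hbd
    have : 0 ≤ 20 - (b * d) ^ 2 := by linarith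
    positivity
  have hA'2 : A' ^ 2 ≤ b ^ 2 * ℓ ^ 6 / 36 := by
    refine (pow_le_pow_left₀ hA'0 (h3.trans (show b * d ^ 3 / 6 ≤ b * ℓ ^ 3 / 6 by gcongr)) 2).trans_eq ?_
    ring
  have hsq : (A' - A) ^ 2 ≤ b ^ 2 * ℓ ^ 6 + κ ^ 2 * ℓ ^ 6 := by
    have h4 : 0 ≤ b ^ 2 * ℓ ^ 6 := by positivity
    have h5 : 0 ≤ κ ^ 2 * ℓ ^ 6 := by positivity
    nlinarith [sq_nonneg (A' + A)]
  have h6 : n * b ^ 3 * (A' - A) ^ 2 ≤ n * b ^ 4 * ℓ ^ 5 + n * b ^ 3 * (κ ^ 2 * ℓ ^ 6) := by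
    have h7 : n * b ^ 3 * (b ^ 2 * ℓ ^ 6) ≤ n * b ^ 4 * ℓ ^ 5 := by
      have : n * b ^ 3 * (b ^ 2 * ℓ ^ 6) = n * b ^ 4 * ℓ ^ 5 * (b * ℓ) := by ring
      rw [this]
      exact mul_le_of_le_one_right (by positivity) hbℓ
    calc n * b ^ 3 * (A' - A) ^ 2 ≤ n * b ^ 3 * (b ^ 2 * ℓ ^ 6 + κ ^ 2 * ℓ ^ 6) :=
          mul_le_mul_of_nonneg_left hsq (by positivity)
      _ ≤ _ := by rw [mul_add]; linarith
  have h8 : b * (b * d ^ 3 / 12 - b ^ 3 * d ^ 5 / 240) ≤ b * A' := mul_le_mul_of_nonneg_left h2 hb.le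
  have h9 : b ^ 4 * d ^ 5 ≤ b ^ 4 * ℓ ^ 5 := by gcongr
  have h10 : 0 ≤ b ^ 4 * d ^ 5 := by positivity
  nlinarith

lemma deficit_zero (n b κ : ℝ) : deficit n b κ 0 = 0 := by
  simp [deficit, segArea_zero_right]

/-- The deficits of the two sides of a shared arc, for opposite curvatures. -/
lemma le_deficit_add_deficit {n b c β κ ℓ : ℝ} (hn : 0 ≤ n) (hb : 0 < b) (hc : 0 < c) (hbβ : b ≤ β)
    (hcβ : c ≤ β) (hℓ : 0 ≤ ℓ) (hβℓ : 8 * (n + 1) * β * ℓ ≤ 1) (hκ : |κ| * ℓ ≤ 2 * Real.pi) :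
    ℓ ^ 3 * (b + c) ^ 2 / 48 - (10 + 40 * n) * β ^ 4 * ℓ ^ 5 ≤
      deficit n b κ ℓ + deficit n c (-κ) ℓ := by
  have hβ : 0 < β := hb.trans_le hbβ
  have hβℓ0 : 0 ≤ β * ℓ := by positivity
  have hβ1 : β * ℓ ≤ 1 / 8 := by linarith [mul_nonneg hn hβℓ0]
  have h1 := le_deficit (κ := κ) hn hb hℓ ((mul_le_mul_of_nonneg_right hbβ hℓ).trans (by linarith)) hκ
  have h2 := le_deficit (κ := -κ) hn hc hℓ ((mul_le_mul_of_nonneg_right hcβ hℓ).trans (by linarith)) (by rwa [abs_neg])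
  rw [segArea_neg, neg_mul, neg_div, Real.sinc_neg, neg_sq] at h2
  have hx : |κ * ℓ / 2| ≤ Real.pi := by
    rw [abs_div, abs_mul, abs_of_nonneg hℓ, abs_two]; linarith
  have hs0 := sinc_nonneg_of_abs_le_pi hx
  have hs1 := Real.sinc_le_one (κ * ℓ / 2)
  have hs2 := le_sinc (κ * ℓ / 2)
  have hs3 := sinc_le_quartic (κ * ℓ / 2)
  have hs4 := sinc_le_of_abs_le_pi hx
  have hA := abs_segArea_le κ hℓ
  have hA' := abs_segArea_sub_le κ hℓ
  set s := Real.sinc (κ * ℓ / 2)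
  set A := segArea κ ℓ
  have hb4 : b ^ 4 ≤ β ^ 4 := pow_le_pow_left₀ hb.le hbβ 4
  have hc4 : c ^ 4 ≤ β ^ 4 := pow_le_pow_left₀ hc.le hcβ 4
  have hb3 : b ^ 3 ≤ β ^ 3 := pow_le_pow_left₀ hb.le hbβ 3
  have hc3 : c ^ 3 ≤ β ^ 3 := pow_le_pow_left₀ hc.le hcβ 3
  have hb2 : b ^ 2 ≤ β ^ 2 := pow_le_pow_left₀ hb.le hbβ 2
  have hc2 : c ^ 2 ≤ β ^ 2 := pow_le_pow_left₀ hc.le hcβ 2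
  have hbc : |b - c| ≤ β := by rw [abs_le]; constructor <;> linarith
  have e1 : (1 + n) * b ^ 4 * ℓ ^ 5 ≤ (1 + n) * β ^ 4 * ℓ ^ 5 := by gcongr
  have e2 : (1 + n) * c ^ 4 * ℓ ^ 5 ≤ (1 + n) * β ^ 4 * ℓ ^ 5 := by gcongr
  have e3 : n * b ^ 3 * (κ ^ 2 * ℓ ^ 6) ≤ n * β ^ 3 * (κ ^ 2 * ℓ ^ 6) := by gcongr
  have e4 : n * c ^ 3 * (κ ^ 2 * ℓ ^ 6) ≤ n * β ^ 3 * (κ ^ 2 * ℓ ^ 6) := by gcongr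
  -- The segment area is odd in the curvature, so the two sides combine to `(b - c) * A`.
  have hsum : 2 * (ℓ - ℓ * s) + (b ^ 2 + c ^ 2) * (ℓ * s) ^ 3 / 24 - (b - c) * A
      - 2 * ((1 + n) * β ^ 4 * ℓ ^ 5) - 2 * (n * β ^ 3 * (κ ^ 2 * ℓ ^ 6)) ≤
      deficit n b κ ℓ + deficit n c (-κ) ℓ := by linarith
  refine le_trans ?_ hsum
  -- For `|κ| ≤ 8 β` the expansions in `κ ℓ` have errors of order `β⁴ ℓ⁵`. Otherwise the excess of
  -- the arc over its chord dominates everything else.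
  rcases le_total |κ| (8 * β) with hk | hk
  · have hk2 : κ ^ 2 ≤ 64 * β ^ 2 := by
      rw [← sq_abs]
      exact (pow_le_pow_left₀ (abs_nonneg _) hk 2).trans_eq (by ring)
    have hk3 : |κ| ^ 3 ≤ 512 * β ^ 3 := by
      refine (pow_le_pow_left₀ (abs_nonneg _) hk 3).trans_eq (by ring)
    have hk4 : κ ^ 4 ≤ 4096 * β ^ 4 := by
      rw [show κ ^ 4 = (κ ^ 2) ^ 2 by ring]
      exact (pow_le_pow_left₀ (sq_nonneg _) hk2 2).trans_eq (by ring)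
    have f1 : ℓ ^ 3 * κ ^ 2 / 24 - 4096 / 1920 * (β ^ 4 * ℓ ^ 5) ≤ ℓ - ℓ * s := by
      have h3 : ℓ * s ≤ ℓ * (1 - (κ * ℓ / 2) ^ 2 / 6 + (κ * ℓ / 2) ^ 4 / 120) :=
        mul_le_mul_of_nonneg_left hs3 hℓ
      have h4 : κ ^ 4 * ℓ ^ 5 ≤ 4096 * β ^ 4 * ℓ ^ 5 := by gcongr
      linarith
    have f2 : ℓ ^ 3 - 8 * (β ^ 2 * ℓ ^ 5) ≤ (ℓ * s) ^ 3 := by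
      have h3 : 1 - 3 * (1 - s) ≤ s ^ 3 := by
        have : 0 ≤ (1 - s) ^ 2 * (s + 2) := by positivity
        linarith
      have h4 : 1 - 3 * ((κ * ℓ / 2) ^ 2 / 6) ≤ s ^ 3 := by linarith
      have h5 : ℓ ^ 3 * (1 - 3 * ((κ * ℓ / 2) ^ 2 / 6)) ≤ ℓ ^ 3 * s ^ 3 :=
        mul_le_mul_of_nonneg_left h4 (by positivity)
      have h6 : κ ^ 2 * ℓ ^ 5 ≤ 64 * β ^ 2 * ℓ ^ 5 := by gcongr
      rw [mul_pow]
      linarith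
    have f3 : (b ^ 2 + c ^ 2) * (ℓ ^ 3 - 8 * (β ^ 2 * ℓ ^ 5)) / 24 ≤
        (b ^ 2 + c ^ 2) * (ℓ * s) ^ 3 / 24 := by gcongr
    have f4 : (b ^ 2 + c ^ 2) * (β ^ 2 * ℓ ^ 5) ≤ 2 * (β ^ 4 * ℓ ^ 5) := by
      have : (b ^ 2 + c ^ 2) * (β ^ 2 * ℓ ^ 5) ≤ (2 * β ^ 2) * (β ^ 2 * ℓ ^ 5) := by gcongr; linarith
      linarith
    have f5 : (b - c) * A ≤ (b - c) * (κ * ℓ ^ 3 / 12) + 512 / 240 * (β ^ 4 * ℓ ^ 5) := by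
      have h3 : (b - c) * (A - κ * ℓ ^ 3 / 12) ≤ β * (512 * β ^ 3 * ℓ ^ 5 / 240) := by
        refine (le_abs_self _).trans ?_
        rw [abs_mul]
        refine mul_le_mul hbc (hA'.trans ?_) (abs_nonneg _) hβ.le
        gcongr
      linarith
    have f6 : n * β ^ 3 * (κ ^ 2 * ℓ ^ 6) ≤ 16 * n * (β ^ 4 * ℓ ^ 5) := by
      calc n * β ^ 3 * (κ ^ 2 * ℓ ^ 6) ≤ n * β ^ 3 * (64 * β ^ 2 * ℓ ^ 6) := by gcongr
        _ = 64 * (n * β ^ 4 * ℓ ^ 5) * (β * ℓ) := by ring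
        _ ≤ 64 * (n * β ^ 4 * ℓ ^ 5) * (1 / 4) := by gcongr; linarith
        _ = _ := by ring
    -- The difference of the two sides is the square `ℓ³ (2 κ - (b - c))² / 48`: the worst curvature
    -- is `(b - c) / 2`.
    have f7 : ℓ ^ 3 * (b + c) ^ 2 / 48 ≤
        2 * (ℓ ^ 3 * κ ^ 2 / 24) + (b ^ 2 + c ^ 2) * ℓ ^ 3 / 24 - (b - c) * (κ * ℓ ^ 3 / 12) := by
      have h3 : 0 ≤ ℓ ^ 3 * (2 * κ - (b - c)) ^ 2 / 48 := by positivity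
      linarith
    have f8 : 0 ≤ β ^ 4 * ℓ ^ 5 := by positivity
    have f9 : 0 ≤ n * (β ^ 4 * ℓ ^ 5) := by positivity
    linarith
  -- With `Z = ℓ³ κ²`, the excess over the two chords is at least `2 Z / 48`, which pays for the
  -- area term `Z / 96`, the quadratic terms `2 Z / 256` and the claimed gain, at most `Z / 768`.
  · have hk2 : 64 * β ^ 2 ≤ κ ^ 2 := by
      rw [← sq_abs κ]
      exact le_of_eq_of_le (by ring) (pow_le_pow_left₀ (by positivity) hk 2)
    set Z := ℓ ^ 3 * κ ^ 2 with hZ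
    have hZ0 : 0 ≤ Z := by positivity
    have f1 : Z / 48 ≤ ℓ - ℓ * s := by
      have h3 : ℓ * s ≤ ℓ * (1 - (κ * ℓ / 2) ^ 2 / 12) := mul_le_mul_of_nonneg_left hs4 hℓ
      rw [hZ]; linarith
    have f2 : (b - c) * A ≤ Z / 96 := by
      refine (le_abs_self _).trans ?_
      rw [abs_mul]
      calc |b - c| * |A| ≤ (|κ| / 8) * (|κ| * ℓ ^ 3 / 12) :=
            mul_le_mul (by linarith) hA (abs_nonneg _) (by positivity)
        _ = Z / 96 := by rw [hZ, ← sq_abs κ]; ring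
    have f3 : n * β ^ 3 * (κ ^ 2 * ℓ ^ 6) ≤ Z / 256 := by
      have h3 : n * (β * ℓ) ≤ 1 / 8 := by linarith
      have h4 : (β * ℓ) ^ 2 ≤ 1 / 64 := (pow_le_pow_left₀ hβℓ0 hβ1 2).trans_eq (by norm_num)
      calc n * β ^ 3 * (κ ^ 2 * ℓ ^ 6) = (n * (β * ℓ)) * (β * ℓ) ^ 2 * Z := by rw [hZ]; ring
        _ ≤ 1 / 8 * (1 / 64) * Z := by gcongr
        _ ≤ Z / 256 := by linarith
    have f4 : ℓ ^ 3 * (b + c) ^ 2 / 48 ≤ Z / 768 := by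
      have h3 : (b + c) ^ 2 ≤ κ ^ 2 / 16 := by
        have : (b + c) ^ 2 ≤ (2 * β) ^ 2 := pow_le_pow_left₀ (by positivity) (by linarith) 2
        linarith
      have h4 : ℓ ^ 3 * (b + c) ^ 2 ≤ ℓ ^ 3 * (κ ^ 2 / 16) := by gcongr
      rw [hZ]; linarith
    have f5 : 0 ≤ (b ^ 2 + c ^ 2) * (ℓ * s) ^ 3 / 24 := by positivity
    have f8 : 0 ≤ β ^ 4 * ℓ ^ 5 := by positivity
    have f9 : 0 ≤ n * (β ^ 4 * ℓ ^ 5) := by positivity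
    linarith

end

/-! ### The perimeter of a single chamber -/

noncomputable section
open Complex

lemma essBoundary_subset_frontier (A : Set ℂ) : essBoundary A ⊆ frontier A := by
  intro p hp
  by_contra hf
  have hmem : p ∈ interior A ∨ p ∈ interior Aᶜ := by
    rw [frontier_eq_closure_inter_closure, mem_inter_iff, not_and_or, ← mem_compl_iff,
      ← mem_compl_iff, ← interior_compl, ← interior_compl, compl_compl] at hf
    exact hf.symm
  rcases hmem with h | h
  · obtain ⟨ρ, hρ, hb⟩ := Metric.mem_nhds_iff.1 (isOpen_interior.mem_nhds h)
    refine hp.2 (tendsto_const_nhds.congr' ?_)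
    filter_upwards [Ioo_mem_nhdsGT hρ] with s hs
    rw [inter_eq_right.2 ((Metric.ball_subset_ball hs.2.le).trans (hb.trans interior_subset)),
      ENNReal.div_self (Metric.measure_ball_pos volume p hs.1).ne' measure_ball_lt_top.ne]
  · obtain ⟨ρ, hρ, hb⟩ := Metric.mem_nhds_iff.1 (isOpen_interior.mem_nhds h)
    refine hp.1 (tendsto_const_nhds.congr' ?_)
    filter_upwards [Ioo_mem_nhdsGT hρ] with s hs
    have : A ∩ Metric.ball p s = ∅ := by
      rw [← disjoint_iff_inter_eq_empty, disjoint_comm]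
      exact disjoint_left.2 fun z hz => interior_subset (hb (Metric.ball_subset_ball hs.2.le hz))
    rw [this, measure_empty, ENNReal.zero_div]

lemma hausdorffMeasure_essBoundary_lt_top {A : Set ℂ} (hA : HasPiecewiseConstCurvBoundary A) :
    μH[1] (essBoundary A) < ⊤ :=
  (measure_mono (essBoundary_subset_frontier A)).trans_lt (hausdorffMeasure_frontier_lt_top hA)

lemma hausdorffMeasure_regBoundary_le_perimeter {A : Set ℂ} (hA : HasPiecewiseConstCurvBoundary A)
    (hm : MeasurableSet A) : (μH[1] (regBoundary A)).toReal ≤ perimeter A :=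
  ENNReal.toReal_mono (hausdorffMeasure_essBoundary_lt_top hA).ne
    (measure_mono (regBoundary_subset_essBoundary hm))

/-- Only this inequality is needed, since the disks stand on the smaller side of the claim. -/
lemma perimeter_ball_le {ρ : ℝ} (hρ : 0 < ρ) : perimeter (Metric.ball 0 ρ) ≤ 2 * Real.pi * ρ := by
  have harc : UnitArc (fun t : ℝ => (ρ : ℂ) * exp (((ρ⁻¹ * t : ℝ) : ℂ) * I)) I ρ⁻¹ := by
    refine ⟨norm_I, fun t => ?_⟩
    have h1 : HasDerivAt (fun t : ℝ => ((ρ⁻¹ * t : ℝ) : ℂ) * I) ((ρ⁻¹ : ℝ) * I) t := by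
      have h2 : HasDerivAt (fun t : ℝ => ((ρ⁻¹ * t : ℝ) : ℂ)) ((ρ⁻¹ : ℝ) : ℂ) t :=
        (((hasDerivAt_id t).const_mul ρ⁻¹).congr_deriv (mul_one _)).ofReal_comp
      exact h2.mul_const I
    refine (h1.cexp.const_mul (ρ : ℂ)).congr_deriv ?_
    have : (ρ : ℂ) ≠ 0 := by exact_mod_cast hρ.ne'
    push_cast
    field_simp
  have hsub : essBoundary (Metric.ball (0 : ℂ) ρ) ⊆
      (fun t : ℝ => (ρ : ℂ) * exp (((ρ⁻¹ * t : ℝ) : ℂ) * I)) '' Ioc (-(Real.pi * ρ)) (Real.pi * ρ) := by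
    intro z hz
    have hz1 := Metric.frontier_ball_subset_sphere (essBoundary_subset_frontier _ hz)
    rw [mem_sphere_zero_iff_norm] at hz1
    refine ⟨z.arg * ρ, ⟨?_, ?_⟩, ?_⟩
    · have := neg_pi_lt_arg z
      nlinarith
    · have := arg_le_pi z
      nlinarith
    · have h1 : ρ⁻¹ * (z.arg * ρ) = z.arg := by field_simp
      dsimp only
      rw [h1, ← hz1]
      exact norm_mul_exp_arg_mul_I z
  refine ENNReal.toReal_le_of_le_ofReal (by positivity) ?_
  refine (measure_mono hsub).trans ((harc.hausdorffMeasure_image_le _).trans_eq ?_)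
  rw [Real.volume_Ioc]
  congr 1; ring

lemma perimeter_equivDisk_le {A : Set ℂ} {r : ℝ} (hr : 0 < r)
    (hA : volume A = ENNReal.ofReal (Real.pi * r ^ 2)) : perimeter (equivDisk A) ≤ 2 * Real.pi * r := by
  have h1 : Real.sqrt ((volume A).toReal / Real.pi) = r := by
    rw [hA, ENNReal.toReal_ofReal (by positivity), mul_div_cancel_left₀ _ Real.pi_ne_zero,
      Real.sqrt_sq hr.le]
  rw [equivDisk, h1]
  exact perimeter_ball_le hr

/-- A quadratic lower bound for the square root. With `u = S / (π r²)` the left side is at most `π r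
(1 + u) (2 - u)`, and `(1 + u) (2 - u)² = 4 - u² (3 - u)` shows that the square of this number does
not exceed `4 π² r² (1 + u)` where `-1 < u < 2`; elsewhere it is not positive. -/
lemma le_of_four_pi_mul_le_sq {r S M : ℝ} (hr : 0 < r) (hM : 0 ≤ M)
    (h : 4 * Real.pi * (Real.pi * r ^ 2 + S) ≤ M ^ 2) :
    2 * Real.pi * r + 1 / r * S - (1 / r) ^ 3 * S ^ 2 ≤ M := by
  have hpi := Real.pi_pos
  obtain ⟨u, rfl⟩ : ∃ u, S = Real.pi * r ^ 2 * u := ⟨S / (Real.pi * r ^ 2), by field_simp⟩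
  have h1 : 2 * Real.pi * r + 1 / r * (Real.pi * r ^ 2 * u) - (1 / r) ^ 3 * (Real.pi * r ^ 2 * u) ^ 2 ≤
      Real.pi * r * ((1 + u) * (2 - u)) := by
    have h2 : 2 * Real.pi * r + 1 / r * (Real.pi * r ^ 2 * u) - (1 / r) ^ 3 * (Real.pi * r ^ 2 * u) ^ 2 =
        Real.pi * r * (2 + u - Real.pi * u ^ 2) := by field_simp
    rw [h2]
    refine mul_le_mul_of_nonneg_left ?_ (by positivity)
    nlinarith [Real.pi_gt_three, sq_nonneg u]
  refine h1.trans ?_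
  by_contra! hlt
  have hpos : 0 < (1 + u) * (2 - u) := pos_of_mul_pos_right (hM.trans_lt hlt) (by positivity)
  have hu1 : 0 < 1 + u := by
    by_contra! hc
    nlinarith
  have hu2 : 0 < 2 - u := pos_of_mul_pos_right hpos hu1.le
  have h3 : M ^ 2 < (Real.pi * r * ((1 + u) * (2 - u))) ^ 2 := pow_lt_pow_left₀ hlt hM two_ne_zero
  have h4 : (Real.pi * r * ((1 + u) * (2 - u))) ^ 2 =
      4 * Real.pi * (Real.pi * r ^ 2 + Real.pi * r ^ 2 * u) - (Real.pi * r) ^ 2 * (1 + u) * (u ^ 2 * (3 - u)) := by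
    ring
  have h5 : 0 ≤ (Real.pi * r) ^ 2 * (1 + u) * (u ^ 2 * (3 - u)) := by
    have : 0 ≤ 3 - u := by linarith
    positivity
  linarith

/-- The perimeter exceeds that of the disk of the same area by the deficits of any disjoint
boundary arcs. -/
theorem add_sum_deficit_le_perimeter {E : Set ℂ} (hE : IsOpen E) (hA : HasPiecewiseConstCurvBoundary E)
    {r : ℝ} (hr : 0 < r) (hvol : volume E = ENNReal.ofReal (Real.pi * r ^ 2))
    {ι : Type*} [Fintype ι] {γ : ι → ℝ → ℂ} {T : ι → ℂ} {κ ℓ : ι → ℝ} {F : ι → Set ℝ}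
    (h : ∀ i, BoundaryArc E (γ i) (T i) (κ i) (ℓ i) (F i))
    (hd : Pairwise fun i j => Disjoint (γ i '' (Ioo 0 (ℓ i) \ F i)) (γ j '' (Ioo 0 (ℓ j) \ F j)))
    (hℓ : ∀ i, 1 / r * ℓ i ≤ 1) :
    2 * Real.pi * r + ∑ i, deficit (Fintype.card ι) (1 / r) (κ i) (ℓ i) ≤ perimeter E := by
  have hpi := Real.pi_gt_three
  have hb0 : 0 < 1 / r := by positivity
  set b := 1 / r with hbdef
  have hb : Bornology.IsBounded E := isBounded_of_finite_area (by rw [hvol]; exact ENNReal.ofReal_lt_top) hA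
  set d : ι → ℝ := fun i => ℓ i * Real.sinc (κ i * ℓ i / 2) with hd_def
  have hx : ∀ i, |κ i * ℓ i / 2| ≤ Real.pi := fun i => by
    rw [abs_div, abs_mul, abs_of_nonneg (h i).nonneg, abs_two]
    linarith [(h i).curv_le]
  have hdn : ∀ i, ‖γ i (ℓ i) - γ i 0‖ = d i := fun i => by
    rw [(h i).arc.norm_chord, sub_zero, abs_of_nonneg (h i).nonneg,
      abs_of_nonneg (sinc_nonneg_of_abs_le_pi (hx i))]
  have hd0 : ∀ i, 0 ≤ d i := fun i => by rw [← hdn]; exact norm_nonneg _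
  have hbd : ∀ i, b * d i ≤ 1 := fun i => by
    refine le_trans (mul_le_mul_of_nonneg_left ?_ hb0.le) (hℓ i)
    exact mul_le_of_le_one_right (h i).nonneg (Real.sinc_le_one _)
  have hy : ∀ i, b * d i / 2 < Real.pi := fun i => by linarith [hbd i]
  have hs0 : ∀ i, 0 < Real.sinc (b * d i / 2) := fun i => by
    have h0 : 0 ≤ b * d i := mul_nonneg hb0.le (hd0 i)
    have := le_sinc (b * d i / 2)
    nlinarith [hbd i]
  -- Prescribing the opening angle `b d` instead of the curvature `b` makes length and curvature of
  -- the new arc explicit.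
  choose γ' T' hγ' h0 h1 using fun i => exists_arc_of_chord (γ i 0) (γ i (ℓ i) - γ i 0) hb0
    (by rw [hdn]; exact hy i)
  simp only [hdn] at hγ' h1
  set ℓ' : ι → ℝ := fun i => d i / Real.sinc (b * d i / 2) with hℓ'_def
  have hκℓ' : ∀ i, b * Real.sinc (b * d i / 2) * ℓ' i = b * d i := fun i => by
    have := (hs0 i).ne'
    rw [hℓ'_def]
    field_simp
  obtain ⟨hM0, hM⟩ := isoperimetric_of_replacement hE hb hA h hd hγ'
    (fun i => div_nonneg (hd0 i) (hs0 i).le)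
    (fun i => by
      rw [abs_of_pos (mul_pos hb0 (hs0 i)), hκℓ' i]
      linarith [hbd i]) h0 (fun i => by rw [h1 i]; ring)
  rw [hvol, ENNReal.toReal_ofReal (by positivity)] at hM
  have hlow := le_of_four_pi_mul_le_sq hr hM0 hM
  rw [← hbdef] at hlow
  have hreg := hausdorffMeasure_regBoundary_le_perimeter hA hE.measurableSet
  -- The total area change enters squared; by Cauchy-Schwarz it is distributed over the arcs at the
  -- price of their number, which is the parameter `n` of `deficit`.
  set a : ι → ℝ := fun i => segArea (b * Real.sinc (b * d i / 2)) (ℓ' i) - segArea (κ i) (ℓ i) with ha_def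
  have hCS : (∑ i, a i) ^ 2 ≤ (Fintype.card ι : ℝ) * ∑ i, a i ^ 2 := by
    have := sq_sum_le_card_mul_sum_sq (s := Finset.univ) (f := a)
    simpa using this
  have hdef : ∑ i, deficit (Fintype.card ι) b (κ i) (ℓ i) =
      -(∑ i, (ℓ' i - ℓ i)) + b * ∑ i, a i - (Fintype.card ι) * b ^ 3 * ∑ i, a i ^ 2 := by
    rw [Finset.mul_sum, Finset.mul_sum, ← Finset.sum_neg_distrib, ← Finset.sum_add_distrib,
      ← Finset.sum_sub_distrib]
    refine Finset.sum_congr rfl fun i _ => ?_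
    simp only [deficit, ha_def, hℓ'_def, hd_def]
    ring
  rw [hdef]
  have h9 : b ^ 3 * (∑ i, a i) ^ 2 ≤ b ^ 3 * ((Fintype.card ι : ℝ) * ∑ i, a i ^ 2) :=
    mul_le_mul_of_nonneg_left hCS (by positivity)
  linarith

end

/-! ### Interfaces of a cluster -/

noncomputable section
open Complex

/-- In a finite measurable partition, every point of an essential boundary lies on another one. -/
lemma essBoundary_subset_iUnion {ι : Type*} [Fintype ι] [DecidableEq ι] {A : ι → Set ℂ}
    (hm : ∀ i, MeasurableSet (A i)) (hd : Pairwise fun i j => Disjoint (A i) (A j))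
    (hU : ⋃ i, A i = univ) (i : ι) :
    essBoundary (A i) ⊆ ⋃ j ∈ Finset.univ.erase i, essBoundary (A j) := by
  intro p hp
  by_contra hc
  simp only [mem_iUnion, not_exists] at hc
  set D : ι → ℝ → ENNReal := fun j ρ =>
    volume (A j ∩ Metric.ball p ρ) / volume (Metric.ball p ρ) with hD
  -- Were `p` on no other essential boundary, all other densities would converge to `0` or `1`. The
  -- limits are kept as natural numbers so that their sum can be enumerated.
  have hlim : ∀ j ∈ Finset.univ.erase i, ∃ c : ℕ, Tendsto (fun ρ => (D j ρ).toReal) (𝓝[>] 0) (𝓝 (c : ℝ)) := by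
    intro j hj
    have h1 := hc j hj
    rw [essBoundary, mem_ofPred_eq, not_and_or, not_not, not_not] at h1
    rcases h1 with h1 | h1
    · refine ⟨0, ?_⟩
      rw [Nat.cast_zero, ← ENNReal.toReal_zero]
      exact (ENNReal.tendsto_toReal ENNReal.zero_ne_top).comp h1
    · refine ⟨1, ?_⟩
      rw [Nat.cast_one, ← ENNReal.toReal_one]
      exact (ENNReal.tendsto_toReal ENNReal.one_ne_top).comp h1
  choose! c hc' using hlim
  have hDle : ∀ j ρ, D j ρ ≤ 1 := fun j ρ =>
    ENNReal.div_le_of_le_mul (by rw [one_mul]; exact measure_mono inter_subset_right)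
  have hDfin : ∀ j ρ, D j ρ ≠ ⊤ := fun j ρ => ((hDle j ρ).trans_lt ENNReal.one_lt_top).ne
  have hsum : ∀ᶠ ρ in 𝓝[>] 0, 1 - ∑ j ∈ Finset.univ.erase i, (D j ρ).toReal = (D i ρ).toReal := by
    filter_upwards [self_mem_nhdsWithin] with ρ hρ
    have h1 : ∑ j, D j ρ = 1 := by
      have h2 : ∑ j, volume (A j ∩ Metric.ball p ρ) = volume (Metric.ball p ρ) := by
        rw [← tsum_fintype (L := .unconditional ι), ← measure_iUnion
          (fun j k hjk => (hd hjk).mono inter_subset_left inter_subset_left)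
          (fun j => (hm j).inter measurableSet_ball), ← iUnion_inter, hU, univ_inter]
      simp only [hD, div_eq_mul_inv]
      rw [← Finset.sum_mul, h2]
      exact ENNReal.mul_inv_cancel (Metric.measure_ball_pos volume p hρ).ne' measure_ball_lt_top.ne
    have h2 : ∑ j, (D j ρ).toReal = 1 := by
      rw [← ENNReal.toReal_sum fun j _ => hDfin j ρ, h1, ENNReal.toReal_one]
    rw [← Finset.add_sum_erase _ _ (Finset.mem_univ i)] at h2
    linarith
  have hT : Tendsto (fun ρ => (D i ρ).toReal) (𝓝[>] 0)
      (𝓝 (1 - ∑ j ∈ Finset.univ.erase i, (c j : ℝ))) :=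
    (tendsto_const_nhds.sub (tendsto_finsetSum _ hc')).congr' hsum
  have hnn : 0 ≤ 1 - ∑ j ∈ Finset.univ.erase i, (c j : ℝ) :=
    ge_of_tendsto hT (Eventually.of_forall fun _ => ENNReal.toReal_nonneg)
  -- The densities add up to `1`, so the remaining one would converge to `1` or `0`, which the
  -- essential boundary excludes.
  have hk : (∑ j ∈ Finset.univ.erase i, c j) ≤ 1 := by
    have : ((∑ j ∈ Finset.univ.erase i, c j : ℕ) : ℝ) ≤ 1 := by push_cast; linarith
    exact_mod_cast this
  have hconv : ∀ x : ENNReal, x ≠ ⊤ → 1 - ∑ j ∈ Finset.univ.erase i, (c j : ℝ) = x.toReal →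
      Tendsto (D i) (𝓝[>] 0) (𝓝 x) := fun x hx he => by
    rw [he] at hT
    exact (ENNReal.tendsto_toReal_iff (hDfin i) hx).1 hT
  rw [← Nat.cast_sum] at hconv
  interval_cases h : ∑ j ∈ Finset.univ.erase i, c j
  · exact hp.2 (hconv 1 ENNReal.one_ne_top (by simp))
  · exact hp.1 (hconv 0 ENNReal.zero_ne_top (by simp))

lemma sum_sum_eq_sum_sum_Ioi {N : ℕ} {f : Fin N → Fin N → ℝ} (hf : ∀ i, f i i = 0) :
    ∑ i, ∑ j, f i j = ∑ i, ∑ j ∈ Finset.Ioi i, (f i j + f j i) := by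
  rw [Finset.sum_sum_Ioi_add_eq_sum_sum_off_diag (fun i j => f j i)]
  refine Finset.sum_congr rfl fun i _ => ?_
  rw [← Finset.sum_add_sum_compl {i}, Finset.sum_singleton, hf, zero_add]

section Cluster

variable {N : ℕ} {E : Fin N → Set ℂ}

/-- The length of the interface between two bounded chambers. -/
def interfaceLength (E : Fin N → Set ℂ) (i j : Fin N) : ℝ :=
  (μH[1] (interface E i.succ j.succ)).toReal

lemma interface_comm (i j : Fin (N + 1)) : interface E i j = interface E j i := inter_comm _ _

lemma interfaceLength_comm (i j : Fin N) : interfaceLength E i j = interfaceLength E j i := by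
  rw [interfaceLength, interface_comm, interfaceLength]

lemma interfaceLength_nonneg (i j : Fin N) : 0 ≤ interfaceLength E i j := ENNReal.toReal_nonneg

lemma hausdorffMeasure_interface_lt_top (hcurv : ∀ i, HasPiecewiseConstCurvBoundary (E i)) (i : Fin N)
    (j : Fin (N + 1)) : μH[1] (interface E i.succ j) < ⊤ :=
  (measure_mono inter_subset_left).trans_lt (hausdorffMeasure_essBoundary_lt_top (hcurv i))

lemma interfaceLength_le_perimeter (hcurv : ∀ i, HasPiecewiseConstCurvBoundary (E i)) (i j : Fin N) :
    interfaceLength E i j ≤ perimeter (E i) :=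
  ENNReal.toReal_mono (hausdorffMeasure_essBoundary_lt_top (hcurv i)).ne
    (measure_mono inter_subset_left)

lemma contact_eq_ite (hcurv : ∀ i, HasPiecewiseConstCurvBoundary (E i)) (i j : Fin N) :
    contact E i j = if 0 < interfaceLength E i j then 1 else 0 := by
  have h : 0 < interfaceLength E i j ↔ 0 < μH[1] (interface E i.succ j.succ) := by
    rw [interfaceLength, ENNReal.toReal_pos_iff]
    exact and_iff_left (hausdorffMeasure_interface_lt_top hcurv i _)
  simp only [contact, h]

/-- With the exterior included, the chambers partition the plane, so the essential boundary of `E i`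
is covered by its interfaces. -/
lemma perimeter_le_sum (hE : IsCluster E) (hcurv : ∀ i, HasPiecewiseConstCurvBoundary (E i)) (i : Fin N) :
    perimeter (E i) ≤ (μH[1] (interface E 0 i.succ)).toReal +
      ∑ j, if i = j then 0 else interfaceLength E i j := by
  have hm : ∀ a, MeasurableSet (chamber E a) := by
    refine Fin.cases ?_ fun j => ?_
    · exact (MeasurableSet.iUnion fun j => (hE.isOpen j).measurableSet).compl
    · exact (hE.isOpen j).measurableSet
  have hd : Pairwise fun a b => Disjoint (chamber E a) (chamber E b) := by
    have h0 : ∀ j, Disjoint (⋃ i, E i)ᶜ (E j) := fun j =>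
      disjoint_compl_left.mono_right (subset_iUnion E j)
    refine Fin.cases (Fin.cases (fun h => absurd rfl h) fun j _ => h0 j) fun i =>
      Fin.cases (fun _ => (h0 i).symm) fun j hij => hE.disjoint i j fun h => hij (by rw [h])
  have hU : ⋃ a, chamber E a = univ := by
    refine eq_univ_of_forall fun z => ?_
    by_cases hz : z ∈ ⋃ i, E i
    · obtain ⟨j, hj⟩ := mem_iUnion.1 hz
      exact mem_iUnion.2 ⟨j.succ, hj⟩
    · exact mem_iUnion.2 ⟨0, hz⟩
  have hsub : essBoundary (E i) ⊆ ⋃ a ∈ Finset.univ.erase i.succ, interface E i.succ a := by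
    intro p hp
    have h1 := essBoundary_subset_iUnion hm hd hU i.succ hp
    simp only [mem_iUnion] at h1 ⊢
    obtain ⟨a, ha, hpa⟩ := h1
    exact ⟨a, ha, hp, hpa⟩
  have hfin := fun a => (hausdorffMeasure_interface_lt_top hcurv i a).ne
  have h2 : perimeter (E i) ≤ ∑ a ∈ Finset.univ.erase i.succ, (μH[1] (interface E i.succ a)).toReal := by
    rw [← ENNReal.toReal_sum fun a _ => hfin a]
    exact ENNReal.toReal_mono (ENNReal.sum_ne_top.2 fun a _ => hfin a)
      ((measure_mono hsub).trans (measure_biUnion_finset_le _ _))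
  refine h2.trans_eq ?_
  have h3 : ∑ a ∈ Finset.univ.erase i.succ, (μH[1] (interface E i.succ a)).toReal =
      ∑ a, if i.succ = a then 0 else (μH[1] (interface E i.succ a)).toReal := by
    rw [← Finset.add_sum_erase _ _ (Finset.mem_univ i.succ), if_pos rfl, zero_add]
    exact Finset.sum_congr rfl fun a ha => (if_neg (Finset.ne_of_mem_erase ha).symm).symm
  rw [h3, Fin.sum_univ_succ, if_neg (Fin.succ_ne_zero i), interface_comm]
  simp only [Fin.succ_inj, interfaceLength]

/-- In the half sum over ordered pairs an exterior interface counts once and a true interface `2 -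
ε` times, while in the sum of the bounds of `perimeter_le_sum` it counts once and twice,
respectively. -/
lemma sum_perimeter_sub_le_weightedPerimeter (hE : IsCluster E)
    (hcurv : ∀ i, HasPiecewiseConstCurvBoundary (E i)) (ε : ℝ) :
    ∑ i, perimeter (E i) - ε * ∑ i, ∑ j ∈ Finset.Ioi i, interfaceLength E i j ≤
      weightedPerimeter ε E := by
  set z : Fin N → ℝ := fun i => (μH[1] (interface E 0 i.succ)).toReal with hz
  set x : Fin N → Fin N → ℝ := fun i j => if i = j then 0 else interfaceLength E i j with hx
  have hxx : ∑ i, ∑ j, x i j = 2 * ∑ i, ∑ j ∈ Finset.Ioi i, interfaceLength E i j := by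
    rw [sum_sum_eq_sum_sum_Ioi fun i => by simp [hx], Finset.mul_sum]
    refine Finset.sum_congr rfl fun i _ => ?_
    rw [Finset.mul_sum]
    refine Finset.sum_congr rfl fun j hj => ?_
    have hij : i ≠ j := (Finset.mem_Ioi.1 hj).ne
    simp only [hx, if_neg hij, if_neg hij.symm, interfaceLength_comm j i]
    ring
  have hP : ∑ i, perimeter (E i) ≤ ∑ i, z i + ∑ i, ∑ j, x i j := by
    rw [← Finset.sum_add_distrib]
    exact Finset.sum_le_sum fun i _ => perimeter_le_sum hE hcurv i
  have hW : weightedPerimeter ε E = ∑ i, z i + (1 - ε / 2) * ∑ i, ∑ j, x i j := by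
    rw [weightedPerimeter, Fin.sum_univ_succ]
    have h0 : ∀ i j : Fin N, (if i.succ = j.succ then 0 else
        weight ε i.succ j.succ * (μH[1] (interface E i.succ j.succ)).toReal) = (2 - ε) * x i j := by
      intro i j
      simp only [hx, Fin.succ_inj, weight, Fin.succ_ne_zero, or_self, if_false, interfaceLength]
      split_ifs <;> ring
    have h1 : ∀ i : Fin N, (if (0 : Fin (N + 1)) = i.succ then 0 else
        weight ε 0 i.succ * (μH[1] (interface E 0 i.succ)).toReal) = z i := by
      intro i
      simp [hz, weight, (Fin.succ_ne_zero i).symm]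
    have h2 : ∀ i : Fin N, (if i.succ = (0 : Fin (N + 1)) then 0 else
        weight ε i.succ 0 * (μH[1] (interface E i.succ 0)).toReal) = z i := by
      intro i
      simp [hz, weight, interface_comm i.succ 0]
    simp only [Fin.sum_univ_succ, h0, h1, h2, if_true, Finset.sum_add_distrib, ← Finset.mul_sum]
    ring
  rw [hW]
  rw [hxx] at hP ⊢
  linarith

/-- The interface of two chambers which share at most one arc is covered by that arc. -/
lemma exists_arc_of_shareAtMostOneArc (hE : IsCluster E)
    (hcurv : ∀ i, HasPiecewiseConstCurvBoundary (E i)) {i j : Fin N} (hij : i ≠ j)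
    (h : ShareAtMostOneArc (E i) (E j)) :
    ∃ κ : ℝ, ∀ m, 0 ≤ m → m ≤ interfaceLength E i j →
      ∃ (γ : ℝ → ℂ) (T : ℂ) (F : Set ℝ), SharedArc (E i) (E j) γ T κ m F := by
  have hsub : interface E i.succ j.succ ⊆ frontier (E i) ∩ frontier (E j) :=
    inter_subset_inter (essBoundary_subset_frontier _) (essBoundary_subset_frontier _)
  have : NullSingletonClass (μH[1] : Measure ℂ) := Measure.nullSingletonClass_hausdorff ℂ one_pos
  rcases h with h | ⟨γ, κ, L, S, hγ, hS, hfr, hrun⟩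
  -- A finite common frontier has length zero: only `m = 0` occurs and any degenerate arc will do.
  · obtain ⟨γ, hγ, -⟩ := UnitArc.exists_arc 0 (T := 1) (by simp) 0
    refine ⟨0, fun m hm0 hm => ⟨γ, 1, ∅, ?_⟩⟩
    have hz : interfaceLength E i j = 0 := by
      rw [interfaceLength, (h.subset hsub).measure_zero, ENNReal.toReal_zero]
    obtain rfl : m = 0 := le_antisymm (hz ▸ hm) hm0
    exact SharedArc.trivial hγ
  · obtain ⟨T, F, hF⟩ := exists_sharedArc (hE.isOpen i) (hE.isOpen j) (hE.disjoint i j hij) (hcurv i)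
      (hcurv j) hγ (by rw [hfr]; exact subset_union_left) hrun
    obtain ⟨T', hT'⟩ := hγ.exists_unitArc
    refine ⟨κ, fun m hm0 hm => ⟨γ, T, F, hF m hm0 (hm.trans ?_)⟩⟩
    refine ENNReal.toReal_le_of_le_ofReal hγ.length_pos.le ?_
    calc μH[1] (interface E i.succ j.succ) ≤ μH[1] (γ '' Icc 0 L ∪ S) := measure_mono (hsub.trans hfr.subset)
      _ ≤ μH[1] (γ '' Icc 0 L) + μH[1] S := measure_union_le _ _
      _ = μH[1] (γ '' Icc 0 L) := by rw [hS.measure_zero, add_zero]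
      _ ≤ volume (Icc 0 L) := hT'.hausdorffMeasure_image_le _
      _ = ENNReal.ofReal L := by rw [Real.volume_Icc, sub_zero]

end Cluster
end

/-! ### Optimisation and the sum over pairs -/

noncomputable section
open Complex

lemma rpow_half_eq {ε : ℝ} (hε : 0 < ε) :
    ε ^ (3 / 2 : ℝ) = Real.sqrt ε ^ 3 ∧ ε ^ (5 / 2 : ℝ) = Real.sqrt ε ^ 5 := by
  constructor <;>
  · rw [Real.sqrt_eq_rpow, ← Real.rpow_natCast, ← Real.rpow_mul hε.le]
    norm_num

/-- Minimisation of the cubic deficit against the linear gain. -/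
lemma exists_pair_bound {σ C₁ X ℓmax : ℝ} (hσ : 0 < σ) (hC₁ : 0 ≤ C₁) (hX : 0 ≤ X)
    (hmax : 0 < ℓmax) :
    ∃ C ε₀ ℓ₀ : ℝ, 0 ≤ C ∧ 0 < ε₀ ∧ 0 < ℓ₀ ∧ ℓ₀ ≤ ℓmax ∧ ∀ ε, 0 < ε → ε < ε₀ → ∀ s, σ ≤ s →
      ∀ x, 0 ≤ x → x ≤ X →
      -(4 / 3 * ε ^ (3 / 2 : ℝ) * (2 / s)) - C * ε ^ (5 / 2 : ℝ) ≤
        min x ℓ₀ ^ 3 * s ^ 2 / 48 - C₁ * min x ℓ₀ ^ 5 - ε * x := by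
  -- Since `ℓ₀ ≤ 1`, the last bound yields `C₁ ℓ₀² ≤ σ² / 96`: up to length `ℓ₀` the quintic error
  -- costs at most half of the cubic gain.
  obtain ⟨ℓ₀, hℓ0, hℓ1, hℓ2, hℓ3⟩ : ∃ ℓ₀ : ℝ, 0 < ℓ₀ ∧ ℓ₀ ≤ ℓmax ∧ ℓ₀ ≤ 1 ∧
      ℓ₀ ≤ σ ^ 2 / (96 * (C₁ + 1)) :=
    ⟨min ℓmax (min 1 (σ ^ 2 / (96 * (C₁ + 1)))), by positivity, min_le_left _ _,
      (min_le_right _ _).trans (min_le_left _ _), (min_le_right _ _).trans (min_le_right _ _)⟩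
  have hsmall : C₁ * ℓ₀ ^ 2 ≤ σ ^ 2 / 96 := by
    rw [le_div_iff₀ (by positivity)] at hℓ3
    have : ℓ₀ ^ 2 ≤ ℓ₀ := by rw [sq]; exact mul_le_of_le_one_left hℓ0.le hℓ2
    have := mul_le_mul_of_nonneg_left this hC₁
    linarith
  refine ⟨C₁ * (10 / σ) ^ 5, σ ^ 2 * ℓ₀ ^ 3 / (96 * (X + 1)), ℓ₀, by positivity, by positivity, hℓ0,
    hℓ1, fun ε hε hε0 s hs x hx0 hxX => ?_⟩
  obtain ⟨h3, h5⟩ := rpow_half_eq hε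
  rw [h3, h5]
  set e := Real.sqrt ε
  have he : 0 < e := Real.sqrt_pos.2 hε
  have hee : ε = e ^ 2 := (Real.sq_sqrt hε.le).symm
  have hs0 : 0 < s := hσ.trans_le hs
  have hsσ : σ ^ 2 ≤ s ^ 2 := pow_le_pow_left₀ hσ.le hs 2
  have hneg : -(4 / 3 * e ^ 3 * (2 / s)) - C₁ * (10 / σ) ^ 5 * e ^ 5 ≤ 0 := by
    have : 0 ≤ 4 / 3 * e ^ 3 * (2 / s) := by positivity
    have : 0 ≤ C₁ * (10 / σ) ^ 5 * e ^ 5 := by positivity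
    linarith
  have hhalf : ∀ m, 0 ≤ m → m ≤ ℓ₀ → m ^ 3 * σ ^ 2 / 96 ≤ m ^ 3 * s ^ 2 / 48 - C₁ * m ^ 5 := by
    intro m hm0 hm
    have h1 : C₁ * m ^ 2 ≤ σ ^ 2 / 96 :=
      (mul_le_mul_of_nonneg_left (pow_le_pow_left₀ hm0 hm 2) hC₁).trans hsmall
    have h2 := mul_le_mul_of_nonneg_left h1 (pow_nonneg hm0 3)
    have h3 := mul_le_mul_of_nonneg_left hsσ (pow_nonneg hm0 3)
    linarith
  rcases le_total x ℓ₀ with hx | hx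
  · rw [min_eq_left hx]
    -- Up to `10 √ε / σ` the quintic error is of order `ε^(5/2)` and the cubic is minimised exactly,
    -- through a factorisation with the double root `x s = 4 √ε`. Beyond, half of the cubic gain
    -- already exceeds `ε x`.
    rcases le_total x (10 * e / σ) with hxe | hxe
    · have h1 : C₁ * x ^ 5 ≤ C₁ * (10 / σ) ^ 5 * e ^ 5 := by
        have : x ^ 5 ≤ (10 * e / σ) ^ 5 := pow_le_pow_left₀ hx0 hxe 5
        calc C₁ * x ^ 5 ≤ C₁ * (10 * e / σ) ^ 5 := mul_le_mul_of_nonneg_left this hC₁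
          _ = _ := by ring
      have h2 : 0 ≤ x ^ 3 * s ^ 2 / 48 - e ^ 2 * x + 4 / 3 * e ^ 3 * (2 / s) := by
        have h3 : x ^ 3 * s ^ 2 / 48 - e ^ 2 * x + 4 / 3 * e ^ 3 * (2 / s) =
            (x * s - 4 * e) ^ 2 * (x * s + 8 * e) / (48 * s) := by
          field_simp; ring
        rw [h3]
        positivity
      rw [hee]; linarith
    · refine hneg.trans ?_
      have h1 := hhalf x hx0 hx
      have h2 : 100 * e ^ 2 ≤ x ^ 2 * σ ^ 2 := by
        rw [div_le_iff₀ hσ] at hxe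
        have := pow_le_pow_left₀ (by positivity) hxe 2
        linarith
      have h3 := mul_le_mul_of_nonneg_left h2 hx0
      have h4 : 0 ≤ x * e ^ 2 := by positivity
      rw [hee]; linarith
  -- For a long interface the fixed gain of the piece of length `ℓ₀` exceeds `ε X`, by the choice of
  -- `ε₀`.
  · rw [min_eq_right hx]
    refine hneg.trans ?_
    have h1 := hhalf ℓ₀ hℓ0.le le_rfl
    rw [lt_div_iff₀ (by positivity)] at hε0
    have h2 := mul_le_mul_of_nonneg_left hxX hε.le
    linarith

/-- The curvatures of the shared arcs, with signs. -/
lemma exists_curvatures {N : ℕ} {E : Fin N → Set ℂ} (hE : IsCluster E)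
    (hcurv : ∀ i, HasPiecewiseConstCurvBoundary (E i))
    (hshare : ∀ i j, i < j → ShareAtMostOneArc (E i) (E j)) :
    ∃ κ : Fin N → Fin N → ℝ, (∀ i j, i < j → κ j i = -κ i j) ∧
      ∀ i j, i ≠ j → ∀ m, 0 ≤ m → m ≤ interfaceLength E i j →
        ∃ (γ : ℝ → ℂ) (T : ℂ) (F : Set ℝ), SharedArc (E i) (E j) γ T (κ i j) m F := by
  have h : ∀ i j, ∃ k : ℝ, i < j → ∀ m, 0 ≤ m → m ≤ interfaceLength E i j →
      ∃ (γ : ℝ → ℂ) (T : ℂ) (F : Set ℝ), SharedArc (E i) (E j) γ T k m F := by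
    intro i j
    by_cases hij : i < j
    · obtain ⟨k, hk⟩ := exists_arc_of_shareAtMostOneArc hE hcurv hij.ne (hshare i j hij)
      exact ⟨k, fun _ => hk⟩
    · exact ⟨0, fun h => absurd h hij⟩
  choose k hk using h
  -- For `i > j` the arc is traversed backwards, which exchanges the two sides and changes the sign
  -- of the curvature.
  refine ⟨fun i j => if i < j then k i j else -k j i, fun i j hij => ?_, fun i j hij m hm0 hm => ?_⟩
  · simp only [if_neg hij.not_gt, if_pos hij]
  · rcases lt_or_gt_of_ne hij with hlt | hgt
    · simp only [if_pos hlt]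
      exact hk i j hlt m hm0 hm
    · simp only [if_neg hgt.not_gt]
      obtain ⟨γ, T, F, h⟩ := hk j i hgt m hm0 (by rwa [interfaceLength_comm])
      exact ⟨_, _, _, h.reverse⟩

/-- The perimeters of the chambers, in terms of the deficits of initial pieces of length `m i j` of
the shared arcs. -/
lemma exists_deficits {N : ℕ} {r : Fin N → ℝ} (hr : ∀ i, 0 < r i) {E : Fin N → Set ℂ}
    (hE : IsCluster E) (hvol : ∀ i, volume (E i) = ENNReal.ofReal (Real.pi * r i ^ 2))
    (hcurv : ∀ i, HasPiecewiseConstCurvBoundary (E i))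
    (hshare : ∀ i j, i < j → ShareAtMostOneArc (E i) (E j)) {m : Fin N → Fin N → ℝ}
    (hm0 : ∀ i j, 0 ≤ m i j) (hmm : ∀ i j, m i j = m j i) (hm : ∀ i j, m i j ≤ interfaceLength E i j)
    (hmr : ∀ i j, 1 / r i * m i j ≤ 1) :
    ∃ κ : Fin N → Fin N → ℝ, (∀ i j, i < j → |κ i j| * m i j ≤ 2 * Real.pi) ∧
      ∑ i, 2 * Real.pi * r i + ∑ i, ∑ j ∈ Finset.Ioi i,
        (deficit N (1 / r i) (κ i j) (m i j) + deficit N (1 / r j) (-κ i j) (m i j)) ≤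
      ∑ i, perimeter (E i) := by
  obtain ⟨κ, hκ, harc⟩ := exists_curvatures hE hcurv hshare
  refine ⟨κ, fun i j hij => ?_, ?_⟩
  · obtain ⟨γ, T, F, h⟩ := harc i j hij.ne (m i j) (hm0 i j) (hm i j)
    exact h.left.curv_le
  -- The diagonal index receives a degenerate arc with zero deficit, so that the family is indexed
  -- by all of `Fin N`.
  set ℓ : Fin N → Fin N → ℝ := fun i j => if i = j then 0 else m i j with hℓ
  have hall : ∀ i j, ∃ (γ : ℝ → ℂ) (T : ℂ) (F : Set ℝ), SharedArc (E i) (E j) γ T (κ i j) (ℓ i j) F := by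
    intro i j
    by_cases hij : i = j
    · obtain ⟨γ, hγ, -⟩ := UnitArc.exists_arc 0 (T := 1) (by simp) (κ i j)
      refine ⟨γ, 1, ∅, ?_⟩
      rw [show ℓ i j = 0 from if_pos hij]
      exact SharedArc.trivial hγ
    · rw [show ℓ i j = m i j from if_neg hij]
      exact harc i j hij _ (hm0 i j) (hm i j)
  choose γ T F h using hall
  have hP : ∀ i, 2 * Real.pi * r i + ∑ j, deficit N (1 / r i) (κ i j) (ℓ i j) ≤ perimeter (E i) := by
    intro i
    have := add_sum_deficit_le_perimeter (hE.isOpen i) (hcurv i) (hr i) (hvol i) (fun j => (h i j).left)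
      (fun j k hjk => (h i j).disjoint_image (h i k) (hE.disjoint j k hjk)) (fun j => by
        by_cases hij : i = j
        · simp [hℓ, hij]
        · rw [show ℓ i j = m i j from if_neg hij]
          exact hmr i j)
    rwa [Fintype.card_fin] at this
  have hsum := Finset.sum_le_sum fun i (_ : i ∈ Finset.univ) => hP i
  rw [Finset.sum_add_distrib, sum_sum_eq_sum_sum_Ioi fun i => by simp [hℓ, deficit_zero]] at hsum
  refine le_trans (le_of_eq ?_) hsum
  congr 1
  refine Finset.sum_congr rfl fun i _ => Finset.sum_congr rfl fun j hj => ?_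
  have hij := Finset.mem_Ioi.1 hj
  rw [show ℓ i j = m i j from if_neg hij.ne, show ℓ j i = m i j from (if_neg hij.ne').trans (hmm j i),
    hκ i j hij]

lemma two_mul_mul_div_add_eq {r s : ℝ} (hr : 0 < r) (hs : 0 < s) :
    2 * r * s / (r + s) = 2 / (1 / r + 1 / s) := by
  field_simp
  ring

end

/-! ### Conclusion -/

theorem proposition3p6 (N : ℕ) (r : Fin N → ℝ) (hr : ∀ i, 0 < r i) :
    ∃ C ε₀ : ℝ, 0 < ε₀ ∧ ∀ ε : ℝ, 0 < ε → ε < ε₀ →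
      ∀ E : Fin N → Set ℂ, IsCluster E →
        (∀ i, volume (E i) = ENNReal.ofReal (Real.pi * r i ^ 2)) →
        (∀ i, HasPiecewiseConstCurvBoundary (E i)) →
        (∀ i j, i < j → ShareAtMostOneArc (E i) (E j)) →
        weightedPerimeter ε E ≥
          (∑ i, perimeter (equivDisk (E i)))
            - 4 / 3 * ε ^ (3 / 2 : ℝ) *
                (∑ i, ∑ j ∈ Finset.Ioi i, contact E i j * (2 * r i * r j / (r i + r j)))
            - C * ε ^ (5 / 2 : ℝ) := by
  have hpi := Real.pi_pos
  set Q : ℝ := ∑ i, 2 * Real.pi * r i with hQ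
  have hQ0 : 0 ≤ Q := Finset.sum_nonneg fun i _ => by have := hr i; positivity
  -- A bound for all curvatures `1 / r i`, as `R` below is one for all radii; the summand `1` keeps
  -- both positive when `N = 0`.
  set β : ℝ := 1 + ∑ i, 1 / r i with hβ
  have hrinv : ∀ i, 0 < 1 / r i := fun i => one_div_pos.2 (hr i)
  have hβ0 : 0 < β := by
    have := Finset.sum_nonneg fun i (_ : i ∈ Finset.univ) => (hrinv i).le
    linarith
  have hbβ : ∀ i, 1 / r i ≤ β := fun i => by
    have := Finset.single_le_sum (fun j _ => (hrinv j).le) (Finset.mem_univ i)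
    linarith
  set R : ℝ := 1 + ∑ i, r i with hR
  have hR0 : 0 < R := by
    have := Finset.sum_nonneg fun i (_ : i ∈ Finset.univ) => (hr i).le
    linarith
  have hσ : ∀ i, 1 / R ≤ 1 / r i := fun i => by
    have := Finset.single_le_sum (fun j _ => (hr j).le) (Finset.mem_univ i)
    exact one_div_le_one_div_of_le (hr i) (by linarith)
  -- `1 / R` is a lower bound for `1 / r i + 1 / r j`, `2 Q` bounds every interface once the total
  -- perimeter is at most `2 Q`, and the bound on `ℓ₀` is the smallness required by
  -- `le_deficit_add_deficit`.
  obtain ⟨C, ε₁, ℓ₀, hC, hε₁, hℓ0, hℓ1, hpair⟩ := exists_pair_bound (σ := 1 / R)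
    (C₁ := (10 + 40 * N) * β ^ 4) (X := 2 * Q) (ℓmax := 1 / (8 * (N + 1) * β)) (by positivity)
    (by positivity) (by positivity) (by positivity)
  -- One error constant for each pair; the second bound on `ε` serves the case of large total
  -- perimeter.
  refine ⟨∑ i : Fin N, ∑ j ∈ Finset.Ioi i, C, min ε₁ (1 / (2 * (N + 1))), by positivity,
    fun ε hε hεlt E hE hvol hcurv hshare => ?_⟩
  have hε1 : ε < ε₁ := hεlt.trans_le (min_le_left _ _)
  have hε2 : ε * (2 * (N + 1)) < 1 := by
    have := hεlt.trans_le (min_le_right _ _)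
    rwa [lt_div_iff₀ (by positivity)] at this
  have hW := sum_perimeter_sub_le_weightedPerimeter hE hcurv ε
  have hdisk : ∑ i, perimeter (equivDisk (E i)) ≤ Q :=
    Finset.sum_le_sum fun i _ => perimeter_equivDisk_le (hr i) (hvol i)
  set x := interfaceLength E with hx
  set S := ∑ i, perimeter (E i) with hS
  have hP0 : ∀ i, 0 ≤ perimeter (E i) := fun i => ENNReal.toReal_nonneg
  have hxP : ∀ i j, x i j ≤ perimeter (E i) := interfaceLength_le_perimeter hcurv
  have hx0 : ∀ i j, 0 ≤ x i j := interfaceLength_nonneg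
  have hcontact : ∀ i j, contact E i j = if 0 < x i j then 1 else 0 := contact_eq_ite hcurv
  have hterm : ∀ i j, 0 ≤ contact E i j * (2 * r i * r j / (r i + r j)) := fun i j => by
    have := hr i
    have := hr j
    rw [hcontact]
    split_ifs <;> positivity
  -- For large `S` the interfaces have total length at most `N S`, so that `P_ε ≥ S - ε N S ≥ S / 2
  -- ≥ Q`.
  rcases le_total (2 * Q) S with hbig | hsmall
  · have h1 : ∑ i, ∑ j ∈ Finset.Ioi i, x i j ≤ N * S := by
      rw [hS, Finset.mul_sum]
      refine Finset.sum_le_sum fun i _ => ?_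
      refine (Finset.sum_le_sum_of_subset_of_nonneg (Finset.subset_univ _) fun j _ _ => hx0 i j).trans ?_
      refine (Finset.sum_le_sum fun j _ => hxP i j).trans_eq ?_
      simp
    have h2 : 0 ≤ ∑ i, ∑ j ∈ Finset.Ioi i, contact E i j * (2 * r i * r j / (r i + r j)) :=
      Finset.sum_nonneg fun i _ => Finset.sum_nonneg fun j _ => hterm i j
    have h3 : 0 ≤ 4 / 3 * ε ^ (3 / 2 : ℝ) *
        ∑ i, ∑ j ∈ Finset.Ioi i, contact E i j * (2 * r i * r j / (r i + r j)) := by positivity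
    have h4 : 0 ≤ (∑ i : Fin N, ∑ j ∈ Finset.Ioi i, C) * ε ^ (5 / 2 : ℝ) :=
      mul_nonneg (Finset.sum_nonneg fun i _ => Finset.sum_nonneg fun j _ => hC) (by positivity)
    have h5 := mul_le_mul_of_nonneg_left h1 hε.le
    have hS0 : 0 ≤ S := by linarith
    have h6 := mul_le_mul_of_nonneg_right hε2.le hS0
    have h7 : 0 ≤ ε * S := mul_nonneg hε.le hS0
    linarith
  · have hm0 : ∀ i j, 0 ≤ min (x i j) ℓ₀ := fun i j => le_min (hx0 i j) hℓ0.le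
    have hℓβ : 8 * (N + 1) * β * ℓ₀ ≤ 1 := by
      rw [le_div_iff₀ (by positivity)] at hℓ1
      linarith
    have hmβ : ∀ i j, 8 * (N + 1) * β * min (x i j) ℓ₀ ≤ 1 := fun i j =>
      (mul_le_mul_of_nonneg_left (min_le_right _ _) (by positivity)).trans hℓβ
    obtain ⟨κ, hκ, hdef⟩ := exists_deficits hr hE hvol hcurv hshare
      (m := fun i j => min (x i j) ℓ₀) hm0 (fun i j => by rw [hx, interfaceLength_comm])
      (fun i j => min_le_left _ _) (fun i j => by
        refine (mul_le_mul_of_nonneg_right (hbβ i) (hm0 i j)).trans ?_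
        have h1 := hmβ i j
        have h2 : 0 ≤ β * min (x i j) ℓ₀ := mul_nonneg hβ0.le (hm0 i j)
        have h3 : 0 ≤ N * (β * min (x i j) ℓ₀) := mul_nonneg (Nat.cast_nonneg N) h2
        linarith)
    have hkey : ∀ i, ∀ j ∈ Finset.Ioi i,
        ε * x i j - 4 / 3 * ε ^ (3 / 2 : ℝ) * (contact E i j * (2 * r i * r j / (r i + r j))) -
          C * ε ^ (5 / 2 : ℝ) ≤
        deficit N (1 / r i) (κ i j) (min (x i j) ℓ₀) +
          deficit N (1 / r j) (-κ i j) (min (x i j) ℓ₀) := by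
      intro i j hj
      have hij := Finset.mem_Ioi.1 hj
      -- Without contact the term with `ε^(3/2)` and both deficits are zero.
      rcases (hx0 i j).eq_or_lt with h0 | hpos
      · rw [hcontact, ← h0, min_eq_left hℓ0.le, deficit_zero, deficit_zero]
        have : 0 ≤ C * ε ^ (5 / 2 : ℝ) := by positivity
        simpa using this
      · have hPS : perimeter (E i) ≤ S := Finset.single_le_sum (fun j _ => hP0 j) (Finset.mem_univ i)
        have h1 := hpair ε hε hε1 (1 / r i + 1 / r j) ((hσ i).trans (by linarith [hrinv j])) (x i j)
          hpos.le ((hxP i j).trans (hPS.trans hsmall))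
        have h2 := le_deficit_add_deficit (Nat.cast_nonneg N) (hrinv i) (hrinv j) (hbβ i) (hbβ j)
          (hm0 i j) (hmβ i j) (hκ i j hij)
        rw [hcontact, if_pos hpos, one_mul, two_mul_mul_div_add_eq (hr i) (hr j)]
        linarith
    have hsum := Finset.sum_le_sum fun i (_ : i ∈ Finset.univ) => Finset.sum_le_sum (hkey i)
    simp only [Finset.sum_sub_distrib, ← Finset.mul_sum] at hsum
    have hCsum : (∑ i : Fin N, ∑ j ∈ Finset.Ioi i, C) * ε ^ (5 / 2 : ℝ) =
        C * ∑ i : Fin N, ∑ j ∈ Finset.Ioi i, ε ^ (5 / 2 : ℝ) := by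
      simp only [Finset.sum_mul, Finset.mul_sum]
    linarith
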